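/- Let $a_n>0$, $b_n\in\mathbb R$ ($n=0,1,2,\dots$), let $J_0$ be the minimal Jacobi operator in $\ell^2(\mathbb Z_+)$, $(J_0u)_n=a_{n-1}u_{n-1}+b_nu_n+a_nu_{n+1}$ with $a_{-1}=0$, defined on sequences with finitely many non-zero components, and let $J$ be a self-adjoint extension of $J_0$ with spectral measure $E$. Put $d\rho(\lambda)=d(E(\lambda)e_0,e_0)$, $e_0=(1,0,0,\dots)$, and let $P_n$ be the polynomials with $P_0=1$ and $a_{n-1}P_{n-1}(\lambda)+b_nP_n(\lambda)+a_nP_{n+1}(\lambda)=\lambda P_n(\lambda)$ for $n\ge 0$. Let $\Lambda\subset\mathbb R$ be an open interval (bounded or not) on which $d\rho(\lambda)=\tau(\lambda)\,d\lambda$ with $\tau\in C^\infty(\Lambda)$, $\tau>0$. Suppose that for $\lambda\in\Lambda$ $$P_n(\lambda)=2\kappa(\lambda)v_n\cos\bigl(\omega(\lambda)x_n+\Phi_n(\lambda)\bigr)+\epsilon_n(\lambda),$$ where $x_n$, $v_n$ are real, $x_{n+1}>x_n$, $x_n\to\infty$, $v_n>0$, and $\sum_{n} v_n^2|x_n|^{-2k}<\infty$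 for some $k>0$ (omitting the at most one index with $x_n=0$); $\omega,\kappa\in C^\infty(\Lambda)$ are real with $\kappa>0$, $\omega'>0$; the functions $\Phi_n\in C^\infty(\Lambda)$ are real with $\Phi_n^{(k)}(\lambda)=o(x_n)$ for $k=1,2$ and $\Phi_n^{(k)}(\lambda)=O(x_n)$ for every $k\ge3$, as $n\to\infty$, uniformly on compact subsets of $\Lambda$; and $\sum_n|\epsilon_n(\lambda)|^2$ is bounded uniformly on compact subsets of $\Lambda$. Let $\Delta=\omega(\Lambda)$, let $\theta\in C^\infty(\Delta)$ be real with $\theta'>0$ and $\theta''\ne0$ on $\Delta$, put $\mathcal I=\theta'(\Delta)$, and let $h:\mathcal I\to\Delta$ be the inverse function of $\theta'$. For $f\in C_0^\infty(\Lambda)$ (complex-valued) define $$F(\mu)=\omega'(\lambda)^{-1}\kappa(\lambda)\sqrt{\tau(\lambda)}\,f(\lambda)\quad\text{for }\mu=\omega(\lambda),\ \lambda\in\Lambda,\qquad \mathcal F(\xi)=\sqrt{|h'(\xi)|}\,F(h(\xi)),\quad \xi\in\mathcal I.$$ Then for every $t>0$ the series below converges, and $$2\pi\lim_{t\to\infty}t^{-1}\sum_{n:\,x_n/t\in\mathcal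 I}v_n^2\,|\mathcal F(x_n/t)|^2=\|f\|^2=\int_\Lambda|f(\lambda)|^2\,d\lambda .$$ -/

import Mathlib

open MeasureTheory Filter Topology

noncomputable section

/-- The Hilbert space of square-summable complex sequences indexed by `0, 1, 2, …`. -/
abbrev EllTwo : Type := lp (fun _ : ℕ => ℂ) 2

/-- The formal Jacobi difference expression
`(J u)_n = a_{n-1} u_{n-1} + b_n u_n + a_n u_{n+1}` with the convention `a_{-1} = 0`. -/
def jacobiSeq (a b : ℕ → ℝ) (u : ℕ → ℂ) : ℕ → ℂ
  | 0 => (b 0 : ℂ) * u 0 + (a 0 : ℂ) * u 1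
  | n + 1 => (a n : ℂ) * u n + (b (n + 1) : ℂ) * u (n + 1) + (a (n + 1) : ℂ) * u (n + 2)

theorem jacobiSeq_finite (a b : ℕ → ℝ) {u : ℕ → ℂ} (hu : {n | u n ≠ 0}.Finite) :
    {n | jacobiSeq a b u n ≠ 0}.Finite := by
  obtain ⟨N, hN⟩ := hu.bddAbove
  have h0 : ∀ n, N < n → u n = 0 := fun n hn => by
    by_contra h
    exact absurd (hN h) (by omega)
  refine (Set.finite_Iic (N + 1)).subset fun n hn => ?_
  by_contra hlt
  simp only [Set.mem_Iic, not_le] at hlt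
  apply hn
  cases n with
  | zero => omega
  | succ n =>
    simp [jacobiSeq, h0 n (by omega), h0 (n + 1) (by omega), h0 (n + 2) (by omega)]

theorem jacobiSeq_add (a b : ℕ → ℝ) (u w : ℕ → ℂ) :
    jacobiSeq a b (u + w) = jacobiSeq a b u + jacobiSeq a b w := by
  ext n
  cases n <;> simp [jacobiSeq] <;> ring

theorem jacobiSeq_smul (a b : ℕ → ℝ) (c : ℂ) (u : ℕ → ℂ) :
    jacobiSeq a b (c • u) = c • jacobiSeq a b u := by
  ext n
  cases n <;> simp [jacobiSeq] <;> ring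

/-- The minimal symmetric Jacobi operator: the formal Jacobi expression on the sequences with
only finitely many non-zero components. -/
def minimalJacobi (a b : ℕ → ℝ) : EllTwo →ₗ.[ℂ] EllTwo where
  domain :=
    { carrier := {u | {n | u n ≠ 0}.Finite}
      zero_mem' := by simp
      add_mem' := fun {u w} hu hw => (hu.union hw).subset fun n hn => by
        by_contra h
        simp only [Set.mem_union, Set.mem_ofPred_eq, not_or, not_not] at h
        exact hn (by simp [h.1, h.2])
      smul_mem' := fun c u hu => hu.subset fun n hn h => hn (by simp [h]) }
  toFun :=
    { toFun := fun u => ⟨jacobiSeq a b u.1,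
        (memℓp_zero (jacobiSeq_finite a b u.2)).of_exponent_ge zero_le⟩
      map_add' := fun u w => by
        apply Subtype.ext
        exact jacobiSeq_add a b u.1 w.1
      map_smul' := fun c u => by
        apply Subtype.ext
        exact jacobiSeq_smul a b c u.1 }

/-- The polynomials `P_n` with `P_0 = 1` and
`a_{n-1} P_{n-1} + b_n P_n + a_n P_{n+1} = z P_n` for all `n ≥ 0`, where `a_{-1} = 0`. -/
def orthoPoly (a b : ℕ → ℝ) : ℕ → Polynomial ℝ
  | 0 => 1
  | 1 => Polynomial.C (a 0)⁻¹ * (Polynomial.X - Polynomial.C (b 0))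
  | n + 2 => Polynomial.C (a (n + 1))⁻¹ *
      ((Polynomial.X - Polynomial.C (b (n + 1))) * orthoPoly a b (n + 1)
        - Polynomial.C (a n) * orthoPoly a b n)

/-- A projection-valued measure on the Borel sets of `ℝ` acting in `EllTwo`
(the values on non-measurable sets play no role). -/
structure ProjValuedMeasure where
  proj : Set ℝ → (EllTwo →L[ℂ] EllTwo)
  isStarProjection : ∀ B, MeasurableSet B → IsStarProjection (proj B)
  univ : proj Set.univ = 1
  inter : ∀ A B, MeasurableSet A → MeasurableSet B → proj (A ∩ B) = proj A * proj B
  hasSum_iUnion : ∀ B : ℕ → Set ℝ, (∀ i, MeasurableSet (B i)) →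
    Pairwise (Function.onFun Disjoint B) →
    ∀ u : EllTwo, HasSum (fun i => proj (B i) u) (proj (⋃ i, B i) u)

theorem ProjValuedMeasure.inner_nonneg (E : ProjValuedMeasure) (u : EllTwo) {B : Set ℝ}
    (hB : MeasurableSet B) : 0 ≤ (inner ℂ u (E.proj B u)).re := by
  have h := E.isStarProjection B hB
  have h1 : E.proj B (E.proj B u) = E.proj B u :=
    congrArg (fun T : EllTwo →L[ℂ] EllTwo => T u) h.isIdempotentElem.eq
  have h2 := (ContinuousLinearMap.isSelfAdjoint_iff_isSymmetric.1 h.isSelfAdjoint) u (E.proj B u)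
  simp only [ContinuousLinearMap.coe_coe] at h2
  rw [h1] at h2
  rw [← h2]
  exact inner_self_nonneg (𝕜 := ℂ)

/-- The scalar measure `B ↦ (E(B) u, u)`. -/
def ProjValuedMeasure.diag (E : ProjValuedMeasure) (u : EllTwo) : Measure ℝ :=
  Measure.ofMeasurable (fun B _ => ENNReal.ofReal (inner ℂ u (E.proj B u)).re)
    (by
      have h := E.hasSum_iUnion (fun _ => ∅) (fun _ => MeasurableSet.empty)
        (fun _ _ _ => disjoint_bot_left) u
      have h0 : E.proj ∅ u = 0 := by
        simpa using tendsto_nhds_unique h.summable.tendsto_atTop_zero tendsto_const_nhds |>.symm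
      simp [h0])
    (by
      intro B hB hd
      have h := E.hasSum_iUnion B hB hd u
      have h1 : HasSum (fun i => (inner ℂ u (E.proj (B i) u)).re)
          (inner ℂ u (E.proj (⋃ i, B i) u)).re :=
        ((Complex.reCLM.restrictScalars ℝ).hasSum ((innerSL ℂ u).hasSum h))
      rw [← h1.tsum_eq]
      exact ENNReal.ofReal_tsum_of_nonneg (fun i => E.inner_nonneg u (hB i)) h1.summable)

/-- `E` is the spectral measure of the operator `J`, that is, `J = ∫ μ dE(μ)`: the domain of `J`
consists of all `u` with `∫ μ² d(E(μ)u, u) < ∞`, and `(Ju, u) = ∫ μ d(E(μ)u, u)` for such `u`. -/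
structure ProjValuedMeasure.IsSpectralMeasureOf (E : ProjValuedMeasure)
    (J : EllTwo →ₗ.[ℂ] EllTwo) : Prop where
  mem_domain_iff : ∀ u : EllTwo, u ∈ J.domain ↔ Integrable (fun y : ℝ => y ^ 2) (E.diag u)
  inner_apply : ∀ u : J.domain,
    inner ℂ (u : EllTwo) (J u) = ((∫ y : ℝ, y ∂(E.diag (u : EllTwo)) : ℝ) : ℂ)

/-- The scalar spectral measure `B ↦ (E(B) e_0, e_0)`, where `e_0 = (1, 0, 0, …)`. -/
def ProjValuedMeasure.scalar (E : ProjValuedMeasure) : Measure ℝ :=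
  E.diag (lp.single 2 0 (1 : ℂ))

/-- The remainder `P_n(y) - 2 κ(y) v_n cos (ω(y) x_n + Φ_n(y))`. -/
def remainder (a b : ℕ → ℝ) (κ ω : ℝ → ℝ) (v x : ℕ → ℝ) (Φ : ℕ → ℝ → ℝ) (n : ℕ) (y : ℝ) : ℝ :=
  (orthoPoly a b n).eval y - 2 * κ y * v n * Real.cos (ω y * x n + Φ n y)

/-- The asymptotic assumption on the orthonormal polynomials on the interval `Λ`. All estimates
are uniform on compact subsets of `Λ`. Since `x_n → ∞`, at most finitely many `x_n` are `≤ 0`,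
and these do not influence the summability condition. -/
structure PolynomialAsymptotics (a b : ℕ → ℝ) (Λ : Set ℝ) (κ ω : ℝ → ℝ) (v x : ℕ → ℝ)
    (Φ : ℕ → ℝ → ℝ) : Prop where
  x_strictMono : StrictMono x
  x_tendsto : Tendsto x atTop atTop
  v_pos : ∀ n, 0 < v n
  summable : ∃ k : ℝ, 0 < k ∧ Summable fun n => v n ^ 2 * |x n| ^ (-(2 * k))
  ω_smooth : ContDiffOn ℝ (⊤ : ℕ∞) ω Λ
  κ_smooth : ContDiffOn ℝ (⊤ : ℕ∞) κ Λ
  κ_pos : ∀ y ∈ Λ, 0 < κ y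
  ω_deriv_pos : ∀ y ∈ Λ, 0 < deriv ω y
  Φ_smooth : ∀ n, ContDiffOn ℝ (⊤ : ℕ∞) (Φ n) Λ
  Φ_little : ∀ K ⊆ Λ, IsCompact K → ∀ k : ℕ, k = 1 ∨ k = 2 → ∀ ε > 0, ∀ᶠ n in atTop,
    ∀ y ∈ K, |iteratedDeriv k (Φ n) y| ≤ ε * x n
  Φ_big : ∀ K ⊆ Λ, IsCompact K → ∀ k : ℕ, 3 ≤ k → ∃ C : ℝ, ∀ᶠ n in atTop,
    ∀ y ∈ K, |iteratedDeriv k (Φ n) y| ≤ C * x n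
  remainder_bound : ∀ K ⊆ Λ, IsCompact K → ∃ C : ℝ, ∀ y ∈ K,
    Summable (fun n => remainder a b κ ω v x Φ n y ^ 2) ∧
      ∑' n, remainder a b κ ω v x Φ n y ^ 2 ≤ C

/-- The function `F` on `Δ = ω(Λ)` given by `F(μ) = ω'(y)⁻¹ κ(y) √τ(y) f(y)` for
`μ = ω(y)`, `y ∈ Λ`. -/
def transportedAmplitude (Λ : Set ℝ) (τ κ ω : ℝ → ℝ) (f : ℝ → ℂ) (μ : ℝ) : ℂ :=
  let y := Function.invFunOn ω Λ μ
  (((deriv ω y)⁻¹ * (κ y * √(τ y)) : ℝ) : ℂ) * f y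

/-- The inverse function `h : θ'(Δ) → Δ` of `θ'`, where `Δ = ω(Λ)`. -/
def derivInverse (Λ : Set ℝ) (ω θ : ℝ → ℝ) : ℝ → ℝ :=
  Function.invFunOn (deriv θ) (ω '' Λ)

/-- The function `𝓕(ξ) = √|h'(ξ)| F(h(ξ))`, for `ξ ∈ θ'(ω(Λ))`. -/
def evolutionProfile (Λ : Set ℝ) (τ κ ω θ : ℝ → ℝ) (f : ℝ → ℂ) (ξ : ℝ) : ℂ :=
  ((√|deriv (derivInverse Λ ω θ) ξ| : ℝ) : ℂ) *
    transportedAmplitude Λ τ κ ω f (derivInverse Λ ω θ ξ)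

end

/-! The sum is the asymptotic form of a conserved norm. The map `g ↦ g(J) e_0` is an isometry of
`L²(dρ)` into `ℓ²`, and the `n`-th component of `g(J) e_0` is `∫ P_n g dρ`, by induction along the
three-term recurrence. Take `g = τ^{-1/2} e^{-itχ} f` with `χ = θ ∘ ω`. Since the factor `e^{-itχ}`
is unimodular, `∑_n |∫ P_n √τ f e^{-itχ} dλ|² = ‖f‖²` for all `t` (`hasSum_norm_sq_of_density`).

Insert the asymptotics of `P_n`, writing the cosine as two exponentials. The exponential with phase
`-(ω x_n + Φ_n) - tχ` has no stationary point, because `ω'` and `χ'` are both positive and `Φ_n' =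
o(x_n)`. Repeated integration by parts bounds its integral by `C (x_n + t)^{-m}`, and `∑ v_n²
|x_n|^{-2k} < ∞` makes the terms dominated. The contribution of `ε_n` is dominated through
Cauchy–Schwarz. Each single term tends to zero as `t → ∞`, so both contributions vanish in `ℓ²`.
With `I_n(t) = ∫ κ √τ f e^{i(ω x_n + Φ_n - tχ)} dλ` this leaves `∑ v_n² |I_n(t)|² → ‖f‖²`
(`tendsto_tsum_phaseIntegral`).

Put `q = θ' ∘ ω`. The phase derivative in `I_n(t)` is `ω' (x_n - q t) + Φ_n'`, so a stationary point
needs the velocity `x_n / t` close to a value of `q` on `supp f`. Velocities outside a compact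
window `[p, P]` are discarded by the same domination argument. Inside the window, stationary phase
gives `t |I_n(t)|² = 2π D(x_n / t) + o(1)` with `D = |κ √τ f|² / (ω' |q'|)` taken at the solution of
`q = x_n / t`. Only `Φ_n', Φ_n'' = o(x_n)` matters here: the values of `Φ_n` affect the phase of the
integral but not its modulus. A compactness argument makes the error uniform in the window.

Summing the errors requires `t^{-1} ∑ v_n² = O(1)` over the window. This follows from the same
conservation law applied to an auxiliary function whose density `D` is bounded below on the window
(`exists_sum_velocityWindow_le`). Finally, `D = |𝓕|²` by the chain rule
(`norm_evolutionProfile_sq`). -/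

open scoped InnerProductSpace

/-! ### Cyclic subspaces of a projection-valued measure. -/

namespace ProjValuedMeasure

variable (E : ProjValuedMeasure)

theorem diag_apply (u : EllTwo) {B : Set ℝ} (hB : MeasurableSet B) :
    E.diag u B = ENNReal.ofReal (inner ℂ u (E.proj B u)).re :=
  Measure.ofMeasurable_apply B hB

theorem inner_proj_proj (u w : EllTwo) {A B : Set ℝ} (hA : MeasurableSet A)
    (hB : MeasurableSet B) :
    inner ℂ (E.proj A u) (E.proj B w) = inner ℂ u (E.proj (A ∩ B) w) := by
  have h := (ContinuousLinearMap.isSelfAdjoint_iff_isSymmetric.1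
    (E.isStarProjection A hA).isSelfAdjoint) u (E.proj B w)
  simp only [ContinuousLinearMap.coe_coe] at h
  rw [h, E.inter A B hA hB]
  rfl

theorem inner_proj_left (u w : EllTwo) {A : Set ℝ} (hA : MeasurableSet A) :
    inner ℂ (E.proj A u) w = inner ℂ u (E.proj A w) := by
  have h := (ContinuousLinearMap.isSelfAdjoint_iff_isSymmetric.1
    (E.isStarProjection A hA).isSelfAdjoint) u w
  simpa only [ContinuousLinearMap.coe_coe] using h

theorem proj_proj (u : EllTwo) {A B : Set ℝ} (hA : MeasurableSet A) (hB : MeasurableSet B) :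
    E.proj A (E.proj B u) = E.proj (A ∩ B) u := by
  rw [E.inter A B hA hB]
  rfl

theorem inner_proj_self (u : EllTwo) {B : Set ℝ} (hB : MeasurableSet B) :
    inner ℂ u (E.proj B u) = ((‖E.proj B u‖ ^ 2 : ℝ) : ℂ) := by
  rw [← Set.inter_self B, ← E.inner_proj_proj u u hB hB, Set.inter_self,
    inner_self_eq_norm_sq_to_K]
  simp

theorem diag_apply_norm (u : EllTwo) {B : Set ℝ} (hB : MeasurableSet B) :
    E.diag u B = ENNReal.ofReal (‖E.proj B u‖ ^ 2) := by
  rw [E.diag_apply u hB, E.inner_proj_self u hB, Complex.ofReal_re]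

instance isFiniteMeasure_diag (u : EllTwo) : IsFiniteMeasure (E.diag u) :=
  ⟨by rw [E.diag_apply u MeasurableSet.univ]; exact ENNReal.ofReal_lt_top⟩

theorem inner_proj_eq_diag (u : EllTwo) {B : Set ℝ} (hB : MeasurableSet B) :
    inner ℂ u (E.proj B u) = (((E.diag u).real B : ℝ) : ℂ) := by
  rw [measureReal_def, E.diag_apply_norm u hB, ENNReal.toReal_ofReal (by positivity),
    E.inner_proj_self u hB]

/-- The formal combinations of spectral projections applied to `u`. -/
noncomputable def cyclicSum (u : EllTwo) : ({B : Set ℝ // MeasurableSet B} →₀ ℂ) →ₗ[ℂ] EllTwo :=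
  Finsupp.linearCombination ℂ fun B => E.proj B.1 u

/-- The simple functions, as elements of `L²`. -/
noncomputable def simpleSum (u : EllTwo) :
    ({B : Set ℝ // MeasurableSet B} →₀ ℂ) →ₗ[ℂ] Lp ℂ 2 (E.diag u) :=
  Finsupp.linearCombination ℂ fun B => indicatorConstLp 2 B.2 (measure_ne_top _ _) (1 : ℂ)

/-- The vectors `E(A)u` and the indicators of `A` have the same Gram matrix, with entries `E_u(A ∩
B)`. This makes the correspondence isometric, hence extendable to all of `L²(dE_u)`. -/
theorem inner_cyclicSum (u : EllTwo) (c d : {B : Set ℝ // MeasurableSet B} →₀ ℂ) :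
    inner ℂ (E.cyclicSum u c) (E.cyclicSum u d) = inner ℂ (E.simpleSum u c) (E.simpleSum u d) := by
  simp only [cyclicSum, simpleSum, Finsupp.linearCombination_apply, Finsupp.sum, sum_inner,
    inner_sum, inner_smul_left, inner_smul_right]
  refine Finset.sum_congr rfl fun A _ => congrArg _ (Finset.sum_congr rfl fun B _ => congrArg _ ?_)
  rw [E.inner_proj_proj u u B.2 A.2, E.inner_proj_eq_diag u (B.2.inter A.2),
    L2.inner_indicatorConstLp_indicatorConstLp]
  simp

theorem norm_cyclicSum (u : EllTwo) (c : {B : Set ℝ // MeasurableSet B} →₀ ℂ) :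
    ‖E.cyclicSum u c‖ = ‖E.simpleSum u c‖ := by
  have h := E.inner_cyclicSum u c c
  rw [inner_self_eq_norm_sq_to_K, inner_self_eq_norm_sq_to_K] at h
  have h' : ‖E.cyclicSum u c‖ ^ 2 = ‖E.simpleSum u c‖ ^ 2 := by exact_mod_cast h
  exact (pow_left_inj₀ (norm_nonneg _) (norm_nonneg _) two_ne_zero).1 h'

theorem denseRange_simpleSum (u : EllTwo) : DenseRange (E.simpleSum u) := by
  intro g
  induction g using Lp.induction (p := 2) (by norm_num) with
  | indicatorConst c hs hμs =>
    apply subset_closure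
    refine ⟨Finsupp.single ⟨_, hs⟩ c, ?_⟩
    simp only [simpleSum, Finsupp.linearCombination_single, Lp.simpleFunc.coe_indicatorConst]
    ext1
    filter_upwards [Lp.coeFn_smul c (indicatorConstLp 2 hs (measure_ne_top (E.diag u) _) (1 : ℂ)),
      indicatorConstLp_coeFn (p := 2) (hs := hs)
        (hμs := measure_ne_top (E.diag u) _) (c := (1 : ℂ)),
      indicatorConstLp_coeFn (p := 2) (hs := hs)
        (hμs := measure_ne_top (E.diag u) _) (c := c)] with y h1 h2 h3
    rw [h1, h3, Pi.smul_apply, h2]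
    simp [Set.indicator]
  | @add f g hf hg hd hfc hgc =>
    have := (E.simpleSum u).range.topologicalClosure.add_mem hfc hgc
    exact this
  | isClosed => exact isClosed_closure

/-- The isometry `L²(dE_u) → ℓ²`, `g ↦ g(J) u`. -/
noncomputable def cyclicMap (u : EllTwo) : Lp ℂ 2 (E.diag u) →L[ℂ] EllTwo :=
  (E.cyclicSum u).extendOfNorm (E.simpleSum u)

theorem cyclicMap_simpleSum (u : EllTwo) (c : {B : Set ℝ // MeasurableSet B} →₀ ℂ) :
    E.cyclicMap u (E.simpleSum u c) = E.cyclicSum u c :=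
  LinearMap.extendOfNorm_eq (E.denseRange_simpleSum u)
    ⟨1, fun c => by rw [E.norm_cyclicSum, one_mul]⟩ c

theorem inner_cyclicMap (u : EllTwo) (g h : Lp ℂ 2 (E.diag u)) :
    inner ℂ (E.cyclicMap u g) (E.cyclicMap u h) = inner ℂ g h := by
  refine (E.denseRange_simpleSum u).induction_on₂
    (p := fun g h => inner ℂ (E.cyclicMap u g) (E.cyclicMap u h) = inner ℂ g h) ?_ ?_ g h
  · exact isClosed_eq (by fun_prop) (by fun_prop)
  · intro c d
    rw [cyclicMap_simpleSum, cyclicMap_simpleSum, inner_cyclicSum]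

/-- Multiplication by the indicator function of `B` in `L²(dE_u)`. -/
noncomputable def cutoff (u : EllTwo) {B : Set ℝ} (hB : MeasurableSet B) :
    Lp ℂ 2 (E.diag u) →L[ℂ] Lp ℂ 2 (E.diag u) :=
  (ContinuousLinearMap.lsmul ℂ ℂ).holderL (E.diag u) ⊤ 2 2
    (indicatorConstLp ⊤ hB (measure_ne_top _ _) (1 : ℂ))

theorem coeFn_cutoff (u : EllTwo) {B : Set ℝ} (hB : MeasurableSet B) (g : Lp ℂ 2 (E.diag u)) :
    E.cutoff u hB g =ᵐ[E.diag u] B.indicator g := by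
  have h := ContinuousLinearMap.coeFn_holder (r := 2) (ContinuousLinearMap.lsmul ℂ ℂ)
    (indicatorConstLp ⊤ hB (measure_ne_top (E.diag u) _) (1 : ℂ)) g
  have h' : E.cutoff u hB g = (ContinuousLinearMap.lsmul ℂ ℂ).holder (r := 2)
    (indicatorConstLp ⊤ hB (measure_ne_top (E.diag u) _) (1 : ℂ)) g := rfl
  rw [h']
  filter_upwards [h, indicatorConstLp_coeFn (p := ⊤) (hs := hB)
    (hμs := measure_ne_top (E.diag u) _) (c := (1 : ℂ))] with y h1 h2
  rw [h1, h2]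
  by_cases hy : y ∈ B <;> simp [hy]

/-- On indicators this is `E(B)E(A) = E(A ∩ B)`; the general case follows by linearity and density.
-/
theorem proj_cyclicMap (u : EllTwo) {B : Set ℝ} (hB : MeasurableSet B) (g : Lp ℂ 2 (E.diag u)) :
    E.proj B (E.cyclicMap u g) = E.cyclicMap u (E.cutoff u hB g) := by
  refine (E.denseRange_simpleSum u).induction_on
    (p := fun g => E.proj B (E.cyclicMap u g) = E.cyclicMap u (E.cutoff u hB g)) g ?_ ?_
  · exact isClosed_eq (by fun_prop) (by fun_prop)
  · intro c
    induction c using Finsupp.induction_linear with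
    | zero => simp
    | add c d hc hd => simp only [map_add, hc, hd]
    | single A c =>
      have h0 : E.cutoff u hB (indicatorConstLp 2 A.2 (measure_ne_top _ _) (1 : ℂ)) =
          indicatorConstLp 2 (A.2.inter hB) (measure_ne_top _ _) (1 : ℂ) := by
        ext1
        filter_upwards [E.coeFn_cutoff u hB (indicatorConstLp 2 A.2 (measure_ne_top _ _) (1 : ℂ)),
          indicatorConstLp_coeFn (p := 2) (hs := A.2)
            (hμs := measure_ne_top (E.diag u) _) (c := (1 : ℂ)),
          indicatorConstLp_coeFn (p := 2) (hs := A.2.inter hB)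
            (hμs := measure_ne_top (E.diag u) _) (c := (1 : ℂ))] with y h1 h2 h3
        rw [h1, h3, Set.inter_comm, ← Set.indicator_indicator]
        by_cases hy : y ∈ B <;> simp [hy, h2]
      have h1 : E.cutoff u hB (E.simpleSum u (Finsupp.single A c)) =
          E.simpleSum u (Finsupp.single ⟨A.1 ∩ B, A.2.inter hB⟩ c) := by
        simp only [simpleSum, Finsupp.linearCombination_single, map_smul, h0]
      rw [h1, cyclicMap_simpleSum, cyclicMap_simpleSum]
      simp only [cyclicSum, Finsupp.linearCombination_single, map_smul]
      rw [E.proj_proj u hB A.2, Set.inter_comm]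

theorem cyclicMap_one (u : EllTwo) :
    E.cyclicMap u (indicatorConstLp 2 MeasurableSet.univ (measure_ne_top _ _) (1 : ℂ)) = u := by
  have h := E.cyclicMap_simpleSum u (Finsupp.single ⟨Set.univ, MeasurableSet.univ⟩ 1)
  simp only [cyclicSum, simpleSum, Finsupp.linearCombination_single, one_smul, E.univ] at h
  exact h

end ProjValuedMeasure

/-! ### The operator as multiplication by the independent variable. -/

namespace ProjValuedMeasure

variable (E : ProjValuedMeasure)

theorem proj_empty (u : EllTwo) : E.proj ∅ u = 0 := by
  have h := E.hasSum_iUnion (fun _ => ∅) (fun _ => MeasurableSet.empty)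
    (fun _ _ _ => disjoint_bot_left) u
  simpa using tendsto_nhds_unique h.summable.tendsto_atTop_zero tendsto_const_nhds |>.symm

theorem diag_compl_eq_zero {u : EllTwo} {B : Set ℝ} (hB : MeasurableSet B)
    (hu : E.proj B u = u) : E.diag u Bᶜ = 0 := by
  rw [E.diag_apply_norm u hB.compl, ← hu, E.proj_proj u hB.compl hB, Set.compl_inter_self,
    proj_empty]
  simp

/-- The cross terms `(E(B)u, w)` vanish. This additivity is what permits polarization of the
quadratic form that characterizes the spectral measure. -/
theorem diag_add {u w : EllTwo}
    (h : ∀ B, MeasurableSet B → inner ℂ w (E.proj B u) = 0) :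
    E.diag (u + w) = E.diag u + E.diag w := by
  ext B hB
  have h1 : inner ℂ u (E.proj B w) = 0 := by
    rw [← E.inner_proj_left u w hB, ← inner_conj_symm, h B hB, map_zero]
  have e1 := E.inner_proj_self u hB
  have e2 := E.inner_proj_self w hB
  rw [Measure.add_apply, E.diag_apply _ hB, E.diag_apply _ hB, E.diag_apply _ hB,
    ← ENNReal.ofReal_add (by rw [e1, Complex.ofReal_re]; positivity)
      (by rw [e2, Complex.ofReal_re]; positivity)]
  congr 1
  rw [map_add, inner_add_left, inner_add_right, inner_add_right, h B hB, h1]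
  simp

/-- The intervals exhaust the line, so `‖z‖²`, the total mass of `E_z`, is zero. -/
theorem eq_zero_of_proj_Icc {z : EllTwo} {N : ℕ}
    (h : ∀ M : ℕ, N ≤ M → E.proj (Set.Icc (-(M : ℝ)) M) z = 0) : z = 0 := by
  have h1 : E.diag z (⋃ M : ℕ, Set.Icc (-((M + N : ℕ) : ℝ)) ((M + N : ℕ) : ℝ)) = 0 := by
    refine measure_iUnion_null fun M => ?_
    rw [E.diag_apply_norm z measurableSet_Icc, h _ (Nat.le_add_left N M)]
    simp
  have h2 : (⋃ M : ℕ, Set.Icc (-((M + N : ℕ) : ℝ)) ((M + N : ℕ) : ℝ)) = Set.univ := by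
    refine Set.eq_univ_of_forall fun y => Set.mem_iUnion.2 ?_
    obtain ⟨M, hM⟩ := exists_nat_ge |y|
    refine ⟨M, abs_le.1 (hM.trans ?_)⟩
    push_cast
    linarith [(Nat.cast_nonneg N : (0 : ℝ) ≤ N)]
  rw [h2, E.diag_apply_norm z MeasurableSet.univ, E.univ, ENNReal.ofReal_eq_zero] at h1
  have h3 : ‖z‖ ^ 2 ≤ 0 := h1
  simpa using le_antisymm h3 (by positivity)

theorem memLp_position (u : EllTwo) (N : ℕ) :
    MemLp ((Set.Icc (-(N : ℝ)) N).indicator (fun y : ℝ => (y : ℂ))) ⊤ (E.diag u) := by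
  refine memLp_top_of_bound ?_ N (ae_of_all _ fun y => ?_)
  · exact (Complex.measurable_ofReal.indicator measurableSet_Icc).aestronglyMeasurable
  · by_cases hy : y ∈ Set.Icc (-(N : ℝ)) N
    · simp only [hy, Set.indicator_of_mem, Complex.norm_real]
      exact abs_le.2 hy
    · simp [hy]

/-- Multiplication by `y` on `[-N, N]` and by zero outside of it. -/
noncomputable def position (u : EllTwo) (N : ℕ) : Lp ℂ 2 (E.diag u) →L[ℂ] Lp ℂ 2 (E.diag u) :=
  (ContinuousLinearMap.lsmul ℂ ℂ).holderL (E.diag u) ⊤ 2 2 (E.memLp_position u N).toLp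

theorem coeFn_position (u : EllTwo) (N : ℕ) (g : Lp ℂ 2 (E.diag u)) :
    E.position u N g =ᵐ[E.diag u]
      fun y => (Set.Icc (-(N : ℝ)) N).indicator (fun y : ℝ => (y : ℂ)) y * g y := by
  have h := ContinuousLinearMap.coeFn_holder (r := 2) (ContinuousLinearMap.lsmul ℂ ℂ)
    ((E.memLp_position u N).toLp) g
  have h' : E.position u N g = (ContinuousLinearMap.lsmul ℂ ℂ).holder (r := 2)
    ((E.memLp_position u N).toLp) g := rfl
  rw [h']
  filter_upwards [h, (E.memLp_position u N).coeFn_toLp] with y h1 h2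
  rw [h1, h2]
  simp

theorem diag_cyclicMap (u : EllTwo) (g : Lp ℂ 2 (E.diag u)) :
    E.diag (E.cyclicMap u g) =
      (E.diag u).withDensity fun y => ENNReal.ofReal (‖g y‖ ^ 2) := by
  have hint : Integrable (fun y => ‖g y‖ ^ 2) (E.diag u) := (Lp.memLp g).integrable_norm_pow'
  ext B hB
  rw [withDensity_apply _ hB, ← ofReal_integral_eq_lintegral_ofReal hint.integrableOn
    (ae_of_all _ fun y => by positivity), E.diag_apply _ hB, E.proj_cyclicMap u hB,
    E.inner_cyclicMap, L2.inner_def]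
  have h1 : (∫ y, inner ℂ (g y) (E.cutoff u hB g y) ∂(E.diag u)) =
      ((∫ y in B, ‖g y‖ ^ 2 ∂(E.diag u) : ℝ) : ℂ) := by
    rw [← integral_indicator hB, ← integral_complex_ofReal]
    refine integral_congr_ae ?_
    filter_upwards [E.coeFn_cutoff u hB g] with y hy
    rw [hy]
    by_cases hyB : y ∈ B <;> simp [hyB, inner_self_eq_norm_sq_to_K, -RCLike.inner_apply]
  rw [h1, Complex.ofReal_re]

variable {E} {J : EllTwo →ₗ.[ℂ] EllTwo}

theorem IsSpectralMeasureOf.mem_domain_of_proj (hE : E.IsSpectralMeasureOf J) {u : EllTwo} {N : ℕ}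
    (hu : E.proj (Set.Icc (-(N : ℝ)) N) u = u) : u ∈ J.domain := by
  rw [hE.mem_domain_iff]
  have h0 := E.diag_compl_eq_zero measurableSet_Icc hu
  refine Integrable.of_bound (by fun_prop) ((N : ℝ) ^ 2) ?_
  filter_upwards [compl_mem_ae_iff.2 h0] with y hy
  rw [compl_compl] at hy
  rw [Real.norm_of_nonneg (by positivity)]
  exact sq_le_sq' hy.1 hy.2

theorem IsSpectralMeasureOf.integrable_id (hE : E.IsSpectralMeasureOf J) {u : EllTwo}
    (hu : u ∈ J.domain) : Integrable (fun y : ℝ => y) (E.diag u) := by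
  have h := (hE.mem_domain_iff u).1 hu
  refine (h.add (integrable_const (1 : ℝ))).mono' (by fun_prop) (ae_of_all _ fun y => ?_)
  rw [Real.norm_eq_abs]
  change |y| ≤ y ^ 2 + 1
  rw [← sq_abs]
  nlinarith [sq_nonneg (|y| - 1), abs_nonneg y]

theorem IsSpectralMeasureOf.inner_add_inner_eq_zero (hE : E.IsSpectralMeasureOf J)
    (u w : J.domain) (h : ∀ B, MeasurableSet B → inner ℂ (w : EllTwo) (E.proj B u) = 0) :
    inner ℂ (u : EllTwo) (J w) + inner ℂ (w : EllTwo) (J u) = 0 := by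
  have h1 := hE.inner_apply (u + w)
  have h2 := hE.inner_apply u
  have h3 := hE.inner_apply w
  rw [Submodule.coe_add, E.diag_add h, integral_add_measure (hE.integrable_id u.2)
    (hE.integrable_id w.2), LinearPMap.map_add, Complex.ofReal_add, ← h2, ← h3] at h1
  simp only [inner_add_left, inner_add_right] at h1
  linear_combination h1

/-- Replacing `w` by `i w` in the preceding identity reverses the sign of one summand relative to
the other, so each vanishes. Thus `J u` has no component along vectors of the domain orthogonal to
the cyclic subspace of `u`. -/
theorem IsSpectralMeasureOf.inner_eq_zero (hE : E.IsSpectralMeasureOf J)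
    (u w : J.domain) (h : ∀ B, MeasurableSet B → inner ℂ (w : EllTwo) (E.proj B u) = 0) :
    inner ℂ (w : EllTwo) (J u) = 0 := by
  have h1 := hE.inner_add_inner_eq_zero u w h
  have h2 := hE.inner_add_inner_eq_zero u (Complex.I • w) fun B hB => by
    rw [Submodule.coe_smul, inner_smul_left, h B hB, mul_zero]
  rw [LinearPMap.map_smul, Submodule.coe_smul, inner_smul_left, inner_smul_right, Complex.conj_I] at h2
  have h3 : Complex.I * (2 * inner ℂ (w : EllTwo) (J u)) = 0 := by
    linear_combination Complex.I * h1 - h2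
  simpa using h3

variable (E) in
/-- The functions in `L²(dE_u)` vanishing outside of `[-N, N]`. -/
noncomputable def truncated (u : EllTwo) (N : ℕ) : Submodule ℂ (Lp ℂ 2 (E.diag u)) :=
  LinearMap.eqLocus (E.cutoff u (B := Set.Icc (-(N : ℝ)) N) measurableSet_Icc).toLinearMap
    LinearMap.id

theorem mem_truncated_iff {u : EllTwo} {N : ℕ} {g : Lp ℂ 2 (E.diag u)} :
    g ∈ E.truncated u N ↔ E.cutoff u (B := Set.Icc (-(N : ℝ)) N) measurableSet_Icc g = g :=
  Iff.rfl

theorem mem_truncated_iff_ae {u : EllTwo} {N : ℕ} {g : Lp ℂ 2 (E.diag u)} :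
    g ∈ E.truncated u N ↔ ∀ᵐ y ∂(E.diag u), y ∉ Set.Icc (-(N : ℝ)) N → g y = 0 := by
  rw [mem_truncated_iff]
  have h0 := E.coeFn_cutoff u (B := Set.Icc (-(N : ℝ)) N) measurableSet_Icc g
  constructor
  · intro h
    rw [h] at h0
    filter_upwards [h0] with y hy hyN
    rw [hy, Set.indicator_of_notMem hyN]
  · intro h
    ext1
    filter_upwards [h0, h] with y h1 h2
    rw [h1]
    by_cases hy : y ∈ Set.Icc (-(N : ℝ)) N
    · rw [Set.indicator_of_mem hy]
    · rw [Set.indicator_of_notMem hy, h2 hy]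

theorem truncated_mono (u : EllTwo) {N M : ℕ} (h : N ≤ M) :
    E.truncated u N ≤ E.truncated u M := by
  intro g hg
  rw [mem_truncated_iff_ae] at hg ⊢
  filter_upwards [hg] with y hy hyM
  refine hy fun hyN => hyM ⟨?_, ?_⟩
  · exact (neg_le_neg (Nat.cast_le.2 h)).trans hyN.1
  · exact hyN.2.trans (Nat.cast_le.2 h)

theorem coeFn_position_of_mem {u : EllTwo} {N : ℕ} {g : Lp ℂ 2 (E.diag u)}
    (hg : g ∈ E.truncated u N) : E.position u N g =ᵐ[E.diag u] fun y => (y : ℂ) * g y := by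
  filter_upwards [E.coeFn_position u N g, mem_truncated_iff_ae.1 hg] with y h1 h2
  rw [h1]
  by_cases hy : y ∈ Set.Icc (-(N : ℝ)) N
  · rw [Set.indicator_of_mem hy]
  · rw [h2 hy, mul_zero, mul_zero]

theorem position_mem_truncated {u : EllTwo} {N : ℕ} {g : Lp ℂ 2 (E.diag u)}
    (hg : g ∈ E.truncated u N) : E.position u N g ∈ E.truncated u N := by
  rw [mem_truncated_iff_ae] at *
  filter_upwards [E.coeFn_position u N g, hg] with y h1 h2 h3
  rw [h1, h2 h3, mul_zero]

theorem position_eq_of_le {u : EllTwo} {N M : ℕ} (h : N ≤ M) {g : Lp ℂ 2 (E.diag u)}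
    (hg : g ∈ E.truncated u N) : E.position u M g = E.position u N g := by
  ext1
  filter_upwards [coeFn_position_of_mem hg, coeFn_position_of_mem (truncated_mono u h hg)]
    with y h1 h2
  rw [h1, h2]

theorem proj_cyclicMap_of_mem {u : EllTwo} {N : ℕ} {g : Lp ℂ 2 (E.diag u)}
    (hg : g ∈ E.truncated u N) :
    E.proj (Set.Icc (-(N : ℝ)) N) (E.cyclicMap u g) = E.cyclicMap u g := by
  rw [E.proj_cyclicMap u measurableSet_Icc, mem_truncated_iff.1 hg]

theorem IsSpectralMeasureOf.cyclicMap_mem_domain (hE : E.IsSpectralMeasureOf J) {u : EllTwo}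
    {N : ℕ} {g : Lp ℂ 2 (E.diag u)} (hg : g ∈ E.truncated u N) :
    E.cyclicMap u g ∈ J.domain :=
  hE.mem_domain_of_proj (proj_cyclicMap_of_mem hg)

theorem IsSpectralMeasureOf.inner_cyclicMap_self (hE : E.IsSpectralMeasureOf J) {u : EllTwo}
    {N : ℕ} {g : Lp ℂ 2 (E.diag u)} (hg : g ∈ E.truncated u N) :
    inner ℂ (E.cyclicMap u g) (J ⟨E.cyclicMap u g, hE.cyclicMap_mem_domain hg⟩) =
      inner ℂ g (E.position u N g) := by
  have h := hE.inner_apply ⟨E.cyclicMap u g, hE.cyclicMap_mem_domain hg⟩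
  have hint : AEMeasurable (fun y => ‖g y‖ ^ 2) (E.diag u) :=
    ((Lp.aestronglyMeasurable g).norm.pow 2).aemeasurable
  rw [h, E.diag_cyclicMap, integral_withDensity_eq_integral_toReal_smul₀ hint.ennreal_ofReal
    (ae_of_all _ fun y => ENNReal.ofReal_lt_top), L2.inner_def, ← integral_complex_ofReal]
  refine integral_congr_ae ?_
  filter_upwards [coeFn_position_of_mem hg] with y hy
  rw [hy, ENNReal.toReal_ofReal (by positivity), ← smul_eq_mul (y : ℂ), inner_smul_right,
    inner_self_eq_norm_sq_to_K]
  simp [mul_comm]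

/-- Polarization of `inner_cyclicMap_self` along `g + c h`, with `c = 1` and `c = i`. -/
theorem IsSpectralMeasureOf.inner_cyclicMap_apply (hE : E.IsSpectralMeasureOf J) {u : EllTwo}
    {N : ℕ} {g h : Lp ℂ 2 (E.diag u)} (hg : g ∈ E.truncated u N) (hh : h ∈ E.truncated u N) :
    inner ℂ (E.cyclicMap u h) (J ⟨E.cyclicMap u g, hE.cyclicMap_mem_domain hg⟩) =
      inner ℂ h (E.position u N g) := by
  have key : ∀ c : ℂ, (starRingEnd ℂ) c *
        (inner ℂ (E.cyclicMap u h) (J ⟨E.cyclicMap u g, hE.cyclicMap_mem_domain hg⟩) -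
          inner ℂ h (E.position u N g)) +
      c * (inner ℂ (E.cyclicMap u g) (J ⟨E.cyclicMap u h, hE.cyclicMap_mem_domain hh⟩) -
          inner ℂ g (E.position u N h)) = 0 := by
    intro c
    have h1 := hE.inner_cyclicMap_self hg
    have h2 := hE.inner_cyclicMap_self hh
    have hc : c • h ∈ E.truncated u N := Submodule.smul_mem _ c hh
    have h3 := hE.inner_cyclicMap_self (Submodule.add_mem _ hg hc)
    have e1 : (⟨E.cyclicMap u (g + c • h),
        hE.cyclicMap_mem_domain (Submodule.add_mem _ hg hc)⟩ : J.domain) =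
        ⟨E.cyclicMap u g, hE.cyclicMap_mem_domain hg⟩ +
          c • ⟨E.cyclicMap u h, hE.cyclicMap_mem_domain hh⟩ := by
      apply Subtype.ext
      simp
    rw [e1, LinearPMap.map_add, LinearPMap.map_smul] at h3
    simp only [map_add, map_smul, inner_add_left, inner_add_right, inner_smul_left,
      inner_smul_right] at h3
    linear_combination h3 - h1 - c * (starRingEnd ℂ) c * h2
  have k1 := key 1
  have k2 := key Complex.I
  rw [map_one] at k1
  rw [Complex.conj_I] at k2
  have h3 : Complex.I * (2 * (inner ℂ (E.cyclicMap u h)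
      (J ⟨E.cyclicMap u g, hE.cyclicMap_mem_domain hg⟩) - inner ℂ h (E.position u N g))) = 0 := by
    linear_combination Complex.I * k1 - k2
  simpa [sub_eq_zero] using h3

/-- Let `z` be the difference of the two sides. Split `E([-M, M]) z` into its part in the cyclic
subspace of `u` and a part `q` orthogonal to it. The first is orthogonal to `z` by
`inner_cyclicMap_apply`, the second by `inner_eq_zero`. Hence `‖E([-M, M]) z‖² = 0` for all large
`M`. -/
theorem IsSpectralMeasureOf.apply_cyclicMap (hE : E.IsSpectralMeasureOf J) {u : EllTwo}
    {N : ℕ} {g : Lp ℂ 2 (E.diag u)} (hg : g ∈ E.truncated u N) :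
    J ⟨E.cyclicMap u g, hE.cyclicMap_mem_domain hg⟩ = E.cyclicMap u (E.position u N g) := by
  rw [← sub_eq_zero]
  set z := J ⟨E.cyclicMap u g, hE.cyclicMap_mem_domain hg⟩ - E.cyclicMap u (E.position u N g)
    with hz
  refine E.eq_zero_of_proj_Icc (N := N) fun M hM => ?_
  have hgM := truncated_mono u hM hg
  have hB : MeasurableSet (Set.Icc (-(M : ℝ)) M) := measurableSet_Icc
  -- Since `cyclicMap` is an isometry, its value at `k` is the orthogonal projection of `z` onto the
  -- cyclic subspace. Cutting off to `[-M, M]` puts both parts into the domain of `J`.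
  set k := ContinuousLinearMap.adjoint (E.cyclicMap u) z with hk
  have hkM : E.cutoff u hB k ∈ E.truncated u M := by
    rw [mem_truncated_iff_ae]
    filter_upwards [E.coeFn_cutoff u hB k] with y hy hyM
    rw [hy, Set.indicator_of_notMem hyM]
  set q := E.proj (Set.Icc (-(M : ℝ)) M) (z - E.cyclicMap u k) with hq
  have hqM : q ∈ J.domain := hE.mem_domain_of_proj (N := M) (by
    rw [hq, E.proj_proj _ hB hB, Set.inter_self])
  have horth : ∀ m, inner ℂ (z - E.cyclicMap u k) (E.cyclicMap u m) = 0 := by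
    intro m
    rw [inner_sub_left, E.inner_cyclicMap, hk, ContinuousLinearMap.adjoint_inner_left, sub_self]
  have hqorth : ∀ m, inner ℂ q (E.cyclicMap u m) = 0 := by
    intro m
    rw [hq, E.inner_proj_left _ _ hB, E.proj_cyclicMap u hB, horth]
  have h1 : inner ℂ q z = 0 := by
    rw [hz, inner_sub_right, hqorth, sub_zero]
    refine hE.inner_eq_zero ⟨E.cyclicMap u g, hE.cyclicMap_mem_domain hg⟩ ⟨q, hqM⟩ fun B hB' => ?_
    change inner ℂ q (E.proj B (E.cyclicMap u g)) = 0
    rw [E.proj_cyclicMap u hB', hqorth]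
  have h2 : inner ℂ (E.cyclicMap u (E.cutoff u hB k)) z = 0 := by
    rw [hz, inner_sub_right, hE.inner_cyclicMap_apply hgM hkM, E.inner_cyclicMap,
      position_eq_of_le hM hg, sub_self]
  have h3 : inner ℂ (E.proj (Set.Icc (-(M : ℝ)) M) z) z = 0 := by
    have : E.proj (Set.Icc (-(M : ℝ)) M) z = q + E.cyclicMap u (E.cutoff u hB k) := by
      rw [hq, map_sub _ z, E.proj_cyclicMap u hB k, sub_add_cancel]
    rw [this, inner_add_left, h1, h2, add_zero]
  rw [E.inner_proj_left _ _ hB, E.inner_proj_self _ hB] at h3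
  simpa using h3

end ProjValuedMeasure

/-! ### Jacobi matrices and Parseval's identity. -/

/-- The canonical basis vectors of `ℓ²`. -/
noncomputable def basisVec (n : ℕ) : EllTwo := lp.single 2 n (1 : ℂ)

theorem basisVec_apply (n m : ℕ) : (basisVec n : EllTwo) m = if m = n then 1 else 0 := by
  rw [basisVec, lp.single_apply]
  by_cases h : m = n
  · subst h; simp
  · simp [h]

theorem inner_basisVec (n : ℕ) (u : EllTwo) : inner ℂ (basisVec n) u = u n := by
  rw [basisVec, lp.inner_single_left]
  simp

theorem basisVec_mem_domain (a b : ℕ → ℝ) (n : ℕ) : basisVec n ∈ (minimalJacobi a b).domain := by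
  change {m | (basisVec n : EllTwo) m ≠ 0}.Finite
  refine (Set.finite_singleton n).subset fun m hm => ?_
  by_contra h
  exact hm (by rw [basisVec_apply]; simpa using h)

theorem minimalJacobi_apply (a b : ℕ → ℝ) (u : (minimalJacobi a b).domain) (m : ℕ) :
    (minimalJacobi a b u : EllTwo) m = jacobiSeq a b (u : EllTwo) m := rfl

theorem minimalJacobi_basisVec_zero (a b : ℕ → ℝ) :
    minimalJacobi a b ⟨basisVec 0, basisVec_mem_domain a b 0⟩ =
      (b 0 : ℂ) • basisVec 0 + (a 0 : ℂ) • basisVec 1 := by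
  ext m
  rw [minimalJacobi_apply]
  simp only [lp.coeFn_add, lp.coeFn_smul, Pi.add_apply, Pi.smul_apply, basisVec_apply]
  rcases m with _ | _ | m <;> simp [jacobiSeq, basisVec_apply]

theorem minimalJacobi_basisVec_succ (a b : ℕ → ℝ) (n : ℕ) :
    minimalJacobi a b ⟨basisVec (n + 1), basisVec_mem_domain a b (n + 1)⟩ =
      (a n : ℂ) • basisVec n + (b (n + 1) : ℂ) • basisVec (n + 1)
        + (a (n + 1) : ℂ) • basisVec (n + 2) := by
  ext m
  rw [minimalJacobi_apply]
  simp only [lp.coeFn_add, lp.coeFn_smul, Pi.add_apply, Pi.smul_apply, basisVec_apply]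
  rcases m with _ | m
  · by_cases h : n = 0
    · subst h; simp [jacobiSeq, basisVec_apply]
    · simp [jacobiSeq, basisVec_apply, Ne.symm h]
      omega
  · simp only [jacobiSeq, basisVec_apply]
    by_cases h1 : m = n
    · subst h1; simp
    · by_cases h2 : m = n + 1
      · subst h2; simp; omega
      · by_cases h3 : m + 1 = n
        · subst h3; simp
          omega
        · have h4 : ¬ m + 2 = n + 1 := by omega
          simp [h1, h2, h3, h4]

namespace ProjValuedMeasure

variable {E : ProjValuedMeasure} {J : EllTwo →ₗ.[ℂ] EllTwo}

theorem inner_self_cyclicMap (u : EllTwo) (g : Lp ℂ 2 (E.diag u)) :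
    inner ℂ u (E.cyclicMap u g) = ∫ y, g y ∂(E.diag u) := by
  calc inner ℂ u (E.cyclicMap u g)
      = inner ℂ (E.cyclicMap u (indicatorConstLp 2 MeasurableSet.univ (measure_ne_top _ _) (1 : ℂ)))
          (E.cyclicMap u g) := by rw [cyclicMap_one]
    _ = ∫ y, g y ∂(E.diag u) := by
        rw [E.inner_cyclicMap, L2.inner_indicatorConstLp_one, Measure.restrict_univ]

theorem integrable_poly_mul {u : EllTwo} {N : ℕ} {g : Lp ℂ 2 (E.diag u)}
    (hg : g ∈ E.truncated u N) (p : Polynomial ℝ) :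
    Integrable (fun y => ((p.eval y : ℝ) : ℂ) * g y) (E.diag u) := by
  obtain ⟨C, hC⟩ := (isCompact_Icc (a := -(N : ℝ)) (b := N)).exists_bound_of_continuousOn
    p.continuous.continuousOn
  have hg1 : Integrable g (E.diag u) := (Lp.memLp g).integrable (by norm_num)
  refine (hg1.norm.const_mul C).mono' ?_ ?_
  · exact ((Complex.continuous_ofReal.comp p.continuous).aestronglyMeasurable).mul
      hg1.aestronglyMeasurable
  · filter_upwards [mem_truncated_iff_ae.1 hg] with y hy
    by_cases hyN : y ∈ Set.Icc (-(N : ℝ)) N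
    · rw [norm_mul, Complex.norm_real]
      exact mul_le_mul_of_nonneg_right (hC y hyN) (norm_nonneg _)
    · simp [hy hyN]

/-- The symmetry of `J` moves it onto `e_n`, where it acts as the Jacobi matrix. The recurrence of
the `P_n` enters through this identity. -/
theorem IsSpectralMeasureOf.inner_basisVec_position (hE : E.IsSpectralMeasureOf J)
    (hJ : IsSelfAdjoint J) {a b : ℕ → ℝ} (hJext : minimalJacobi a b ≤ J) {u : EllTwo} {N : ℕ}
    {g : Lp ℂ 2 (E.diag u)} (hg : g ∈ E.truncated u N) (n : ℕ) :
    inner ℂ (basisVec n) (E.cyclicMap u (E.position u N g)) =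
      inner ℂ (minimalJacobi a b ⟨basisVec n, basisVec_mem_domain a b n⟩) (E.cyclicMap u g) := by
  have hn : basisVec n ∈ J.domain := hJext.1 (basisVec_mem_domain a b n)
  have h1 : minimalJacobi a b ⟨basisVec n, basisVec_mem_domain a b n⟩ = J ⟨basisVec n, hn⟩ :=
    hJext.2 rfl
  have hsymm := LinearPMap.adjoint_isFormalAdjoint hJ.dense_domain
  rw [LinearPMap.isSelfAdjoint_def.1 hJ] at hsymm
  rw [h1, ← hE.apply_cyclicMap hg]
  exact (hsymm ⟨basisVec n, hn⟩ ⟨E.cyclicMap u g, hE.cyclicMap_mem_domain hg⟩).symm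

theorem integral_poly_mul_position {u : EllTwo} {N : ℕ} {g : Lp ℂ 2 (E.diag u)}
    (hg : g ∈ E.truncated u N) (p : Polynomial ℝ) :
    ∫ y, ((p.eval y : ℝ) : ℂ) * E.position u N g y ∂(E.diag u) =
      ∫ y, (((Polynomial.X * p).eval y : ℝ) : ℂ) * g y ∂(E.diag u) := by
  refine integral_congr_ae ?_
  filter_upwards [coeFn_position_of_mem hg] with y hy
  rw [hy]
  simp
  ring

theorem IsSpectralMeasureOf.inner_basisVec_cyclicMap (hE : E.IsSpectralMeasureOf J)
    (hJ : IsSelfAdjoint J) {a b : ℕ → ℝ} (ha : ∀ n, 0 < a n) (hJext : minimalJacobi a b ≤ J)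
    {N : ℕ} (n : ℕ) {g : Lp ℂ 2 (E.diag (basisVec 0))} (hg : g ∈ E.truncated (basisVec 0) N) :
    inner ℂ (basisVec n) (E.cyclicMap (basisVec 0) g) =
      ∫ y, (((orthoPoly a b n).eval y : ℝ) : ℂ) * g y ∂(E.diag (basisVec 0)) := by
  -- The function `g` must vary: the step applies the induction hypothesis to `y g(y)` as well as to
  -- `g`, then solves the recurrence for the coefficient of index `n`, dividing by `a_{n-1} > 0`.
  induction n using Nat.strong_induction_on generalizing g with
  | _ n ih =>
    have hlin : ∀ p q : Polynomial ℝ,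
        ∫ y, (((p - q).eval y : ℝ) : ℂ) * g y ∂(E.diag (basisVec 0)) =
          ∫ y, ((p.eval y : ℝ) : ℂ) * g y ∂(E.diag (basisVec 0)) -
            ∫ y, ((q.eval y : ℝ) : ℂ) * g y ∂(E.diag (basisVec 0)) := by
      intro p q
      rw [← integral_sub (integrable_poly_mul hg p) (integrable_poly_mul hg q)]
      refine integral_congr_ae (ae_of_all _ fun y => ?_)
      simp
      ring
    have hconst : ∀ (c : ℝ) (p : Polynomial ℝ),
        ∫ y, (((Polynomial.C c * p).eval y : ℝ) : ℂ) * g y ∂(E.diag (basisVec 0)) =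
          c * ∫ y, ((p.eval y : ℝ) : ℂ) * g y ∂(E.diag (basisVec 0)) := by
      intro c p
      rw [← integral_const_mul]
      refine integral_congr_ae (ae_of_all _ fun y => ?_)
      simp
      ring
    match n with
    | 0 =>
      rw [inner_self_cyclicMap]
      simp [orthoPoly]
    | 1 =>
      have h0 := ih 0 (by omega) hg
      have h1 := ih 0 (by omega) (position_mem_truncated hg)
      rw [integral_poly_mul_position hg, hE.inner_basisVec_position hJ hJext hg,
        minimalJacobi_basisVec_zero, inner_add_left, inner_smul_left, inner_smul_left, h0,
        Complex.conj_ofReal, Complex.conj_ofReal] at h1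
      have ha0 : (a 0 : ℂ) ≠ 0 := Complex.ofReal_ne_zero.2 (ha 0).ne'
      have h2 : Polynomial.C (b 0) = Polynomial.C (b 0) * orthoPoly a b 0 := by simp [orthoPoly]
      have h3 : (Polynomial.X : Polynomial ℝ) = Polynomial.X * orthoPoly a b 0 := by
        simp [orthoPoly]
      rw [orthoPoly, hconst, hlin, h2, hconst]
      conv_rhs => rw [h3]
      rw [← h1]
      push_cast
      field_simp
      ring
    | n + 2 =>
      have h0 := ih n (by omega) hg
      have h1 := ih (n + 1) (by omega) hg
      have h2 := ih (n + 1) (by omega) (position_mem_truncated hg)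
      rw [integral_poly_mul_position hg, hE.inner_basisVec_position hJ hJext hg,
        minimalJacobi_basisVec_succ, inner_add_left, inner_add_left, inner_smul_left,
        inner_smul_left, inner_smul_left, h0, h1, Complex.conj_ofReal, Complex.conj_ofReal,
        Complex.conj_ofReal] at h2
      have ha0 : (a (n + 1) : ℂ) ≠ 0 := Complex.ofReal_ne_zero.2 (ha (n + 1)).ne'
      rw [orthoPoly, hconst, hlin, hconst, sub_mul, hlin, hconst, ← h2]
      push_cast
      field_simp
      ring

/-- Parseval's identity for the orthonormal polynomials. -/
theorem IsSpectralMeasureOf.hasSum_norm_sq (hE : E.IsSpectralMeasureOf J)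
    (hJ : IsSelfAdjoint J) {a b : ℕ → ℝ} (ha : ∀ n, 0 < a n) (hJext : minimalJacobi a b ≤ J)
    {g : ℝ → ℂ} (hg : MemLp g 2 E.scalar) (hgc : HasCompactSupport g) :
    HasSum (fun n => ‖∫ y, (((orthoPoly a b n).eval y : ℝ) : ℂ) * g y ∂E.scalar‖ ^ 2)
      (∫ y, ‖g y‖ ^ 2 ∂E.scalar) := by
  change MemLp g 2 (E.diag (basisVec 0)) at hg
  change HasSum (fun n => ‖∫ y, (((orthoPoly a b n).eval y : ℝ) : ℂ) * g y
    ∂(E.diag (basisVec 0))‖ ^ 2) (∫ y, ‖g y‖ ^ 2 ∂(E.diag (basisVec 0)))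
  obtain ⟨R, hR⟩ := hgc.isBounded.exists_norm_le
  obtain ⟨N, hN⟩ := exists_nat_ge R
  -- Compact support keeps `g(J) e_0` in the domain of `J` and makes all the moments of `g` finite.
  have hgt : hg.toLp g ∈ E.truncated (basisVec 0) N := by
    rw [mem_truncated_iff_ae]
    filter_upwards [hg.coeFn_toLp] with y hy hyN
    rw [hy]
    by_contra h0
    exact hyN (abs_le.1 ((hR y (subset_tsupport g h0)).trans hN))
  have h1 := lp.hasSum_norm (p := 2) (by norm_num) (E.cyclicMap (basisVec 0) (hg.toLp g))
  simp only [ENNReal.toReal_ofNat, Real.rpow_ofNat] at h1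
  have h2 : ‖E.cyclicMap (basisVec 0) (hg.toLp g)‖ ^ 2 =
      ∫ y, ‖g y‖ ^ 2 ∂(E.diag (basisVec 0)) := by
    have h3 := E.inner_cyclicMap (basisVec 0) (hg.toLp g) (hg.toLp g)
    rw [inner_self_eq_norm_sq_to_K, L2.inner_def] at h3
    have h4 : (∫ y, inner ℂ (hg.toLp g y) (hg.toLp g y) ∂(E.diag (basisVec 0))) =
        ((∫ y, ‖g y‖ ^ 2 ∂(E.diag (basisVec 0)) : ℝ) : ℂ) := by
      rw [← integral_complex_ofReal]
      refine integral_congr_ae ?_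
      filter_upwards [hg.coeFn_toLp] with y hy
      rw [hy, inner_self_eq_norm_sq_to_K]
      simp
    rw [h4] at h3
    have h5 : ((‖E.cyclicMap (basisVec 0) (hg.toLp g)‖ ^ 2 : ℝ) : ℂ) =
        ((∫ y, ‖g y‖ ^ 2 ∂(E.diag (basisVec 0)) : ℝ) : ℂ) := by
      simpa using h3
    exact Complex.ofReal_injective h5
  rw [h2] at h1
  convert h1 using 3 with n
  rw [← inner_basisVec n, hE.inner_basisVec_cyclicMap hJ ha hJext n hgt]
  refine congrArg _ (integral_congr_ae ?_)
  filter_upwards [hg.coeFn_toLp] with y hy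
  rw [hy]

end ProjValuedMeasure

theorem integral_eq_of_restrict_withDensity {F : Type*} [NormedAddCommGroup F] [NormedSpace ℝ F]
    {ρ : Measure ℝ} {Λ : Set ℝ} (hΛ : IsOpen Λ) {τ : ℝ → ℝ} (hτ : ContinuousOn τ Λ)
    (hτpos : ∀ y ∈ Λ, 0 < τ y)
    (hρ : ρ.restrict Λ = (volume.restrict Λ).withDensity (fun y => ENNReal.ofReal (τ y)))
    {H : ℝ → F} (hH : ∀ y, y ∉ Λ → H y = 0) :
    ∫ y, H y ∂ρ = ∫ y, τ y • H y := by
  rw [← setIntegral_eq_integral_of_forall_compl_eq_zero hH, hρ,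
    integral_withDensity_eq_integral_toReal_smul₀
      (hτ.aemeasurable hΛ.measurableSet).ennreal_ofReal
      (ae_of_all _ fun y => ENNReal.ofReal_lt_top),
    ← setIntegral_eq_integral_of_forall_compl_eq_zero (s := Λ) (f := fun y => τ y • H y)
      fun y hy => by rw [hH y hy, smul_zero]]
  refine setIntegral_congr_fun hΛ.measurableSet fun y hy => ?_
  rw [ENNReal.toReal_ofReal (hτpos y hy).le]

/-- Parseval's identity for `τ^{-1/2} e^{iφ} f`. The phase drops out of the norm, and the choice `φ
= -t θ(ω)` yields conservation of the norm under the evolution. -/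
theorem ProjValuedMeasure.IsSpectralMeasureOf.hasSum_norm_sq_of_density
    {E : ProjValuedMeasure} {J : EllTwo →ₗ.[ℂ] EllTwo} (hE : E.IsSpectralMeasureOf J)
    (hJ : IsSelfAdjoint J) {a b : ℕ → ℝ} (ha : ∀ n, 0 < a n) (hJext : minimalJacobi a b ≤ J)
    {Λ : Set ℝ} (hΛ : IsOpen Λ) {τ : ℝ → ℝ} (hτ : ContinuousOn τ Λ)
    (hτpos : ∀ y ∈ Λ, 0 < τ y)
    (hρ : E.scalar.restrict Λ =
      (volume.restrict Λ).withDensity (fun y => ENNReal.ofReal (τ y)))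
    {f : ℝ → ℂ} (hf : Continuous f) (hfc : HasCompactSupport f) (hfs : tsupport f ⊆ Λ)
    {φ : ℝ → ℝ} (hφ : ContinuousOn φ Λ) :
    HasSum (fun n => ‖∫ y, (((orthoPoly a b n).eval y * √(τ y) : ℝ) : ℂ) * f y *
      Complex.exp (Complex.I * φ y)‖ ^ 2) (∫ y in Λ, ‖f y‖ ^ 2) := by
  set G : ℝ → ℂ := fun y => (((√(τ y))⁻¹ : ℝ) : ℂ) * Complex.exp (Complex.I * φ y) * f y with hG
  have hf0 : ∀ y, y ∉ Λ → f y = 0 := fun y hy => by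
    by_contra h
    exact hy (hfs (subset_tsupport f h))
  have hG0 : ∀ y, y ∉ Λ → G y = 0 := fun y hy => by simp [hG, hf0 y hy]
  have hGs : tsupport G ⊆ tsupport f := closure_mono fun y hy h => hy (by simp [hG, h])
  have hGc : HasCompactSupport G := hfc.mono' fun y hy => hGs (subset_tsupport G hy)
  have hGcont : Continuous G := by
    refine continuous_of_tsupport fun y hy => ?_
    have hyΛ := hΛ.mem_nhds (hfs (hGs hy))
    have h1 : ContinuousAt (fun y => (√(τ y))⁻¹) y :=
      ((hτ.continuousAt hyΛ).sqrt).inv₀ (Real.sqrt_pos.2 (hτpos y (hfs (hGs hy)))).ne'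
    have h2 : ContinuousAt φ y := hφ.continuousAt hyΛ
    exact ((Complex.continuous_ofReal.continuousAt.comp h1).mul
      ((continuousAt_const.mul (Complex.continuous_ofReal.continuousAt.comp h2)).cexp)).mul
      hf.continuousAt
  have : IsFiniteMeasure E.scalar := E.isFiniteMeasure_diag _
  have h := hE.hasSum_norm_sq hJ ha hJext (hGcont.memLp_of_hasCompactSupport hGc) hGc
  have hsq : ∀ y ∈ Λ, τ y * (√(τ y))⁻¹ = √(τ y) := fun y hy => by
    have := (Real.sqrt_pos.2 (hτpos y hy)).ne'
    field_simp
    rw [Real.sq_sqrt (hτpos y hy).le]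
  have hR : ∫ y, ‖G y‖ ^ 2 ∂E.scalar = ∫ y in Λ, ‖f y‖ ^ 2 := by
    rw [integral_eq_of_restrict_withDensity hΛ hτ hτpos hρ (fun y hy => by
      rw [hG0 y hy]; simp),
      setIntegral_eq_integral_of_forall_compl_eq_zero fun y hy => by rw [hf0 y hy]; simp]
    refine integral_congr_ae (ae_of_all _ fun y => ?_)
    by_cases hy : y ∈ Λ
    · have h1 : ‖G y‖ ^ 2 = (√(τ y))⁻¹ ^ 2 * ‖f y‖ ^ 2 := by
        rw [hG]
        simp only [norm_mul, Complex.norm_real, Complex.norm_exp_I_mul_ofReal, mul_one]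
        rw [mul_pow, Real.norm_eq_abs, sq_abs]
      have h2 : τ y * (√(τ y))⁻¹ ^ 2 = 1 := by
        rw [inv_pow, Real.sq_sqrt (hτpos y hy).le, mul_inv_cancel₀ (hτpos y hy).ne']
      simp only [smul_eq_mul]
      rw [h1, ← mul_assoc, h2, one_mul]
    · simp [hG, hf0 y hy]
  rw [hR] at h
  convert h using 3 with n
  rw [integral_eq_of_restrict_withDensity hΛ hτ hτpos hρ fun y hy => by
    rw [hG0 y hy, mul_zero]]
  refine congrArg _ (integral_congr_ae (ae_of_all _ fun y => ?_))
  by_cases hy : y ∈ Λ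
  · have h1 : (τ y : ℂ) * (((√(τ y))⁻¹ : ℝ) : ℂ) = (√(τ y) : ℝ) := by
      rw [← Complex.ofReal_mul, hsq y hy]
    simp only [hG, Complex.real_smul, Complex.ofReal_mul]
    rw [← h1]
    ring
  · simp [hG, hf0 y hy]

/-! ### Uniform symbol bounds and the method of nonstationary phase. -/

/-- The functions `F i` are smooth on `U` and their derivatives of order at most `m` are bounded
on `U` uniformly in `i`. -/
def BoundedDerivs {ι F : Type*} [NormedAddCommGroup F] [NormedSpace ℝ F] (U : Set ℝ) :
    ℕ → (ι → ℝ → F) → Prop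
  | 0, f => (∀ i, ContDiffOn ℝ (⊤ : ℕ∞) (f i) U) ∧ ∃ C, ∀ i, ∀ y ∈ U, ‖f i y‖ ≤ C
  | m + 1, f => ((∀ i, ContDiffOn ℝ (⊤ : ℕ∞) (f i) U) ∧ ∃ C, ∀ i, ∀ y ∈ U, ‖f i y‖ ≤ C) ∧
      BoundedDerivs U m (fun i => deriv (f i))

namespace BoundedDerivs

variable {ι F : Type*} [NormedAddCommGroup F] [NormedSpace ℝ F] {U : Set ℝ} {m : ℕ}

theorem contDiffOn {f : ι → ℝ → F} (h : BoundedDerivs U m f) (i : ι) :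
    ContDiffOn ℝ (⊤ : ℕ∞) (f i) U := by
  cases m with
  | zero => exact h.1 i
  | succ m => exact h.1.1 i

theorem bound {f : ι → ℝ → F} (h : BoundedDerivs U m f) : ∃ C, ∀ i, ∀ y ∈ U, ‖f i y‖ ≤ C := by
  cases m with
  | zero => exact h.2
  | succ m => exact h.1.2

theorem of_succ {f : ι → ℝ → F} (h : BoundedDerivs U (m + 1) f) : BoundedDerivs U m f := by
  induction m generalizing f with
  | zero => exact h.1
  | succ m ih => exact ⟨h.1, ih h.2⟩

theorem differentiableAt (hU : IsOpen U) {f : ι → ℝ → F} (h : BoundedDerivs U m f) (i : ι) {y : ℝ}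
    (hy : y ∈ U) : DifferentiableAt ℝ (f i) y :=
  ((h.contDiffOn i).differentiableOn (by simp)).differentiableAt (hU.mem_nhds hy)

theorem congr (hU : IsOpen U) {f g : ι → ℝ → F} (h : BoundedDerivs U m f)
    (hfg : ∀ i, Set.EqOn (g i) (f i) U) : BoundedDerivs U m g := by
  have hzero : ∀ {f g : ι → ℝ → F}, BoundedDerivs U 0 f → (∀ i, Set.EqOn (g i) (f i) U) →
      BoundedDerivs U 0 g := by
    intro f g h hfg
    obtain ⟨C, hC⟩ := h.2
    exact ⟨fun i => (h.1 i).congr (hfg i), C, fun i y hy => by rw [hfg i hy]; exact hC i y hy⟩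
  induction m generalizing f g with
  | zero => exact hzero h hfg
  | succ m ih =>
    exact ⟨hzero h.1 hfg, ih h.2 fun i y hy =>
      (Filter.eventuallyEq_of_mem (hU.mem_nhds hy) (hfg i)).deriv_eq⟩

theorem add (hU : IsOpen U) {f g : ι → ℝ → F} (hf : BoundedDerivs U m f)
    (hg : BoundedDerivs U m g) : BoundedDerivs U m (fun i y => f i y + g i y) := by
  have hzero : ∀ {f g : ι → ℝ → F}, BoundedDerivs U 0 f → BoundedDerivs U 0 g →
      BoundedDerivs U 0 (fun i y => f i y + g i y) := by
    intro f g hf hg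
    obtain ⟨C, hC⟩ := hf.2
    obtain ⟨D, hD⟩ := hg.2
    exact ⟨fun i => (hf.1 i).add (hg.1 i), C + D, fun i y hy =>
      (norm_add_le _ _).trans (add_le_add (hC i y hy) (hD i y hy))⟩
  induction m generalizing f g with
  | zero => exact hzero hf hg
  | succ m ih =>
    refine ⟨hzero hf.1 hg.1, (ih hf.2 hg.2).congr hU fun i y hy => ?_⟩
    exact deriv_fun_add (hf.differentiableAt hU i hy) (hg.differentiableAt hU i hy)

theorem smul (hU : IsOpen U) {f : ι → ℝ → ℝ} {g : ι → ℝ → F} (hf : BoundedDerivs U m f)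
    (hg : BoundedDerivs U m g) : BoundedDerivs U m (fun i y => f i y • g i y) := by
  have hzero : ∀ {f : ι → ℝ → ℝ} {g : ι → ℝ → F}, BoundedDerivs U 0 f → BoundedDerivs U 0 g →
      BoundedDerivs U 0 (fun i y => f i y • g i y) := by
    intro f g hf hg
    obtain ⟨C, hC⟩ := hf.2
    obtain ⟨D, hD⟩ := hg.2
    refine ⟨fun i => (hf.1 i).smul (hg.1 i), C * D, fun i y hy => ?_⟩
    rw [norm_smul]
    exact mul_le_mul (hC i y hy) (hD i y hy) (norm_nonneg _) ((norm_nonneg _).trans (hC i y hy))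
  induction m generalizing f g with
  | zero => exact hzero hf hg
  | succ m ih =>
    refine ⟨hzero hf.1 hg.1, ((ih hf.of_succ hg.2).add hU (ih hf.2 hg.of_succ)).congr hU
      fun i y hy => ?_⟩
    exact deriv_fun_smul (hf.differentiableAt hU i hy) (hg.differentiableAt hU i hy)

/-- The recursion closes because `(1/f)' = -f' (1/f)²` involves only `f'` and the lower-order bounds
already known for `1/f`. -/
theorem inv (hU : IsOpen U) {f : ι → ℝ → ℝ} (hf : BoundedDerivs U m f) {c : ℝ} (hc : 0 < c)
    (hfc : ∀ i, ∀ y ∈ U, c ≤ |f i y|) : BoundedDerivs U m (fun i y => (f i y)⁻¹) := by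
  have hne : ∀ i, ∀ y ∈ U, f i y ≠ 0 := fun i y hy h => by
    have := hfc i y hy
    rw [h, abs_zero] at this
    linarith
  have hzero : BoundedDerivs U 0 (fun i y => (f i y)⁻¹) := by
    refine ⟨fun i => (hf.contDiffOn i).inv (hne i), c⁻¹, fun i y hy => ?_⟩
    rw [norm_inv]
    exact inv_anti₀ hc (hfc i y hy)
  induction m with
  | zero => exact hzero
  | succ m ih =>
    have h1 := ih hf.of_succ
    have h2 := (hf.2.smul hU (h1.smul hU h1)).smul hU (g := fun _ _ => (-1 : ℝ)) ?_
    · refine ⟨hzero, h2.congr hU fun i y hy => ?_⟩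
      have := ((hf.differentiableAt hU i hy).hasDerivAt.inv (hne i y hy)).deriv
      simp only [smul_eq_mul]
      rw [show (fun y => (f i y)⁻¹) = (f i)⁻¹ from rfl, this]
      field_simp [hne i y hy]
    · clear ih h1
      have : ∀ (m : ℕ) (c : ℝ), BoundedDerivs U m (fun (_ : ι) (_ : ℝ) => c) := by
        intro m
        induction m with
        | zero => exact fun c => ⟨fun i => contDiffOn_const, ‖c‖, fun i y _ => le_rfl⟩
        | succ m ih =>
          intro c
          refine ⟨⟨fun i => contDiffOn_const, ‖c‖, fun i y _ => le_rfl⟩, ?_⟩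
          simpa using ih 0
      exact this m _

theorem of_iteratedDeriv (hU : IsOpen U) {f : ι → ℝ → F}
    (hs : ∀ i, ContDiffOn ℝ (⊤ : ℕ∞) (f i) U)
    (hb : ∀ k ≤ m, ∃ C, ∀ i, ∀ y ∈ U, ‖iteratedDeriv k (f i) y‖ ≤ C) : BoundedDerivs U m f := by
  induction m generalizing f with
  | zero => exact ⟨hs, by simpa using hb 0 le_rfl⟩
  | succ m ih =>
    refine ⟨⟨hs, by simpa using hb 0 (Nat.zero_le _)⟩, ih (fun i => ?_) fun k hk => ?_⟩
    · exact (hs i).deriv_of_isOpen hU (by simp)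
    · simpa [iteratedDeriv_succ'] using hb (k + 1) (by omega)

/-- A fixed function, smooth near a compact set containing `U`. -/
theorem const {Λ : Set ℝ} (hΛ : IsOpen Λ) {f : ℝ → F} (hf : ContDiffOn ℝ (⊤ : ℕ∞) f Λ)
    {K : Set ℝ} (hK : IsCompact K) (hKΛ : K ⊆ Λ) (hUK : U ⊆ K) (m : ℕ) :
    BoundedDerivs U m (fun _ : ι => f) := by
  induction m generalizing f with
  | zero =>
    obtain ⟨C, hC⟩ := hK.exists_bound_of_continuousOn (hf.continuousOn.mono hKΛ)
    exact ⟨fun _ => hf.mono (hUK.trans hKΛ), C, fun _ y hy => hC y (hUK hy)⟩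
  | succ m ih =>
    obtain ⟨C, hC⟩ := hK.exists_bound_of_continuousOn (hf.continuousOn.mono hKΛ)
    exact ⟨⟨fun _ => hf.mono (hUK.trans hKΛ), C, fun _ y hy => hC y (hUK hy)⟩,
      ih (hf.deriv_of_isOpen hΛ (by simp))⟩

end BoundedDerivs

theorem integral_deriv_eq_zero_of_hasCompactSupport {F : Type*} [NormedAddCommGroup F]
    [NormedSpace ℝ F] [CompleteSpace F] {w : ℝ → F} (hw : Differentiable ℝ w)
    (hw' : Continuous (deriv w)) (hc : HasCompactSupport w) : ∫ y, deriv w y = 0 :=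
  integral_eq_zero_of_hasDerivAt_of_integrable (fun y => (hw y).hasDerivAt)
    (hw'.integrable_of_hasCompactSupport hc.deriv) (hw.continuous.integrable_of_hasCompactSupport hc)

theorem tsupport_subset_of_imp {X F G : Type*} [TopologicalSpace X] [Zero F] [Zero G] {f : X → F}
    {g : X → G} (h : ∀ y, g y = 0 → f y = 0) : tsupport f ⊆ tsupport g :=
  closure_mono fun y hy hg => hy (h y hg)

theorem tsupport_deriv_subset_tsupport {F : Type*} [NormedAddCommGroup F] [NormedSpace ℝ F]
    (f : ℝ → F) : tsupport (deriv f) ⊆ tsupport f :=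
  closure_minimal support_deriv_subset (isClosed_tsupport f)

/-- One integration by parts in an oscillatory integral. -/
theorem integral_mul_exp_eq {U : Set ℝ} (hU : IsOpen U) {a : ℝ → ℂ} {φ : ℝ → ℝ}
    (ha : ContDiffOn ℝ (⊤ : ℕ∞) a U) (hac : HasCompactSupport a) (has : tsupport a ⊆ U)
    (hφ : ContDiffOn ℝ (⊤ : ℕ∞) φ U) (hφ' : ∀ y ∈ U, deriv φ y ≠ 0) (L : ℝ) :
    (L : ℂ) * ∫ y, a y * Complex.exp (Complex.I * (L * φ y : ℝ)) =
      Complex.I * ∫ y, deriv (fun y => (deriv φ y)⁻¹ • a y) y *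
        Complex.exp (Complex.I * (L * φ y : ℝ)) := by
  set q : ℝ → ℂ := fun y => (deriv φ y)⁻¹ • a y with hq
  set e : ℝ → ℂ := fun y => Complex.exp (Complex.I * (L * φ y : ℝ)) with he
  have hqs : tsupport q ⊆ tsupport a := tsupport_subset_of_imp fun y h => by simp [hq, h]
  have hqU : ContDiffOn ℝ (⊤ : ℕ∞) q U :=
    ((hφ.deriv_of_isOpen hU (by simp)).inv hφ').smul ha
  have heU : ContDiffOn ℝ (⊤ : ℕ∞) e U :=
    (contDiffOn_const.mul (Complex.ofRealCLM.contDiff.comp_contDiffOn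
      (contDiffOn_const.mul hφ))).cexp
  have hwU : ContDiffOn ℝ (⊤ : ℕ∞) (fun y => q y * e y) U := hqU.mul heU
  have hws : tsupport (fun y => q y * e y) ⊆ tsupport a :=
    (tsupport_subset_of_imp fun y h => by simp [h]).trans hqs
  have hw : ContDiff ℝ (⊤ : ℕ∞) (fun y => q y * e y) := by
    rw [contDiff_iff_contDiffAt]
    intro y
    by_cases hy : y ∈ tsupport a
    · exact hwU.contDiffAt (hU.mem_nhds (has hy))
    · have : (fun y => q y * e y) =ᶠ[𝓝 y] 0 :=
        notMem_tsupport_iff_eventuallyEq.1 fun h => hy (hws h)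
      exact (contDiffAt_const (c := (0 : ℂ))).congr_of_eventuallyEq this
  have hwc : HasCompactSupport (fun y => q y * e y) :=
    hac.mono' fun y hy => hws (subset_tsupport _ hy)
  have h0 := integral_deriv_eq_zero_of_hasCompactSupport (hw.differentiable (by simp))
    (hw.continuous_deriv (by simp)) hwc
  have hcont : ∀ {r : ℝ → ℂ}, ContDiffOn ℝ (⊤ : ℕ∞) r U → tsupport r ⊆ tsupport a →
      Integrable (fun y => r y * e y) := by
    intro r hr hrs
    have hs : tsupport (fun y => r y * e y) ⊆ tsupport a :=
      (tsupport_subset_of_imp fun y h => by simp [h]).trans hrs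
    refine Continuous.integrable_of_hasCompactSupport ?_ (hac.mono' fun y hy =>
      hs (subset_tsupport _ hy))
    refine continuous_of_tsupport fun y hy => ?_
    exact (hr.mul heU).continuousOn.continuousAt (hU.mem_nhds (has (hs hy)))
  -- Here `q = a / φ'`, so `q e' = i L a e`; the integral of the total derivative vanishes by
  -- compact support.
  have hder : ∀ y, deriv (fun y => q y * e y) y =
      deriv q y * e y + (Complex.I * L) * (a y * e y) := by
    intro y
    by_cases hy : y ∈ tsupport a
    · have hyU := hU.mem_nhds (has hy)
      have h1 := (hqU.differentiableOn (by simp)).differentiableAt hyU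
      have h2 := (hφ.differentiableOn (by simp)).differentiableAt hyU
      have h3 : HasDerivAt e (e y * (Complex.I * ((L * deriv φ y : ℝ) : ℂ))) y :=
        ((h2.hasDerivAt.const_mul L).ofReal_comp.const_mul Complex.I).cexp
      have h4 : ((deriv φ y : ℝ) : ℂ) ≠ 0 := Complex.ofReal_ne_zero.2 (hφ' y (has hy))
      rw [show (fun y => q y * e y) = q * e from rfl, (h1.hasDerivAt.mul h3).deriv, hq]
      simp only [Complex.real_smul]
      push_cast
      field_simp
    · have h1 : (fun y => q y * e y) =ᶠ[𝓝 y] 0 :=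
        notMem_tsupport_iff_eventuallyEq.1 fun h => hy (hws h)
      have h2 : q =ᶠ[𝓝 y] 0 :=
        notMem_tsupport_iff_eventuallyEq.1 fun h => hy (hqs h)
      rw [h1.deriv_eq, h2.deriv_eq, image_eq_zero_of_notMem_tsupport hy]
      simp
  simp_rw [hder] at h0
  rw [integral_add (hcont (hqU.deriv_of_isOpen hU (by simp)) ((tsupport_deriv_subset_tsupport _).trans hqs))
    ((hcont ha subset_rfl).const_mul _), integral_const_mul] at h0
  linear_combination (-Complex.I) * h0 + (L : ℂ) * (∫ y, a y * e y) * Complex.I_sq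

/-- Rapid decay of oscillatory integrals without stationary points. -/
theorem BoundedDerivs.norm_integral_mul_exp_le {ι : Type*} {U : Set ℝ} (hU : IsOpen U)
    (hUb : Bornology.IsBounded U) (m : ℕ) {a : ι → ℝ → ℂ} {φ : ι → ℝ → ℝ}
    (ha : BoundedDerivs U m a) (hac : ∀ i, HasCompactSupport (a i)) (has : ∀ i, tsupport (a i) ⊆ U)
    (hφ : ∀ i, ContDiffOn ℝ (⊤ : ℕ∞) (φ i) U) (hφ' : BoundedDerivs U m (fun i => deriv (φ i)))
    {c : ℝ} (hc : 0 < c) (hφc : ∀ i, ∀ y ∈ U, c ≤ |deriv (φ i) y|) :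
    ∃ C : ℝ, ∀ i, ∀ L : ℝ, 0 < L →
      ‖∫ y, a i y * Complex.exp (Complex.I * (L * φ i y : ℝ))‖ ≤ C / L ^ m := by
  induction m generalizing a with
  | zero =>
    obtain ⟨C, hC⟩ := ha.bound
    refine ⟨C * volume.real U, fun i L _ => ?_⟩
    rw [pow_zero, div_one, ← setIntegral_eq_integral_of_forall_compl_eq_zero (s := U)]
    · refine norm_setIntegral_le_of_norm_le_const hUb.measure_lt_top fun y hy => ?_
      rw [norm_mul, Complex.norm_exp_I_mul_ofReal, mul_one]
      exact hC i y hy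
    · intro y hy
      rw [image_eq_zero_of_notMem_tsupport fun h => hy (has i h), zero_mul]
  | succ m ih =>
    have hne : ∀ i, ∀ y ∈ U, deriv (φ i) y ≠ 0 := fun i y hy h => by
      have := hφc i y hy
      rw [h, abs_zero] at this
      linarith
    have hq := (hφ'.inv hU hc hφc).smul hU ha
    have hqs : ∀ i, tsupport (fun y => (deriv (φ i) y)⁻¹ • a i y) ⊆ tsupport (a i) :=
      fun i => tsupport_subset_of_imp fun y h => by simp [h]
    have hds : ∀ i, tsupport (deriv (fun y => (deriv (φ i) y)⁻¹ • a i y)) ⊆ tsupport (a i) :=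
      fun i => (tsupport_deriv_subset_tsupport _).trans (hqs i)
    -- The new amplitude `(a / φ')'` has one controlled derivative fewer, and one factor `L⁻¹` has
    -- been gained.
    obtain ⟨C, hC⟩ := ih hq.2 (fun i => (hac i).mono' fun y hy => hds i (subset_tsupport _ hy))
      (fun i => (hds i).trans (has i)) hφ'.of_succ
    refine ⟨C, fun i L hL => ?_⟩
    have h1 := congrArg norm (integral_mul_exp_eq hU (ha.contDiffOn i) (hac i) (has i) (hφ i)
      (hne i) L)
    rw [norm_mul, norm_mul, Complex.norm_I, one_mul, Complex.norm_real,
      Real.norm_of_nonneg hL.le] at h1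
    have h2 := hC i L hL
    rw [← h1] at h2
    rw [pow_succ, ← div_div, le_div_iff₀ hL, mul_comm]
    exact h2

/-! ### Truncated Gaussian and Fresnel integrals. -/

theorem integral_inv_sub_sq {a b z : ℝ} (hz : ∀ y ∈ Set.uIcc a b, y ≠ z) :
    ∫ y in a..b, ((y - z) ^ 2)⁻¹ = (a - z)⁻¹ - (b - z)⁻¹ := by
  have hne : ∀ y ∈ Set.uIcc a b, y - z ≠ 0 := fun y hy => sub_ne_zero.2 (hz y hy)
  rw [intervalIntegral.integral_eq_sub_of_hasDerivAt (f := fun y => -(y - z)⁻¹)]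
  · ring
  · intro y hy
    have h := (((hasDerivAt_id y).sub_const z).inv (hne y hy)).neg
    exact h.congr_deriv (by simp [neg_div])
  · refine ContinuousOn.intervalIntegrable ?_
    exact ((continuousOn_id.sub continuousOn_const).pow 2).inv₀ fun y hy => pow_ne_zero 2 (hne y hy)

theorem norm_cexp_neg_mul_sq_le_one {b : ℂ} (hb : 0 ≤ b.re) (u : ℝ) :
    ‖Complex.exp (-b * (u : ℂ) ^ 2)‖ ≤ 1 := by
  rw [norm_cexp_neg_mul_sq, Real.exp_le_one_iff]
  nlinarith [sq_nonneg u]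

/-- A tail of the Gaussian integral with a complex parameter. -/
theorem norm_integral_cexp_neg_mul_sq_le {b : ℂ} (hb : 0 ≤ b.re) (hb0 : b ≠ 0) {R S : ℝ}
    (hR : 0 < R) (hRS : R ≤ S) :
    ‖∫ u in R..S, Complex.exp (-b * (u : ℂ) ^ 2)‖ ≤ 1 / (‖b‖ * R) := by
  have hpos : ∀ u ∈ Set.uIcc R S, 0 < u := fun u hu => by
    rw [Set.uIcc_of_le hRS] at hu
    exact hR.trans_le hu.1
  have hS : 0 < S := hR.trans_le hRS
  have hbn : 0 < ‖b‖ := norm_pos_iff.2 hb0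
  set e : ℝ → ℂ := fun u => Complex.exp (-b * (u : ℂ) ^ 2) with he
  have hecont : Continuous e := by fun_prop
  have hgcont : ContinuousOn (fun u : ℝ => (2 * b * (u : ℂ) ^ 2)⁻¹ * e u) (Set.uIcc R S) := by
    refine ContinuousOn.mul (ContinuousOn.inv₀ (by fun_prop) fun u hu => ?_) hecont.continuousOn
    have := (hpos u hu).ne'
    simp [hb0, this]
  -- Integration by parts based on `e = -(2bu)⁻¹ e'`. The two boundary terms and the remaining
  -- integral of `u⁻²` add up to exactly `1 / (‖b‖ R)`.
  have hd : ∀ u ∈ Set.uIcc R S, HasDerivAt (fun u : ℝ => -(2 * b * (u : ℂ))⁻¹ * e u)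
      (e u + (2 * b * (u : ℂ) ^ 2)⁻¹ * e u) u := by
    intro u hu
    have hu0 : (u : ℂ) ≠ 0 := Complex.ofReal_ne_zero.2 (hpos u hu).ne'
    have h0 : HasDerivAt (fun u : ℝ => (u : ℂ)) 1 u := Complex.ofRealCLM.hasDerivAt
    have h1 := ((h0.const_mul (2 * b)).inv (by simp [hb0, hu0])).neg
    have h2 := ((h0.pow 2).const_mul (-b)).cexp
    refine (h1.mul h2).congr_deriv ?_
    simp [he]
    field_simp
    ring
  have h1 := intervalIntegral.integral_eq_sub_of_hasDerivAt hd
    ((hecont.continuousOn.add hgcont).intervalIntegrable)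
  rw [intervalIntegral.integral_add (hecont.intervalIntegrable _ _) hgcont.intervalIntegrable] at h1
  have h2 : ‖∫ u in R..S, (2 * b * (u : ℂ) ^ 2)⁻¹ * e u‖ ≤
      ∫ u in R..S, (2 * ‖b‖)⁻¹ * ((u - 0) ^ 2)⁻¹ := by
    refine intervalIntegral.norm_integral_le_of_norm_le hRS (ae_of_all _ fun u hu => ?_) ?_
    · rw [norm_mul, norm_inv, norm_mul, norm_mul, norm_pow, Complex.norm_real, Complex.norm_ofNat,
        Real.norm_eq_abs, sq_abs, sub_zero, mul_inv]
      exact mul_le_of_le_one_right (by positivity) (norm_cexp_neg_mul_sq_le_one hb u)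
    · refine ContinuousOn.intervalIntegrable (continuousOn_const.mul
        (ContinuousOn.inv₀ (by fun_prop) fun u hu => ?_))
      have := (hpos u hu).ne'
      simp [this]
  rw [intervalIntegral.integral_const_mul, integral_inv_sub_sq fun u hu => (hpos u hu).ne'] at h2
  have h3 : ∀ u : ℝ, 0 < u → ‖-(2 * b * (u : ℂ))⁻¹ * e u‖ ≤ (2 * ‖b‖)⁻¹ * u⁻¹ := by
    intro u hu
    rw [norm_mul, norm_neg, norm_inv, norm_mul, norm_mul, Complex.norm_real, Complex.norm_ofNat,
      Real.norm_of_nonneg hu.le, mul_inv]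
    exact mul_le_of_le_one_right (by positivity) (norm_cexp_neg_mul_sq_le_one hb u)
  have h4 : ∫ u in R..S, e u = -(2 * b * (S : ℂ))⁻¹ * e S - -(2 * b * (R : ℂ))⁻¹ * e R -
      ∫ u in R..S, (2 * b * (u : ℂ) ^ 2)⁻¹ * e u := by linear_combination h1
  rw [h4]
  refine (norm_sub_le _ _).trans ((add_le_add ((norm_sub_le _ _).trans
    (add_le_add (h3 S hS) (h3 R hR))) h2).trans ?_)
  simp only [sub_zero]
  apply le_of_eq
  field_simp
  ring

/-- For `Re b > 0` the integral over the line is explicit, and each of the two tails costs at most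
`1 / (‖b‖ R)`. -/
theorem abs_norm_integral_cexp_sub_le_of_re_pos {b : ℂ} (hb : 0 < b.re) {R : ℝ} (hR : 0 < R) :
    |‖∫ u in (-R)..R, Complex.exp (-b * (u : ℂ) ^ 2)‖ - √(Real.pi / ‖b‖)| ≤ 2 / (‖b‖ * R) := by
  have hb0 : b ≠ 0 := fun h => by simp [h] at hb
  have hint : ∀ x y : ℝ, IntervalIntegrable (fun u : ℝ => Complex.exp (-b * (u : ℂ) ^ 2))
      volume x y := fun x y => (by fun_prop : Continuous _).intervalIntegrable _ _
  have hlim := intervalIntegral_tendsto_integral (integrable_cexp_neg_mul_sq hb)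
    tendsto_neg_atTop_atBot tendsto_id
  have hnorm : ‖∫ u : ℝ, Complex.exp (-b * (u : ℂ) ^ 2)‖ = √(Real.pi / ‖b‖) := by
    rw [integral_gaussian_complex hb,
      show (1 / 2 : ℂ) = ((1 / 2 : ℝ) : ℂ) by norm_num, Complex.norm_cpow_real,
      norm_div, Complex.norm_real, Real.norm_of_nonneg Real.pi_pos.le, Real.sqrt_eq_rpow]
  rw [← hnorm]
  refine (abs_norm_sub_norm_le _ _).trans ?_
  rw [norm_sub_rev]
  refine le_of_tendsto ((hlim.sub_const _).norm) ?_
  filter_upwards [eventually_ge_atTop R] with S hS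
  have h1 : (∫ u in (-S)..S, Complex.exp (-b * (u : ℂ) ^ 2)) -
      ∫ u in (-R)..R, Complex.exp (-b * (u : ℂ) ^ 2) =
      (∫ u in (-S)..(-R), Complex.exp (-b * (u : ℂ) ^ 2)) +
        ∫ u in R..S, Complex.exp (-b * (u : ℂ) ^ 2) := by
    rw [← intervalIntegral.integral_add_adjacent_intervals (hint (-S) (-R)) (hint (-R) S),
      ← intervalIntegral.integral_add_adjacent_intervals (hint (-R) R) (hint R S)]
    ring
  have h2 : (∫ u in (-S)..(-R), Complex.exp (-b * (u : ℂ) ^ 2)) =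
      ∫ u in R..S, Complex.exp (-b * (u : ℂ) ^ 2) := by
    rw [← intervalIntegral.integral_comp_neg]
    simp
  simp only [id] at *
  rw [h1, h2]
  refine (norm_add_le _ _).trans ?_
  have h3 := norm_integral_cexp_neg_mul_sq_le hb.le hb0 hR hS
  calc _ ≤ 1 / (‖b‖ * R) + 1 / (‖b‖ * R) := add_le_add h3 h3
    _ = _ := by ring

/-- Truncated Fresnel and Gaussian integrals. -/
theorem abs_norm_integral_cexp_sub_le {b : ℂ} (hb : 0 ≤ b.re) (hb0 : b ≠ 0) {R : ℝ} (hR : 0 < R) :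
    |‖∫ u in (-R)..R, Complex.exp (-b * (u : ℂ) ^ 2)‖ - √(Real.pi / ‖b‖)| ≤ 2 / (‖b‖ * R) := by
  -- Imaginary `b` is the case needed for stationary phase. It is reached through `b + ε`, since the
  -- bound depends on `‖b‖` only and over a finite interval everything is continuous in `b`.
  have hb' : Tendsto (fun ε : ℝ => b + (ε : ℂ)) (𝓝[>] 0) (𝓝 b) := by
    have : Continuous (fun ε : ℝ => b + (ε : ℂ)) := by fun_prop
    simpa using (this.tendsto 0).mono_left nhdsWithin_le_nhds
  have hcont : Continuous fun z : ℂ => ∫ u in (-R)..R, Complex.exp (-z * (u : ℂ) ^ 2) :=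
    intervalIntegral.continuous_parametric_intervalIntegral_of_continuous' (by fun_prop) _ _
  have hn : Tendsto (fun ε : ℝ => ‖b + (ε : ℂ)‖) (𝓝[>] 0) (𝓝 ‖b‖) := hb'.norm
  have hbn : ‖b‖ ≠ 0 := norm_ne_zero_iff.2 hb0
  have h1 : Tendsto (fun ε : ℝ => |‖∫ u in (-R)..R, Complex.exp (-(b + (ε : ℂ)) * (u : ℂ) ^ 2)‖ -
      √(Real.pi / ‖b + (ε : ℂ)‖)|) (𝓝[>] 0)
      (𝓝 |‖∫ u in (-R)..R, Complex.exp (-b * (u : ℂ) ^ 2)‖ - √(Real.pi / ‖b‖)|) :=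
    (((hcont.tendsto b).comp hb').norm.sub (tendsto_const_nhds.div hn hbn).sqrt).abs
  have h2 : Tendsto (fun ε : ℝ => 2 / (‖b + (ε : ℂ)‖ * R)) (𝓝[>] 0) (𝓝 (2 / (‖b‖ * R))) :=
    tendsto_const_nhds.div (hn.mul_const R) (mul_ne_zero hbn hR.ne')
  refine le_of_tendsto_of_tendsto h1 h2 ?_
  filter_upwards [self_mem_nhdsWithin] with ε hε
  refine abs_norm_integral_cexp_sub_le_of_re_pos ?_ hR
  simp only [Complex.add_re, Complex.ofReal_re]
  have : (0 : ℝ) < ε := hε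
  linarith

/-! ### The method of stationary phase. -/

/-- Oscillatory integrals over an interval at distance `d` from the stationary point `z`. -/
theorem norm_integral_mul_exp_le_of_dist {a b z d c C₀ C₁ M t : ℝ} (hab : a ≤ b) (hd : 0 < d)
    (hc : 0 < c) (ht : 0 < t) {F F' : ℝ → ℂ} (hF : ∀ y ∈ Set.Icc a b, HasDerivAt F (F' y) y)
    (hF' : ContinuousOn F' (Set.Icc a b)) (hC₀ : ∀ y ∈ Set.Icc a b, ‖F y‖ ≤ C₀)
    (hC₁ : ∀ y ∈ Set.Icc a b, ‖F' y‖ ≤ C₁) {ψ p r : ℝ → ℝ}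
    (hψ : ∀ y ∈ Set.Icc a b, HasDerivAt ψ (p y) y) (hp : ∀ y ∈ Set.Icc a b, HasDerivAt p (r y) y)
    (hr : ContinuousOn r (Set.Icc a b)) (hM : ∀ y ∈ Set.Icc a b, |r y| ≤ M)
    (hpz : ∀ y ∈ Set.Icc a b, c * |y - z| ≤ |p y|) (hdist : ∀ y ∈ Set.Icc a b, d ≤ |y - z|) :
    ‖∫ y in a..b, F y * Complex.exp (Complex.I * (t * ψ y : ℝ))‖ ≤
      (2 * C₀ / c + C₁ * (b - a) / c + 2 * C₀ * M / c ^ 2) / (d * t) := by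
  have huI : Set.uIcc a b = Set.Icc a b := Set.uIcc_of_le hab
  have ha : a ∈ Set.Icc a b := Set.left_mem_Icc.2 hab
  have hb : b ∈ Set.Icc a b := Set.right_mem_Icc.2 hab
  have hC₀0 : 0 ≤ C₀ := (norm_nonneg _).trans (hC₀ a ha)
  have hC₁0 : 0 ≤ C₁ := (norm_nonneg _).trans (hC₁ a ha)
  have hM0 : 0 ≤ M := (abs_nonneg _).trans (hM a ha)
  have hlow : ∀ y ∈ Set.Icc a b, c * d ≤ |p y| := fun y hy =>
    (mul_le_mul_of_nonneg_left (hdist y hy) hc.le).trans (hpz y hy)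
  have hcd : 0 < c * d := mul_pos hc hd
  have hp0 : ∀ y ∈ Set.Icc a b, p y ≠ 0 := fun y hy => abs_pos.1 (hcd.trans_le (hlow y hy))
  have hp0' : ∀ y ∈ Set.Icc a b, (p y : ℂ) ≠ 0 := fun y hy => Complex.ofReal_ne_zero.2 (hp0 y hy)
  have hyz : ∀ y ∈ Set.Icc a b, y ≠ z := fun y hy h => by
    have := hdist y hy
    rw [h, sub_self, abs_zero] at this
    linarith
  set e : ℝ → ℂ := fun y => Complex.exp (Complex.I * (t * ψ y : ℝ)) with he
  have hen : ∀ y, ‖e y‖ = 1 := fun y => Complex.norm_exp_I_mul_ofReal _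
  have hFc : ContinuousOn F (Set.Icc a b) := fun y hy => (hF y hy).continuousAt.continuousWithinAt
  have hpc : ContinuousOn (fun y => (p y : ℂ)) (Set.Icc a b) := fun y hy =>
    (Complex.continuous_ofReal.continuousAt.comp (hp y hy).continuousAt).continuousWithinAt
  have hrc : ContinuousOn (fun y => (r y : ℂ)) (Set.Icc a b) :=
    Complex.continuous_ofReal.comp_continuousOn hr
  have hed : ∀ y ∈ Set.Icc a b, HasDerivAt e (e y * (Complex.I * ((t * p y : ℝ) : ℂ))) y :=
    fun y hy => (((hψ y hy).const_mul t).ofReal_comp.const_mul Complex.I).cexp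
  have hec : ContinuousOn e (Set.Icc a b) := fun y hy =>
    (hed y hy).continuousAt.continuousWithinAt
  -- This is `(F / p)' e`, left over after one integration by parts. The dangerous part is of size
  -- `(y - z)⁻²`, whose integral is again of order `1 / d`, like the boundary terms.
  set g : ℝ → ℂ := fun y => (F' y * (p y : ℂ)⁻¹ - F y * r y * ((p y : ℂ) ^ 2)⁻¹) * e y with hg
  have hgc : ContinuousOn g (Set.Icc a b) :=
    ((hF'.mul (hpc.inv₀ hp0')).sub ((hFc.mul hrc).mul
      ((hpc.pow 2).inv₀ fun y hy => pow_ne_zero 2 (hp0' y hy)))).mul hec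
  have hwd : ∀ y ∈ Set.uIcc a b, HasDerivAt (fun y => F y * (p y : ℂ)⁻¹ * e y)
      (g y + (Complex.I * t) * (F y * e y)) y := by
    intro y hy
    rw [huI] at hy
    have h := ((hF y hy).mul ((hp y hy).ofReal_comp.inv (hp0' y hy))).mul (hed y hy)
    refine h.congr_deriv ?_
    have := hp0' y hy
    simp [hg]
    field_simp
    ring
  have hFe : IntervalIntegrable (fun y => F y * e y) volume a b :=
    ContinuousOn.intervalIntegrable (huI ▸ hFc.mul hec)
  have hgi : IntervalIntegrable g volume a b := ContinuousOn.intervalIntegrable (huI ▸ hgc)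
  have h1 := intervalIntegral.integral_eq_sub_of_hasDerivAt hwd (hgi.add (hFe.const_mul _))
  rw [intervalIntegral.integral_add hgi (hFe.const_mul _), intervalIntegral.integral_const_mul]
    at h1
  have hinv : ∀ y ∈ Set.Icc a b, |p y|⁻¹ ≤ (c * d)⁻¹ := fun y hy => inv_anti₀ hcd (hlow y hy)
  have hbd : ∀ y ∈ Set.Icc a b, ‖F y * (p y : ℂ)⁻¹ * e y‖ ≤ C₀ * (c * d)⁻¹ := by
    intro y hy
    rw [norm_mul, norm_mul, hen, mul_one, norm_inv, Complex.norm_real]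
    exact mul_le_mul (hC₀ y hy) (hinv y hy) (by positivity) hC₀0
  have hsqc : ContinuousOn (fun y => ((y - z) ^ 2)⁻¹) (Set.Icc a b) :=
    ContinuousOn.inv₀ (by fun_prop) fun y hy => pow_ne_zero 2 (sub_ne_zero.2 (hyz y hy))
  have hsqi : IntervalIntegrable (fun y => ((y - z) ^ 2)⁻¹) volume a b :=
    ContinuousOn.intervalIntegrable (huI ▸ hsqc)
  have h2 : ‖∫ y in a..b, g y‖ ≤
      ∫ y in a..b, (C₁ * (c * d)⁻¹ + C₀ * M / c ^ 2 * ((y - z) ^ 2)⁻¹) := by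
    refine intervalIntegral.norm_integral_le_of_norm_le hab (ae_of_all _ fun y hy => ?_)
      ((intervalIntegrable_const).add (hsqi.const_mul _))
    have hy' := Set.Ioc_subset_Icc_self hy
    rw [hg]
    simp only
    rw [norm_mul, hen, mul_one]
    refine (norm_sub_le _ _).trans (add_le_add ?_ ?_)
    · rw [norm_mul, norm_inv, Complex.norm_real]
      exact mul_le_mul (hC₁ y hy') (hinv y hy') (by positivity) hC₁0
    · rw [norm_mul, norm_mul, norm_inv, norm_pow, Complex.norm_real, Complex.norm_real,
        div_mul_eq_mul_div, mul_div_assoc]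
      have h3 : (‖p y‖ ^ 2)⁻¹ ≤ ((y - z) ^ 2)⁻¹ / c ^ 2 := by
        rw [← one_div, ← one_div, div_div]
        have h0 : 0 < |y - z| := hd.trans_le (hdist y hy')
        rw [← sq_abs (y - z)]
        refine one_div_le_one_div_of_le (by positivity) ?_
        rw [← mul_pow, mul_comm]
        exact pow_le_pow_left₀ (by positivity) (hpz y hy') 2
      exact mul_le_mul (mul_le_mul (hC₀ y hy') (hM y hy') (norm_nonneg _) hC₀0) h3
        (by positivity) (by positivity)
  rw [intervalIntegral.integral_add intervalIntegrable_const (hsqi.const_mul _),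
    intervalIntegral.integral_const, intervalIntegral.integral_const_mul,
    integral_inv_sub_sq (huI ▸ hyz), smul_eq_mul] at h2
  have h3 : (a - z)⁻¹ - (b - z)⁻¹ ≤ 2 * d⁻¹ := by
    have hi : ∀ y ∈ Set.Icc a b, |(y - z)⁻¹| ≤ d⁻¹ := fun y hy => by
      rw [abs_inv]
      exact inv_anti₀ hd (hdist y hy)
    have h4 := (abs_le.1 (hi a ha)).2
    have h5 := (abs_le.1 (hi b hb)).1
    linarith
  have h6 : Complex.I * t * ∫ y in a..b, F y * e y =
      F b * (p b : ℂ)⁻¹ * e b - F a * (p a : ℂ)⁻¹ * e a - ∫ y in a..b, g y := by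
    linear_combination h1
  have h7 := congrArg norm h6
  rw [norm_mul, norm_mul, Complex.norm_I, one_mul, Complex.norm_real,
    Real.norm_of_nonneg ht.le] at h7
  have h8 : t * ‖∫ y in a..b, F y * e y‖ ≤ C₀ * (c * d)⁻¹ + C₀ * (c * d)⁻¹ +
      ((b - a) * (C₁ * (c * d)⁻¹) + C₀ * M / c ^ 2 * (2 * d⁻¹)) := by
    rw [h7]
    refine (norm_sub_le _ _).trans (add_le_add ((norm_sub_le _ _).trans
      (add_le_add (hbd b hb) (hbd a ha))) (h2.trans ?_))
    gcongr
  rw [le_div_iff₀ (by positivity)]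
  calc ‖∫ y in a..b, F y * e y‖ * (d * t) = d * (t * ‖∫ y in a..b, F y * e y‖) := by ring
    _ ≤ d * (C₀ * (c * d)⁻¹ + C₀ * (c * d)⁻¹ +
      ((b - a) * (C₁ * (c * d)⁻¹) + C₀ * M / c ^ 2 * (2 * d⁻¹))) := by gcongr
    _ = _ := by
      field_simp
      ring

/-- Two applications of the mean value inequality, first to `p y - A (y - z)` and then to `ψ y - A
(y - z)² / 2`. The lost factor `1/2` is harmless. -/
theorem abs_sub_sub_quadratic_le {ψ p r : ℝ → ℝ} {s : Set ℝ} (hs : Convex ℝ s) {z A ε : ℝ}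
    (hz : z ∈ s) (hε : 0 ≤ ε) (hψ : ∀ y ∈ s, HasDerivAt ψ (p y) y)
    (hp : ∀ y ∈ s, HasDerivAt p (r y) y) (hpz : p z = 0) (hr : ∀ y ∈ s, |r y - A| ≤ ε) {y : ℝ}
    (hy : y ∈ s) : |ψ y - ψ z - A * (y - z) ^ 2 / 2| ≤ ε * (y - z) ^ 2 := by
  have h1 : ∀ x ∈ s, |p x - A * (x - z)| ≤ ε * |x - z| := by
    intro x hx
    have h := Convex.norm_image_sub_le_of_norm_hasDerivWithin_le
      (f := fun y => p y - A * (y - z)) (f' := fun y => r y - A) (s := s) (x := z) (y := x) (C := ε)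
      (fun y hy => (((hp y hy).sub (((hasDerivAt_id y).sub_const z).const_mul A)).congr_deriv
        (by ring)).hasDerivWithinAt) hr hs hz hx
    simpa [hpz] using h
  have hsub : Set.uIcc z y ⊆ s := hs.ordConnected.uIcc_subset hz hy
  have h := Convex.norm_image_sub_le_of_norm_hasDerivWithin_le
    (f := fun y => ψ y - A * (y - z) ^ 2 / 2) (f' := fun y => p y - A * (y - z))
    (s := Set.uIcc z y) (x := z) (y := y) (C := ε * |y - z|)
    (fun x hx => (((hψ x (hsub hx)).sub (((((hasDerivAt_id x).sub_const z).pow 2).const_mul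
      A).div_const 2)).congr_deriv (by simp; ring)).hasDerivWithinAt)
    (fun x hx => (h1 x (hsub hx)).trans 
      (mul_le_mul_of_nonneg_left (Set.abs_sub_left_of_mem_uIcc hx) hε))
    (convex_uIcc z y) Set.left_mem_uIcc Set.right_mem_uIcc
  rw [Real.norm_eq_abs, Real.norm_eq_abs, mul_assoc, ← sq, sq_abs] at h
  simp only [sub_self] at h
  convert h using 2
  ring

/-- Convergence of the rescaled phase near the stationary point. -/
theorem tendsto_mul_phase_sub {t z : ℕ → ℝ} (ht : Tendsto t atTop atTop) {z₀ A : ℝ}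
    (hz : Tendsto z atTop (𝓝 z₀)) {α β : ℝ} (hz₀ : z₀ ∈ Set.Ioo α β) {ψ p r : ℕ → ℝ → ℝ}
    (hψ : ∀ᶠ j in atTop, ∀ y ∈ Set.Icc α β, HasDerivAt (ψ j) (p j y) y)
    (hp : ∀ᶠ j in atTop, ∀ y ∈ Set.Icc α β, HasDerivAt (p j) (r j y) y)
    (hpz : ∀ᶠ j in atTop, p j (z j) = 0)
    (hA : ∀ ε > 0, ∃ δ > 0, ∀ᶠ j in atTop, ∀ y, |y - z₀| < δ → |r j y - A| ≤ ε) (u : ℝ) :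
    Tendsto (fun j => t j * (ψ j (z j + (√(t j))⁻¹ * u) - ψ j (z j))) atTop
      (𝓝 (A * u ^ 2 / 2)) := by
  have hs : Tendsto (fun j => (√(t j))⁻¹) atTop (𝓝 0) :=
    tendsto_inv_atTop_zero.comp (Real.tendsto_sqrt_atTop.comp ht)
  have hzu : Tendsto (fun j => z j + (√(t j))⁻¹ * u) atTop (𝓝 z₀) := by
    simpa using hz.add (hs.mul_const u)
  rw [Metric.tendsto_nhds]
  intro ε hε
  obtain ⟨δ, hδ, hr⟩ := hA (ε / (2 * (u ^ 2 + 1))) (by positivity)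
  obtain ⟨η, hη, hηsub⟩ := Metric.isOpen_iff.1 (isOpen_Ioo (a := α) (b := β)) z₀ hz₀
  have hμ : 0 < min δ η := lt_min hδ hη
  filter_upwards [hψ, hp, hpz, hr, (Metric.tendsto_nhds.1 hz) _ hμ, (Metric.tendsto_nhds.1 hzu) _ hμ,
    ht.eventually_gt_atTop 0] with j h1 h2 h3 h4 h5 h6 h7
  have hsub : Metric.ball z₀ (min δ η) ⊆ Set.Icc α β :=
    (Metric.ball_subset_ball (min_le_right _ _)).trans (hηsub.trans Set.Ioo_subset_Icc_self)
  have h := abs_sub_sub_quadratic_le (convex_ball z₀ (min δ η)) (A := A)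
    (Metric.mem_ball.2 h5) (by positivity : 0 ≤ ε / (2 * (u ^ 2 + 1)))
    (fun y hy => h1 y (hsub hy)) (fun y hy => h2 y (hsub hy)) h3
    (fun y hy => h4 y ((Metric.mem_ball.1 hy).trans_le (min_le_left _ _))) (Metric.mem_ball.2 h6)
  have hsq : t j * ((√(t j))⁻¹ * u) ^ 2 = u ^ 2 := by
    rw [mul_pow, inv_pow, Real.sq_sqrt h7.le, ← mul_assoc, mul_inv_cancel₀ h7.ne', one_mul]
  rw [add_sub_cancel_left] at h
  rw [Real.dist_eq]
  have e1 : t j * (ψ j (z j + (√(t j))⁻¹ * u) - ψ j (z j)) - A * u ^ 2 / 2 =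
      t j * (ψ j (z j + (√(t j))⁻¹ * u) - ψ j (z j) - A * ((√(t j))⁻¹ * u) ^ 2 / 2) := by
    linear_combination (A / 2) * hsq
  rw [e1, abs_mul, abs_of_pos h7]
  calc _ ≤ t j * (ε / (2 * (u ^ 2 + 1)) * ((√(t j))⁻¹ * u) ^ 2) := by gcongr
    _ = ε / (2 * (u ^ 2 + 1)) * u ^ 2 := by linear_combination ε / (2 * (u ^ 2 + 1)) * hsq
    _ < ε := by
      rw [div_mul_eq_mul_div, div_lt_iff₀ (by positivity)]
      nlinarith [sq_nonneg u]

/-- The substitution `y = z_j + u / √t_j` absorbs the factor `√t_j` and turns the phase, measured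
from its value at `z_j`, into `A u² / 2` in the limit. Dominated convergence applies on the fixed
interval `[-R, R]`. -/
theorem tendsto_sqrt_mul_norm_integral_near {t z : ℕ → ℝ} (ht : Tendsto t atTop atTop) {z₀ A : ℝ}
    (hz : Tendsto z atTop (𝓝 z₀)) {α β : ℝ} (hz₀ : z₀ ∈ Set.Ioo α β) {ψ p r : ℕ → ℝ → ℝ}
    (hψ : ∀ᶠ j in atTop, ∀ y ∈ Set.Icc α β, HasDerivAt (ψ j) (p j y) y)
    (hp : ∀ᶠ j in atTop, ∀ y ∈ Set.Icc α β, HasDerivAt (p j) (r j y) y)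
    (hpz : ∀ᶠ j in atTop, p j (z j) = 0)
    (hA : ∀ ε > 0, ∃ δ > 0, ∀ᶠ j in atTop, ∀ y, |y - z₀| < δ → |r j y - A| ≤ ε)
    {F : ℝ → ℂ} (hF : Continuous F) {C₀ : ℝ} (hC₀ : ∀ y, ‖F y‖ ≤ C₀) {R : ℝ} (hR : 0 < R) :
    Tendsto (fun j => √(t j) * ‖∫ y in (z j - R * (√(t j))⁻¹)..(z j + R * (√(t j))⁻¹),
        F y * Complex.exp (Complex.I * (t j * ψ j y : ℝ))‖) atTop
      (𝓝 (‖F z₀‖ * ‖∫ u in (-R)..R, Complex.exp (Complex.I * (A * u ^ 2 / 2 : ℝ))‖)) := by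
  have hs : Tendsto (fun j => (√(t j))⁻¹) atTop (𝓝 0) :=
    tendsto_inv_atTop_zero.comp (Real.tendsto_sqrt_atTop.comp ht)
  have hzu : ∀ u, Tendsto (fun j => z j + (√(t j))⁻¹ * u) atTop (𝓝 z₀) := fun u => by
    simpa using hz.add (hs.mul_const u)
  have hlim : Tendsto (fun j => ∫ u in (-R)..R, F (z j + (√(t j))⁻¹ * u) *
        Complex.exp (Complex.I * (t j * (ψ j (z j + (√(t j))⁻¹ * u) - ψ j (z j)) : ℝ))) atTop
      (𝓝 (∫ u in (-R)..R, F z₀ * Complex.exp (Complex.I * (A * u ^ 2 / 2 : ℝ)))) := by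
    refine intervalIntegral.tendsto_integral_filter_of_dominated_convergence (fun _ => C₀) ?_ ?_
      intervalIntegrable_const ?_
    · have hin : ∀ v : ℝ, ∀ᶠ j in atTop, z j + (√(t j))⁻¹ * v ∈ Set.Ioo α β := fun v =>
        (hzu v).eventually (isOpen_Ioo.mem_nhds hz₀)
      filter_upwards [hψ, hin (-R), hin R, ht.eventually_gt_atTop 0] with j h1 h2 h3 h4
      refine ContinuousOn.aestronglyMeasurable ?_ measurableSet_uIoc
      have hmem : ∀ u ∈ Set.uIoc (-R) R, z j + (√(t j))⁻¹ * u ∈ Set.Icc α β := by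
        intro u hu
        rw [Set.uIoc_of_le (by linarith)] at hu
        have hi : 0 < (√(t j))⁻¹ := inv_pos.2 (Real.sqrt_pos.2 h4)
        exact ⟨h2.1.le.trans (by gcongr; exact hu.1.le), le_trans (by gcongr; exact hu.2) h3.2.le⟩
      have hψc : ContinuousOn (fun u => ψ j (z j + (√(t j))⁻¹ * u)) (Set.uIoc (-R) R) :=
        ContinuousOn.comp (t := Set.Icc α β)
          (fun y hy => (h1 y hy).continuousAt.continuousWithinAt) (by fun_prop) hmem
      refine ContinuousOn.mul (by fun_prop) (ContinuousOn.cexp (continuousOn_const.mul ?_))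
      exact Complex.continuous_ofReal.comp_continuousOn
        (continuousOn_const.mul (hψc.sub continuousOn_const))
    · refine Eventually.of_forall fun j => ae_of_all _ fun u _ => ?_
      rw [norm_mul, Complex.norm_exp_I_mul_ofReal, mul_one]
      exact hC₀ _
    · refine ae_of_all _ fun u _ => ?_
      refine ((hF.tendsto z₀).comp (hzu u)).mul (Tendsto.cexp (tendsto_const_nhds.mul ?_))
      exact (Complex.continuous_ofReal.tendsto _).comp
        (tendsto_mul_phase_sub ht hz hz₀ hψ hp hpz hA u)
  rw [← norm_mul, ← intervalIntegral.integral_const_mul]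
  refine hlim.norm.congr' ?_
  filter_upwards [ht.eventually_gt_atTop 0] with j h4
  have hi : 0 < √(t j) := Real.sqrt_pos.2 h4
  have h1 := intervalIntegral.smul_integral_comp_add_mul (a := -R) (b := R)
    (fun y => F y * Complex.exp (Complex.I * (t j * ψ j y : ℝ))) (√(t j))⁻¹ (z j)
  have e1 : z j + (√(t j))⁻¹ * -R = z j - R * (√(t j))⁻¹ := by ring
  have e2 : z j + (√(t j))⁻¹ * R = z j + R * (√(t j))⁻¹ := by ring
  rw [e1, e2] at h1
  rw [← h1, norm_smul, Real.norm_of_nonneg (by positivity), ← mul_assoc,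
    mul_inv_cancel₀ hi.ne', one_mul]
  -- The value of the phase at `z_j` contributes a unimodular constant with no limit in general;
  -- this is why only moduli are compared.
  have h2 : ∀ u, F (z j + (√(t j))⁻¹ * u) *
      Complex.exp (Complex.I * (t j * (ψ j (z j + (√(t j))⁻¹ * u) - ψ j (z j)) : ℝ)) =
      Complex.exp (Complex.I * (-(t j * ψ j (z j)) : ℝ)) * (F (z j + (√(t j))⁻¹ * u) *
      Complex.exp (Complex.I * (t j * ψ j (z j + (√(t j))⁻¹ * u) : ℝ))) := by
    intro u
    rw [mul_left_comm, ← Complex.exp_add]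
    congr 2
    push_cast
    ring
  simp_rw [h2]
  rw [intervalIntegral.integral_const_mul, norm_mul, Complex.norm_exp_I_mul_ofReal, one_mul]

/-- The method of stationary phase, for a sequence of phase functions `ψ j` with stationary
points `z j`. -/
theorem tendsto_sqrt_mul_norm_integral {t z : ℕ → ℝ} (ht : Tendsto t atTop atTop) {z₀ A : ℝ}
    (hz : Tendsto z atTop (𝓝 z₀)) {α β : ℝ} (hz₀ : z₀ ∈ Set.Ioo α β) {ψ p r : ℕ → ℝ → ℝ}
    (hψ : ∀ᶠ j in atTop, ∀ y ∈ Set.Icc α β, HasDerivAt (ψ j) (p j y) y)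
    (hp : ∀ᶠ j in atTop, ∀ y ∈ Set.Icc α β, HasDerivAt (p j) (r j y) y)
    (hr : ∀ᶠ j in atTop, ContinuousOn (r j) (Set.Icc α β))
    {M : ℝ} (hM : ∀ᶠ j in atTop, ∀ y ∈ Set.Icc α β, |r j y| ≤ M)
    (hpz : ∀ᶠ j in atTop, p j (z j) = 0) {c : ℝ} (hc : 0 < c)
    (hpc : ∀ᶠ j in atTop, ∀ y ∈ Set.Icc α β, c * |y - z j| ≤ |p j y|) (hA0 : A ≠ 0)
    (hA : ∀ ε > 0, ∃ δ > 0, ∀ᶠ j in atTop, ∀ y, |y - z₀| < δ → |r j y - A| ≤ ε)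
    {F : ℝ → ℂ} (hF : ContDiff ℝ 1 F) (hFc : HasCompactSupport F) :
    Tendsto (fun j => √(t j) * ‖∫ y in α..β, F y * Complex.exp (Complex.I * (t j * ψ j y : ℝ))‖)
      atTop (𝓝 (‖F z₀‖ * √(2 * Real.pi / |A|))) := by
  obtain ⟨C₀, hC₀⟩ := hFc.exists_bound_of_continuous hF.continuous
  obtain ⟨C₁, hC₁⟩ := hFc.deriv.exists_bound_of_continuous (hF.continuous_deriv le_rfl)
  have hs : Tendsto (fun j => (√(t j))⁻¹) atTop (𝓝 0) :=
    tendsto_inv_atTop_zero.comp (Real.tendsto_sqrt_atTop.comp ht)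
  have hC₀0 : 0 ≤ C₀ := (norm_nonneg _).trans (hC₀ 0)
  have hC₁0 : 0 ≤ C₁ := (norm_nonneg _).trans (hC₁ 0)
  have hαβ : α < β := hz₀.1.trans hz₀.2
  set M' := max M 0 with hM'
  set K : ℝ := 2 * C₀ / c + C₁ * (β - α) / c + 2 * C₀ * M' / c ^ 2 with hK
  have hK0 : 0 ≤ K := by
    have : 0 ≤ β - α := by linarith
    have : 0 ≤ M' := le_max_right _ _
    positivity
  have hA' : 0 < |A| := abs_pos.2 hA0
  rw [Metric.tendsto_nhds]
  intro ε hε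
  -- `D / R` bounds the total error at scale `R`: `2K / R` from the two outer intervals and the rest
  -- from truncating the Fresnel integral. The choice of `R` makes it less than `ε / 2`.
  set D : ℝ := 2 * K + ‖F z₀‖ * (4 / |A|) with hD
  have hD0 : 0 ≤ D := by positivity
  set R : ℝ := 2 * (D + 1) / ε with hR
  have hR0 : 0 < R := by positivity
  have hmid := tendsto_sqrt_mul_norm_integral_near ht hz hz₀ hψ hp hpz hA hF.continuous hC₀ hR0
  have hfres : |‖∫ u in (-R)..R, Complex.exp (Complex.I * (A * u ^ 2 / 2 : ℝ))‖ -
      √(2 * Real.pi / |A|)| ≤ 4 / |A| / R := by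
    have h := abs_norm_integral_cexp_sub_le (b := -(Complex.I * (A / 2 : ℝ))) (by simp)
      (by simp [hA0]) hR0
    have e1 : ‖-(Complex.I * ((A / 2 : ℝ) : ℂ))‖ = |A| / 2 := by
      rw [norm_neg, norm_mul, Complex.norm_I, one_mul, Complex.norm_real, Real.norm_eq_abs,
        abs_div, abs_two]
    have e2 : ∀ u : ℝ, Complex.exp (-(-(Complex.I * ((A / 2 : ℝ) : ℂ))) * (u : ℂ) ^ 2) =
        Complex.exp (Complex.I * (A * u ^ 2 / 2 : ℝ)) := fun u => by
      congr 1
      push_cast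
      ring
    have e3 : Real.pi / (|A| / 2) = 2 * Real.pi / |A| := by field_simp
    have e4 : 2 / (|A| / 2 * R) = 4 / |A| / R := by field_simp; norm_num
    simpa only [e1, e2, e3, e4] using h
  have hin : ∀ v : ℝ, ∀ᶠ j in atTop, z j + v * (√(t j))⁻¹ ∈ Set.Ioo α β := fun v => by
    have : Tendsto (fun j => z j + v * (√(t j))⁻¹) atTop (𝓝 z₀) := by
      simpa using hz.add (hs.const_mul v)
    exact this.eventually (isOpen_Ioo.mem_nhds hz₀)
  filter_upwards [hψ, hp, hr, hM, hpc, hin (-R), hin R, ht.eventually_gt_atTop 0,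
    (Metric.tendsto_nhds.1 hmid) (ε / 2) (by positivity)] with j h1 h2 h3 h4 h5 h6 h7 h8 h9
  have hst : 0 < √(t j) := Real.sqrt_pos.2 h8
  set d : ℝ := R * (√(t j))⁻¹ with hd
  have hd0 : 0 < d := by positivity
  rw [neg_mul, ← hd, ← sub_eq_add_neg] at h6
  have hcontI : ContinuousOn (fun y => F y * Complex.exp (Complex.I * (t j * ψ j y : ℝ)))
      (Set.Icc α β) := by
    have hψc : ContinuousOn (ψ j) (Set.Icc α β) :=
      fun y hy => (h1 y hy).continuousAt.continuousWithinAt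
    exact hF.continuous.continuousOn.mul (ContinuousOn.cexp (continuousOn_const.mul
      (Complex.continuous_ofReal.comp_continuousOn (continuousOn_const.mul hψc))))
  have hint : ∀ a ∈ Set.Icc α β, ∀ b ∈ Set.Icc α β, IntervalIntegrable
      (fun y => F y * Complex.exp (Complex.I * (t j * ψ j y : ℝ))) volume a b := fun a ha b hb =>
    (hcontI.mono (Set.ordConnected_Icc.uIcc_subset ha hb)).intervalIntegrable
  -- With `d = R / √t` the bound `K / (d t)`, multiplied by `√t`, equals `K / R` independently of
  -- `t`.
  have htail : ∀ a b : ℝ, α ≤ a → a ≤ b → b ≤ β → (∀ y ∈ Set.Icc a b, d ≤ |y - z j|) →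
      √(t j) * ‖∫ y in a..b, F y * Complex.exp (Complex.I * (t j * ψ j y : ℝ))‖ ≤ K / R := by
    intro a b ha hab hb hdist
    have hsub : Set.Icc a b ⊆ Set.Icc α β := Set.Icc_subset_Icc ha hb
    have h := norm_integral_mul_exp_le_of_dist hab hd0 hc h8 (F := F) (F' := deriv F)
      (fun y _ => (hF.differentiable (by simp) y).hasDerivAt)
      (hF.continuous_deriv le_rfl).continuousOn (fun y _ => hC₀ y) (fun y _ => hC₁ y)
      (fun y hy => h1 y (hsub hy)) (fun y hy => h2 y (hsub hy)) (h3.mono hsub)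
      (fun y hy => (h4 y (hsub hy)).trans (le_max_left M 0)) (fun y hy => h5 y (hsub hy)) hdist
    have hK' : 2 * C₀ / c + C₁ * (b - a) / c + 2 * C₀ * M' / c ^ 2 ≤ K := by
      rw [hK]
      have : b - a ≤ β - α := by linarith
      gcongr
    calc _ ≤ √(t j) * (K / (d * t j)) := by
          refine mul_le_mul_of_nonneg_left (h.trans ?_) hst.le
          exact div_le_div_of_nonneg_right hK' (by positivity)
      _ = K / R := by
          have : t j = √(t j) ^ 2 := (Real.sq_sqrt h8.le).symm
          rw [hd]
          nth_rw 3 [this]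
          field_simp
  have hL := htail α (z j - d) le_rfl h6.1.le (h6.2.le) fun y hy => by
    rw [abs_of_nonpos (by linarith [hy.2])]
    linarith [hy.2]
  have hRt := htail (z j + d) β h7.1.le h7.2.le le_rfl fun y hy => by
    rw [abs_of_nonneg (by linarith [hy.1])]
    linarith [hy.1]
  have mα : α ∈ Set.Icc α β := Set.left_mem_Icc.2 hαβ.le
  have mβ : β ∈ Set.Icc α β := Set.right_mem_Icc.2 hαβ.le
  have m1 := Set.Ioo_subset_Icc_self h6
  have m2 := Set.Ioo_subset_Icc_self h7
  have hsum := intervalIntegral.integral_add_adjacent_intervals (hint α mα _ m1) (hint _ m1 _ m2)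
  have hsum2 := intervalIntegral.integral_add_adjacent_intervals (hint α mα _ m2) (hint _ m2 β mβ)
  rw [← hsum] at hsum2
  rw [Real.dist_eq] at h9 ⊢
  rw [← hsum2]
  set Il := ∫ y in α..(z j - d), F y * Complex.exp (Complex.I * (t j * ψ j y : ℝ))
  set Im := ∫ y in (z j - d)..(z j + d), F y * Complex.exp (Complex.I * (t j * ψ j y : ℝ))
  set Ir := ∫ y in (z j + d)..β, F y * Complex.exp (Complex.I * (t j * ψ j y : ℝ))
  have h10 : |√(t j) * ‖Il + Im + Ir‖ - √(t j) * ‖Im‖| ≤ 2 * K / R := by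
    rw [← mul_sub, abs_mul, abs_of_pos hst]
    have : |‖Il + Im + Ir‖ - ‖Im‖| ≤ ‖Il‖ + ‖Ir‖ := by
      refine (abs_norm_sub_norm_le _ _).trans ?_
      rw [show Il + Im + Ir - Im = Il + Ir by ring]
      exact norm_add_le _ _
    calc _ ≤ √(t j) * (‖Il‖ + ‖Ir‖) := by gcongr
      _ ≤ K / R + K / R := by rw [mul_add]; exact add_le_add hL hRt
      _ = _ := by ring
  have h11 : |‖F z₀‖ * ‖∫ u in (-R)..R, Complex.exp (Complex.I * (A * u ^ 2 / 2 : ℝ))‖ -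
      ‖F z₀‖ * √(2 * Real.pi / |A|)| ≤ ‖F z₀‖ * (4 / |A| / R) := by
    rw [← mul_sub, abs_mul, abs_of_nonneg (norm_nonneg (F z₀))]
    gcongr
  have h12 : 2 * K / R + ‖F z₀‖ * (4 / |A| / R) < ε / 2 := by
    have : 2 * K / R + ‖F z₀‖ * (4 / |A| / R) = D / R := by rw [hD]; ring
    rw [this, hR, div_div_eq_mul_div, div_lt_iff₀ (by positivity)]
    nlinarith
  rw [abs_lt] at h9 ⊢
  rw [abs_le] at h10 h11
  constructor <;> linarith [h9.1, h9.2, h10.1, h10.2, h11.1, h11.2]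

/-! ### Compact intervals and inverse functions on the line. -/

theorem exists_Icc_subset_of_isCompact {Λ K : Set ℝ} (hΛ : IsOpen Λ) (hΛ' : Λ.OrdConnected)
    (hne : Λ.Nonempty) (hK : IsCompact K) (hKΛ : K ⊆ Λ) :
    ∃ α β : ℝ, α < β ∧ K ⊆ Set.Ioo α β ∧ Set.Icc α β ⊆ Λ := by
  obtain ⟨y₀, hy₀⟩ := hne
  have hK' : IsCompact (insert y₀ K) := hK.insert y₀
  have hne' : (insert y₀ K).Nonempty := Set.insert_nonempty _ _
  have hsub : insert y₀ K ⊆ Λ := Set.insert_subset hy₀ hKΛ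
  have h1 := hsub (hK'.sInf_mem hne')
  have h2 := hsub (hK'.sSup_mem hne')
  obtain ⟨ε₁, hε₁, hb₁⟩ := Metric.isOpen_iff.1 hΛ _ h1
  obtain ⟨ε₂, hε₂, hb₂⟩ := Metric.isOpen_iff.1 hΛ _ h2
  have hα : sInf (insert y₀ K) - ε₁ / 2 ∈ Λ := hb₁ (by
    rw [Metric.mem_ball, Real.dist_eq, sub_sub_cancel_left, abs_neg, abs_of_pos] <;> linarith)
  have hβ : sSup (insert y₀ K) + ε₂ / 2 ∈ Λ := hb₂ (by
    rw [Metric.mem_ball, Real.dist_eq, add_sub_cancel_left, abs_of_pos] <;> linarith)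
  have hle : ∀ y ∈ insert y₀ K, sInf (insert y₀ K) ≤ y ∧ y ≤ sSup (insert y₀ K) := fun y hy =>
    ⟨csInf_le hK'.bddBelow hy, le_csSup hK'.bddAbove hy⟩
  refine ⟨_, _, ?_, fun y hy => ⟨?_, ?_⟩, hΛ'.out hα hβ⟩
  · have := hle y₀ (Set.mem_insert _ _)
    linarith [this.1, this.2]
  · linarith [(hle y (Set.mem_insert_of_mem _ hy)).1]
  · linarith [(hle y (Set.mem_insert_of_mem _ hy)).2]

theorem injOn_of_deriv_ne_zero {Λ : Set ℝ} (hΛ' : Λ.OrdConnected) {q : ℝ → ℝ}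
    (hq : ContinuousOn q Λ) (hq' : ∀ y ∈ Λ, deriv q y ≠ 0) : Set.InjOn q Λ := by
  have key : ∀ a ∈ Λ, ∀ b ∈ Λ, a < b → q a ≠ q b := by
    intro a ha b hb hab h
    obtain ⟨c, hc, hc'⟩ := exists_deriv_eq_zero hab (hq.mono (hΛ'.out ha hb)) h
    exact hq' c (hΛ'.out ha hb (Set.Ioo_subset_Icc_self hc)) hc'
  intro a ha b hb h
  rcases lt_trichotomy a b with hab | hab | hab
  · exact absurd h (key a ha b hb hab)
  · exact hab
  · exact absurd h.symm (key b hb a ha hab)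

theorem ContDiffOn.hasStrictDerivAt_deriv {Λ : Set ℝ} (hΛ : IsOpen Λ) {q : ℝ → ℝ}
    (hq : ContDiffOn ℝ (⊤ : ℕ∞) q Λ) {z : ℝ} (hz : z ∈ Λ) : HasStrictDerivAt q (deriv q z) z :=
  (hq.contDiffAt (hΛ.mem_nhds hz)).hasStrictDerivAt (by simp)

theorem isOpen_image_of_deriv_ne_zero {Λ : Set ℝ} (hΛ : IsOpen Λ) {q : ℝ → ℝ}
    (hq : ContDiffOn ℝ (⊤ : ℕ∞) q Λ) (hq' : ∀ y ∈ Λ, deriv q y ≠ 0) : IsOpen (q '' Λ) := by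
  rw [isOpen_iff_mem_nhds]
  rintro _ ⟨z, hz, rfl⟩
  rw [← (hq.hasStrictDerivAt_deriv hΛ hz).map_nhds_eq (hq' z hz)]
  exact image_mem_map (hΛ.mem_nhds hz)

/-- By injectivity on `Λ`, the globally chosen inverse agrees near `q z` with the local inverse of
the inverse function theorem. -/
theorem hasDerivAt_invFunOn {Λ : Set ℝ} (hΛ : IsOpen Λ) {q : ℝ → ℝ}
    (hq : ContDiffOn ℝ (⊤ : ℕ∞) q Λ) (hq' : ∀ y ∈ Λ, deriv q y ≠ 0) (hinj : Set.InjOn q Λ) {z : ℝ}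
    (hz : z ∈ Λ) : HasDerivAt (Function.invFunOn q Λ) (deriv q z)⁻¹ (q z) := by
  have hs := hq.hasStrictDerivAt_deriv hΛ hz
  have hloc := (hs.to_localInverse (hq' z hz)).hasDerivAt
  refine hloc.congr_of_eventuallyEq ?_
  set g := hs.localInverse q (deriv q z) z (hq' z hz) with hg
  have hgz : g (q z) = z := hs.hasStrictFDerivAt_equiv (hq' z hz) |>.localInverse_apply_image
  have hgc : Tendsto g (𝓝 (q z)) (𝓝 z) := by
    have := hloc.continuousAt.tendsto
    rwa [hgz] at this
  have hr : ∀ᶠ y in 𝓝 (q z), q (g y) = y :=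
    (hs.hasStrictFDerivAt_equiv (hq' z hz)).eventually_right_inverse
  filter_upwards [hgc.eventually (hΛ.mem_nhds hz), hr] with y h1 h2
  have h3 : y ∈ q '' Λ := ⟨g y, h1, h2⟩
  exact hinj (Function.invFunOn_mem h3) h1 ((Function.invFunOn_eq h3).trans h2.symm)

theorem mul_abs_sub_le_of_le_abs_deriv {α β c : ℝ} {k k' : ℝ → ℝ}
    (hk : ∀ y ∈ Set.Icc α β, HasDerivAt k (k' y) y) (hk' : ∀ y ∈ Set.Icc α β, c ≤ |k' y|) {y z : ℝ}
    (hy : y ∈ Set.Icc α β) (hz : z ∈ Set.Icc α β) : c * |y - z| ≤ |k y - k z| := by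
  have key : ∀ a ∈ Set.Icc α β, ∀ b ∈ Set.Icc α β, a < b → c * |b - a| ≤ |k b - k a| := by
    intro a ha b hb hab
    have hsub : Set.Icc a b ⊆ Set.Icc α β := Set.Icc_subset_Icc ha.1 hb.2
    obtain ⟨ξ, hξ, h⟩ := exists_hasDerivAt_eq_slope k k' hab
      (fun y hy => (hk y (hsub hy)).continuousAt.continuousWithinAt)
      (fun y hy => hk y (hsub (Set.Ioo_subset_Icc_self hy)))
    have h1 := hk' ξ (hsub (Set.Ioo_subset_Icc_self hξ))
    rw [h, abs_div, le_div_iff₀ (abs_pos.2 (sub_ne_zero.2 hab.ne'))] at h1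
    exact h1
  rcases lt_trichotomy y z with h | h | h
  · rw [abs_sub_comm y z, abs_sub_comm (k y)]
    exact key y hy z hz h
  · simp [h]
  · exact key z hz y hy h

/-! ### Stationary phase with perturbed phases. -/

/-- Stationary phase for the phases `s ω + φ - χ` with `χ' = q ω'` and a small perturbation `φ`. -/
theorem tendsto_sqrt_mul_norm_integral_perturbed {α β : ℝ} {ω ω₁ ω₂ χ q q₁ : ℝ → ℝ}
    (hω : ∀ y ∈ Set.Icc α β, HasDerivAt ω (ω₁ y) y)
    (hω₁ : ∀ y ∈ Set.Icc α β, HasDerivAt ω₁ (ω₂ y) y) (hω₂ : ContinuousOn ω₂ (Set.Icc α β))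
    (hχ : ∀ y ∈ Set.Icc α β, HasDerivAt χ (q y * ω₁ y) y)
    (hq : ∀ y ∈ Set.Icc α β, HasDerivAt q (q₁ y) y) (hq₁ : ContinuousOn q₁ (Set.Icc α β))
    (hωpos : ∀ y ∈ Set.Icc α β, 0 < ω₁ y) (hq₁0 : ∀ y ∈ Set.Icc α β, q₁ y ≠ 0)
    {φ φ₁ φ₂ : ℕ → ℝ → ℝ} (hφ : ∀ j, ∀ y ∈ Set.Icc α β, HasDerivAt (φ j) (φ₁ j y) y)
    (hφ₁ : ∀ j, ∀ y ∈ Set.Icc α β, HasDerivAt (φ₁ j) (φ₂ j y) y)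
    (hφ₂ : ∀ j, ContinuousOn (φ₂ j) (Set.Icc α β))
    (hsmall₁ : ∀ ε > 0, ∀ᶠ j in atTop, ∀ y ∈ Set.Icc α β, |φ₁ j y| ≤ ε)
    (hsmall₂ : ∀ ε > 0, ∀ᶠ j in atTop, ∀ y ∈ Set.Icc α β, |φ₂ j y| ≤ ε)
    {s t : ℕ → ℝ} (ht : Tendsto t atTop atTop) {z₀ : ℝ} (hz₀ : z₀ ∈ Set.Ioo α β)
    (hs : Tendsto s atTop (𝓝 (q z₀))) {F : ℝ → ℂ} (hF : ContDiff ℝ 1 F)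
    (hFc : HasCompactSupport F) :
    Tendsto (fun j => √(t j) * ‖∫ y in α..β, F y *
        Complex.exp (Complex.I * (t j * (s j * ω y + φ j y - χ y) : ℝ))‖)
      atTop (𝓝 (‖F z₀‖ * √(2 * Real.pi / (ω₁ z₀ * |q₁ z₀|)))) := by
  have hαβ : α < β := hz₀.1.trans hz₀.2
  have hz₀' := Set.Ioo_subset_Icc_self hz₀
  have hIne : (Set.Icc α β).Nonempty := ⟨z₀, hz₀'⟩
  have hω₁c : ContinuousOn ω₁ (Set.Icc α β) := fun y hy => (hω₁ y hy).continuousAt.continuousWithinAt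
  have hqc : ContinuousOn q (Set.Icc α β) := fun y hy => (hq y hy).continuousAt.continuousWithinAt
  obtain ⟨yw, hyw, hw⟩ := isCompact_Icc.exists_isMinOn hIne hω₁c
  set w := ω₁ yw with hwdef
  have hw0 : 0 < w := hωpos yw hyw
  have hwle : ∀ y ∈ Set.Icc α β, w ≤ ω₁ y := fun y hy => hw hy
  obtain ⟨yc, hyc, hc⟩ := isCompact_Icc.exists_isMinOn hIne hq₁.abs
  -- Half of the minimum of `|q'|` is given up to absorb the derivative of `φ' / ω'`.
  set c := |q₁ yc| / 2 with hcdef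
  have hc0 : 0 < c := half_pos (abs_pos.2 (hq₁0 yc hyc))
  have hcle : ∀ y ∈ Set.Icc α β, 2 * c ≤ |q₁ y| := fun y hy => by
    have : |q₁ yc| ≤ |q₁ y| := hc hy
    rw [hcdef]
    linarith
  obtain ⟨W₁, hW₁⟩ := isCompact_Icc.exists_bound_of_continuousOn hω₁c
  obtain ⟨W₂, hW₂⟩ := isCompact_Icc.exists_bound_of_continuousOn hω₂
  obtain ⟨B, hB⟩ := isCompact_Icc.exists_bound_of_continuousOn
    ((hq₁.mul hω₁c).add (hqc.mul hω₂))
  have hW₁0 : 0 ≤ W₁ := (norm_nonneg _).trans (hW₁ z₀ hz₀')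
  have hW₂0 : 0 ≤ W₂ := (norm_nonneg _).trans (hW₂ z₀ hz₀')
  set p : ℕ → ℝ → ℝ := fun j y => s j * ω₁ y + φ₁ j y - q y * ω₁ y with hp
  set r : ℕ → ℝ → ℝ := fun j y => s j * ω₂ y + φ₂ j y - (q₁ y * ω₁ y + q y * ω₂ y) with hr
  -- The phase derivative divided by `ω'`. Unlike the phase derivative itself, it has a derivative
  -- bounded away from zero on all of `[α, β]`, namely close to `-q'`; this gives both the location
  -- of the zero and the linear lower bound.
  set k : ℕ → ℝ → ℝ := fun j y => s j + φ₁ j y / ω₁ y - q y with hk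
  have hpk : ∀ j, ∀ y ∈ Set.Icc α β, p j y = ω₁ y * k j y := fun j y hy => by
    have := (hωpos y hy).ne'
    simp only [hp, hk]
    field_simp
  set k' : ℕ → ℝ → ℝ := fun j y => (φ₂ j y * ω₁ y - φ₁ j y * ω₂ y) / ω₁ y ^ 2 - q₁ y with hk'
  have hkd : ∀ j, ∀ y ∈ Set.Icc α β, HasDerivAt (k j) (k' j y) y := fun j y hy =>
    (((hφ₁ j y hy).div (hω₁ y hy) (hωpos y hy).ne').const_add (s j)).sub (hq y hy)
  have hk'low : ∀ᶠ j in atTop, ∀ y ∈ Set.Icc α β, c ≤ |k' j y| := by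
    have hε : 0 < c * w ^ 2 / (W₁ + W₂ + 1) := by positivity
    filter_upwards [hsmall₁ _ hε, hsmall₂ _ hε] with j h1 h2 y hy
    have e1 : |(φ₂ j y * ω₁ y - φ₁ j y * ω₂ y) / ω₁ y ^ 2| ≤ c := by
      rw [abs_div, abs_of_pos (pow_pos (hωpos y hy) 2), div_le_iff₀ (pow_pos (hωpos y hy) 2)]
      calc _ ≤ |φ₂ j y * ω₁ y| + |φ₁ j y * ω₂ y| := abs_sub _ _
        _ ≤ c * w ^ 2 / (W₁ + W₂ + 1) * W₁ + c * w ^ 2 / (W₁ + W₂ + 1) * W₂ := by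
          rw [abs_mul, abs_mul]
          exact add_le_add (mul_le_mul (h2 y hy) (hW₁ y hy) (abs_nonneg _) hε.le)
            (mul_le_mul (h1 y hy) (hW₂ y hy) (abs_nonneg _) hε.le)
        _ ≤ c * w ^ 2 := by
          rw [← mul_add, div_mul_eq_mul_div, div_le_iff₀ (by positivity)]
          have : 0 < c * w ^ 2 := by positivity
          nlinarith
        _ ≤ c * ω₁ y ^ 2 := by
          have := hwle y hy
          gcongr
    have e2 := hcle y hy
    have e3 := abs_sub_abs_le_abs_sub (q₁ y) ((φ₂ j y * ω₁ y - φ₁ j y * ω₂ y) / ω₁ y ^ 2)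
    rw [abs_sub_comm] at e3
    simp only [hk']
    linarith
  have hklim : ∀ y ∈ Set.Icc α β, Tendsto (fun j => k j y) atTop (𝓝 (q z₀ - q y)) := by
    intro y hy
    have h1 : Tendsto (fun j => φ₁ j y) atTop (𝓝 0) := by
      rw [Metric.tendsto_nhds]
      intro ε hε
      filter_upwards [hsmall₁ (ε / 2) (half_pos hε)] with j hj
      rw [dist_zero_right]
      exact (hj y hy).trans_lt (half_lt_self hε)
    simpa using (hs.add (h1.div_const (ω₁ y))).sub_const (q y)
  have hqinj : Set.InjOn q (Set.Icc α β) := by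
    refine injOn_of_deriv_ne_zero Set.ordConnected_Icc hqc fun y hy => ?_
    rw [(hq y hy).deriv]
    exact hq₁0 y hy
  have mα : α ∈ Set.Icc α β := Set.left_mem_Icc.2 hαβ.le
  have mβ : β ∈ Set.Icc α β := Set.right_mem_Icc.2 hαβ.le
  have hzero : ∀ᶠ j in atTop, ∃ z ∈ Set.Icc α β, k j z = 0 := by
    have hsign : ∀ᶠ j in atTop, (0 : ℝ) ∈ Set.uIcc (k j α) (k j β) := by
      rcases hqc.strictMonoOn_of_injOn_Icc' hαβ.le hqinj with hm | hm
      · filter_upwards [(hklim α mα).eventually_const_lt (sub_pos.2 (hm mα hz₀' hz₀.1)),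
          (hklim β mβ).eventually_lt_const (sub_neg.2 (hm hz₀' mβ hz₀.2))] with j h1 h2
        exact Set.mem_uIcc_of_ge h2.le h1.le
      · filter_upwards [(hklim α mα).eventually_lt_const (sub_neg.2 (hm mα hz₀' hz₀.1)),
          (hklim β mβ).eventually_const_lt (sub_pos.2 (hm hz₀' mβ hz₀.2))] with j h1 h2
        exact Set.mem_uIcc_of_le h1.le h2.le
    filter_upwards [hsign] with j hj
    have hkc : ContinuousOn (k j) (Set.uIcc α β) := by
      rw [Set.uIcc_of_le hαβ.le]
      exact fun y hy => (hkd j y hy).continuousAt.continuousWithinAt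
    obtain ⟨z, hz, hz0⟩ := intermediate_value_uIcc hkc hj
    rw [Set.uIcc_of_le hαβ.le] at hz
    exact ⟨z, hz, hz0⟩
  obtain ⟨z, hz⟩ : ∃ z : ℕ → ℝ, ∀ᶠ j in atTop, z j ∈ Set.Icc α β ∧ k j (z j) = 0 := by
    classical
    -- The value `0` is used only for the finitely many `j` for which no zero is available.
    refine ⟨fun j => if h : ∃ z ∈ Set.Icc α β, k j z = 0 then h.choose else 0, ?_⟩
    filter_upwards [hzero] with j hj
    rw [dif_pos hj]
    exact hj.choose_spec
  have hdist : ∀ᶠ j in atTop, ∀ y ∈ Set.Icc α β, c * |y - z j| ≤ |k j y| := by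
    filter_upwards [hk'low, hz] with j h1 h2 y hy
    have := mul_abs_sub_le_of_le_abs_deriv (hkd j) h1 hy h2.1
    rwa [h2.2, sub_zero] at this
  have hzlim : Tendsto z atTop (𝓝 z₀) := by
    rw [tendsto_iff_norm_sub_tendsto_zero]
    have h0 : Tendsto (fun j => |k j z₀| / c) atTop (𝓝 0) := by
      simpa using ((hklim z₀ hz₀').abs).div_const c
    refine squeeze_zero' (Eventually.of_forall fun _ => norm_nonneg _) ?_ h0
    filter_upwards [hdist] with j hj
    rw [Real.norm_eq_abs, abs_sub_comm, le_div_iff₀ hc0, mul_comm]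
    exact hj z₀ hz₀'
  have hsbd : ∀ᶠ j in atTop, |s j| ≤ |q z₀| + 1 := by
    filter_upwards [hs.abs.eventually_lt_const (lt_add_one |q z₀|)] with j hj
    exact hj.le
  have hωz := hωpos z₀ hz₀'
  -- The limiting second derivative of the phase at `z₀` is `-ω' q'`: the two terms with `ω''`
  -- cancel because `s_j → q z₀`.
  have hA : |(-(ω₁ z₀ * q₁ z₀))| = ω₁ z₀ * |q₁ z₀| := by
    rw [abs_neg, abs_mul, abs_of_pos hωz]
  rw [← hA]
  refine tendsto_sqrt_mul_norm_integral (p := p) (r := r) (z := z) (c := w * c)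
    (M := (|q z₀| + 1) * W₂ + 1 + B) ht hzlim hz₀ ?_ ?_ ?_ ?_ ?_ (mul_pos hw0 hc0) ?_ ?_ ?_ hF hFc
  · exact Eventually.of_forall fun j y hy =>
      (((hω y hy).const_mul (s j)).add (hφ j y hy)).sub (hχ y hy)
  · exact Eventually.of_forall fun j y hy =>
      (((hω₁ y hy).const_mul (s j)).add (hφ₁ j y hy)).sub ((hq y hy).mul (hω₁ y hy))
  · exact Eventually.of_forall fun j =>
      ((continuousOn_const.mul hω₂).add (hφ₂ j)).sub ((hq₁.mul hω₁c).add (hqc.mul hω₂))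
  · filter_upwards [hsbd, hsmall₂ 1 one_pos] with j h1 h2 y hy
    refine (abs_sub _ _).trans (add_le_add ((abs_add_le _ _).trans (add_le_add ?_ (h2 y hy)))
      (hB y hy))
    rw [abs_mul]
    exact mul_le_mul h1 (hW₂ y hy) (abs_nonneg _) (by positivity)
  · filter_upwards [hz] with j hj
    rw [hpk j _ hj.1, hj.2, mul_zero]
  · filter_upwards [hdist] with j hj y hy
    rw [hpk j y hy, abs_mul, mul_assoc]
    have h1 := hj y hy
    have h2 : w ≤ |ω₁ y| := (hwle y hy).trans (le_abs_self _)
    gcongr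
  · exact neg_ne_zero.2 (mul_ne_zero hωz.ne' (hq₁0 z₀ hz₀'))
  · intro ε hε
    have hnhds : Set.Icc α β ∈ 𝓝 z₀ := Icc_mem_nhds hz₀.1 hz₀.2
    have hcont : ContinuousAt (fun y => q z₀ * ω₂ y - (q₁ y * ω₁ y + q y * ω₂ y)) z₀ :=
      ((continuousOn_const.mul hω₂).sub ((hq₁.mul hω₁c).add (hqc.mul hω₂))).continuousAt hnhds
    obtain ⟨δ, hδ, hδ'⟩ := Metric.eventually_nhds_iff.1
      ((Metric.tendsto_nhds.1 hcont (ε / 3) (by positivity)).and hnhds)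
    refine ⟨δ, hδ, ?_⟩
    filter_upwards [hsmall₂ (ε / 3) (by positivity),
      (Metric.tendsto_nhds.1 hs) (ε / 3 / (W₂ + 1)) (by positivity)] with j h1 h2 y hy
    obtain ⟨h3, h4⟩ := hδ' (y := y) hy
    rw [Real.dist_eq] at h2 h3
    have e1 : r j y - -(ω₁ z₀ * q₁ z₀) = (s j - q z₀) * ω₂ y + φ₂ j y +
        ((q z₀ * ω₂ y - (q₁ y * ω₁ y + q y * ω₂ y)) -
          (q z₀ * ω₂ z₀ - (q₁ z₀ * ω₁ z₀ + q z₀ * ω₂ z₀))) := by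
      simp only [hr]
      ring
    have e2 : |(s j - q z₀) * ω₂ y| ≤ ε / 3 := by
      rw [abs_mul]
      calc _ ≤ ε / 3 / (W₂ + 1) * W₂ :=
            mul_le_mul h2.le (hW₂ y h4) (abs_nonneg _) (by positivity)
        _ ≤ ε / 3 := by
          rw [div_mul_eq_mul_div, div_le_iff₀ (by positivity)]
          nlinarith
    rw [e1]
    refine (abs_add_le _ _).trans ((add_le_add ((abs_add_le _ _).trans (add_le_add e2 (h1 y h4)))
      h3.le).trans ?_)
    linarith

/-! ### Oscillatory integrals of the evolution away from stationary points. -/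

theorem BoundedDerivs.coeff {ι : Type*} {U : Set ℝ} {c : ι → ℝ} {B : ℝ} (hc : ∀ i, |c i| ≤ B)
    (m : ℕ) : BoundedDerivs U m (fun i (_ : ℝ) => c i) := by
  induction m generalizing c B with
  | zero => exact ⟨fun i => contDiffOn_const, B, fun i y _ => hc i⟩
  | succ m ih =>
    refine ⟨⟨fun i => contDiffOn_const, B, fun i y _ => hc i⟩, ?_⟩
    simp only [deriv_const']
    exact ih (c := fun _ => 0) (B := 0) fun i => by simp

theorem exists_pos_le_of_isCompact {K : Set ℝ} (hK : IsCompact K) {f : ℝ → ℝ} (hf : ContinuousOn f K)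
    (hpos : ∀ y ∈ K, 0 < f y) : ∃ c, 0 < c ∧ ∀ y ∈ K, c ≤ f y := by
  rcases K.eq_empty_or_nonempty with h | h
  · exact ⟨1, one_pos, fun y hy => by simp [h] at hy⟩
  · obtain ⟨y₀, hy₀, hmin⟩ := hK.exists_isMinOn h hf
    exact ⟨f y₀, hpos y₀ hy₀, fun y hy => hmin hy⟩

/-- The Riemann–Lebesgue lemma for a phase without stationary points. -/
theorem tendsto_integral_mul_exp_zero {Λ : Set ℝ} (hΛ : IsOpen Λ) (hΛ' : Λ.OrdConnected)
    (hne : Λ.Nonempty) {a : ℝ → ℂ} (ha : ContDiffOn ℝ (⊤ : ℕ∞) a Λ) (hac : HasCompactSupport a)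
    (has : tsupport a ⊆ Λ) {χ : ℝ → ℝ} (hχ : ContDiffOn ℝ (⊤ : ℕ∞) χ Λ)
    (hχ' : ∀ y ∈ Λ, deriv χ y ≠ 0) :
    Tendsto (fun t : ℝ => ∫ y, a y * Complex.exp (Complex.I * (t * χ y : ℝ))) atTop (𝓝 0) := by
  obtain ⟨α, β, hαβ, hK, hI⟩ := exists_Icc_subset_of_isCompact hΛ hΛ' hne hac.isCompact has
  have hχd := hχ.deriv_of_isOpen hΛ (m := (⊤ : ℕ∞)) (by simp)
  obtain ⟨c, hc, hcle⟩ := exists_pos_le_of_isCompact isCompact_Icc (hχd.continuousOn.mono hI).abs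
    fun y hy => abs_pos.2 (hχ' y (hI hy))
  have hb : ∀ {f : ℝ → ℂ}, ContDiffOn ℝ (⊤ : ℕ∞) f Λ →
      BoundedDerivs (Set.Ioo α β) 1 (fun _ : Unit => f) := fun hf =>
    BoundedDerivs.const hΛ hf isCompact_Icc hI Set.Ioo_subset_Icc_self 1
  obtain ⟨C, hC⟩ := BoundedDerivs.norm_integral_mul_exp_le isOpen_Ioo
    (Metric.isBounded_Ioo α β) 1 (a := fun _ : Unit => a) (φ := fun _ => χ) (hb ha)
    (fun _ => hac) (fun _ => hK) (fun _ => hχ.mono (Set.Ioo_subset_Icc_self.trans hI))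
    (BoundedDerivs.const hΛ hχd isCompact_Icc hI Set.Ioo_subset_Icc_self 1)
    hc fun _ y hy => hcle y (Set.Ioo_subset_Icc_self hy)
  refine squeeze_zero_norm' ?_ (tendsto_const_nhds.div_atTop tendsto_id : Tendsto
    (fun t : ℝ => C / t) atTop (𝓝 0))
  filter_upwards [eventually_gt_atTop 0] with t ht
  simpa using hC () t ht

theorem tendsto_integral_mul_exp_neg_zero {Λ : Set ℝ} (hΛ : IsOpen Λ) (hΛ' : Λ.OrdConnected)
    (hne : Λ.Nonempty) {a : ℝ → ℂ} (ha : ContDiffOn ℝ (⊤ : ℕ∞) a Λ) (hac : HasCompactSupport a)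
    (has : tsupport a ⊆ Λ) {χ : ℝ → ℝ} (hχ : ContDiffOn ℝ (⊤ : ℕ∞) χ Λ)
    (hχ' : ∀ y ∈ Λ, 0 < deriv χ y) :
    Tendsto (fun t : ℝ => ∫ y, a y * Complex.exp (Complex.I * (-(t * χ y) : ℝ))) atTop (𝓝 0) := by
  have h := tendsto_integral_mul_exp_zero hΛ hΛ' hne ha hac has hχ.neg fun y hy => by
    rw [deriv.fun_neg]
    exact neg_ne_zero.2 (hχ' y hy).ne'
  simpa only [Pi.neg_apply, mul_neg] using h

/-- The oscillatory integrals `∫ g(y) e^{i (σ (ω(y) x_n + Φ_n(y)) - t χ(y))} dy`. -/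
noncomputable def phaseIntegral (ω χ : ℝ → ℝ) (x : ℕ → ℝ) (Φ : ℕ → ℝ → ℝ) (g : ℝ → ℂ) (σ : ℝ)
    (n : ℕ) (t : ℝ) : ℂ :=
  ∫ y, g y * Complex.exp (Complex.I * (σ * (ω y * x n + Φ n y) - t * χ y : ℝ))

theorem norm_phaseIntegral_le_integral (ω χ : ℝ → ℝ) (x : ℕ → ℝ) (Φ : ℕ → ℝ → ℝ) (g : ℝ → ℂ)
    (σ : ℝ) (n : ℕ) (t : ℝ) : ‖phaseIntegral ω χ x Φ g σ n t‖ ≤ ∫ y, ‖g y‖ := by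
  refine (norm_integral_le_integral_norm _).trans (le_of_eq ?_)
  refine integral_congr_ae (ae_of_all _ fun y => ?_)
  simp only [norm_mul, Complex.norm_exp_I_mul_ofReal, mul_one]

/-- For fixed `n` the whole factor `e^{iσ(ω x_n + Φ_n)}` joins the amplitude, and only `tχ` is left
as a phase. This supplies the termwise limits for dominated convergence. -/
theorem tendsto_phaseIntegral_zero {Λ : Set ℝ} (hΛ : IsOpen Λ) (hΛ' : Λ.OrdConnected)
    (hne : Λ.Nonempty) {ω χ : ℝ → ℝ} {x : ℕ → ℝ} {Φ : ℕ → ℝ → ℝ} {g : ℝ → ℂ}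
    (hω : ContDiffOn ℝ (⊤ : ℕ∞) ω Λ) (hΦ : ∀ n, ContDiffOn ℝ (⊤ : ℕ∞) (Φ n) Λ)
    (hχ : ContDiffOn ℝ (⊤ : ℕ∞) χ Λ) (hχ' : ∀ y ∈ Λ, 0 < deriv χ y)
    (hg : ContDiff ℝ (⊤ : ℕ∞) g) (hgc : HasCompactSupport g) (hgs : tsupport g ⊆ Λ) (σ : ℝ)
    (n : ℕ) : Tendsto (fun t => phaseIntegral ω χ x Φ g σ n t) atTop (𝓝 0) := by
  set a : ℝ → ℂ := fun y => g y *
    Complex.exp (Complex.I * ((σ * (ω y * x n + Φ n y) : ℝ) : ℂ)) with ha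
  have has : tsupport a ⊆ tsupport g := tsupport_subset_of_imp fun y h => by simp [ha, h]
  have haΛ : ContDiffOn ℝ (⊤ : ℕ∞) a Λ := hg.contDiffOn.mul (contDiffOn_const.mul
    (Complex.ofRealCLM.contDiff.comp_contDiffOn
      (contDiffOn_const.mul ((hω.mul contDiffOn_const).add (hΦ n))))).cexp
  refine (tendsto_integral_mul_exp_neg_zero hΛ hΛ' hne haΛ
    (hgc.mono' fun y hy => has (subset_tsupport _ hy)) (has.trans hgs) hχ hχ').congr fun t => ?_
  rw [phaseIntegral]
  refine integral_congr_ae (ae_of_all _ fun y => ?_)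
  simp only [ha]
  rw [mul_assoc, ← Complex.exp_add]
  congr 2
  push_cast
  ring

/-- Uniform decay of the oscillatory integrals in the absence of stationary points. -/
theorem norm_phaseIntegral_le {Λ : Set ℝ} (hΛ : IsOpen Λ) {α β : ℝ} (hI : Set.Icc α β ⊆ Λ)
    {ω χ : ℝ → ℝ} {x : ℕ → ℝ} {Φ : ℕ → ℝ → ℝ} {g : ℝ → ℂ}
    (hω : ContDiffOn ℝ (⊤ : ℕ∞) ω Λ) (hΦ : ∀ n, ContDiffOn ℝ (⊤ : ℕ∞) (Φ n) Λ)
    (hχ : ContDiffOn ℝ (⊤ : ℕ∞) χ Λ) (hg : ContDiff ℝ (⊤ : ℕ∞) g) (hgc : HasCompactSupport g)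
    (hgs : tsupport g ⊆ Set.Ioo α β) (σ : ℝ) (m : ℕ) (S : Set (ℕ × ℝ))
    (hSx : ∀ i ∈ S, 0 < x i.1) (hSt : ∀ i ∈ S, 0 < i.2)
    (hΦb : ∀ k, 1 ≤ k → k ≤ m + 1 → ∃ C, ∀ i ∈ S, ∀ y ∈ Set.Icc α β,
      |iteratedDeriv k (Φ i.1) y| ≤ C * x i.1) {c : ℝ} (hc : 0 < c)
    (hlow : ∀ i ∈ S, ∀ y ∈ Set.Ioo α β, c * (x i.1 + i.2) ≤
      |σ * (deriv ω y * x i.1 + deriv (Φ i.1) y) - i.2 * deriv χ y|) :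
    ∃ C, ∀ i ∈ S, ‖phaseIntegral ω χ x Φ g σ i.1 i.2‖ ≤ C / (x i.1 + i.2) ^ m := by
  have hU : IsOpen (Set.Ioo α β) := isOpen_Ioo
  have hUΛ : Set.Ioo α β ⊆ Λ := Set.Ioo_subset_Icc_self.trans hI
  have hL : ∀ i : S, 0 < x i.1.1 + i.1.2 := fun i => add_pos (hSx i i.2) (hSt i i.2)
  -- Dividing by the large parameter `x_n + t` makes the family uniformly smooth over all pairs `(n,
  -- t)`: the coefficients `x_n / (x_n + t)` and `t / (x_n + t)` lie in `[0, 1]`, and the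
  -- derivatives of `Φ_n` are `O(x_n)`.
  set φ : S → ℝ → ℝ := fun i y =>
    (x i.1.1 + i.1.2)⁻¹ * (σ * (ω y * x i.1.1 + Φ i.1.1 y) - i.1.2 * χ y) with hφ
  have hφd : ∀ i, ∀ y ∈ Set.Ioo α β, deriv (φ i) y = (x i.1.1 + i.1.2)⁻¹ *
      (σ * (deriv ω y * x i.1.1 + deriv (Φ i.1.1) y) - i.1.2 * deriv χ y) := by
    intro i y hy
    have hn := hΛ.mem_nhds (hUΛ hy)
    have h1 := ((hω.differentiableOn (by simp)).differentiableAt hn).hasDerivAt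
    have h2 := (((hΦ i.1.1).differentiableOn (by simp)).differentiableAt hn).hasDerivAt
    have h3 := ((hχ.differentiableOn (by simp)).differentiableAt hn).hasDerivAt
    exact (((((h1.mul_const _).add h2).const_mul σ).sub (h3.const_mul _)).const_mul _).deriv
  have hconst : ∀ {f : ℝ → ℝ}, ContDiffOn ℝ (⊤ : ℕ∞) f Λ →
      BoundedDerivs (Set.Ioo α β) m (fun _ : S => f) := fun hf =>
    BoundedDerivs.const hΛ hf isCompact_Icc hI Set.Ioo_subset_Icc_self m
  have hΦB : BoundedDerivs (Set.Ioo α β) m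
      (fun (i : S) y => (x i.1.1 + i.1.2)⁻¹ * deriv (Φ i.1.1) y) := by
    refine BoundedDerivs.of_iteratedDeriv hU (fun i => contDiffOn_const.mul
      (((hΦ i.1.1).mono hUΛ).deriv_of_isOpen hU (by simp))) fun k hk => ?_
    obtain ⟨C, hC⟩ := hΦb (k + 1) (by omega) (by omega)
    refine ⟨|C|, fun i y hy => ?_⟩
    rw [iteratedDeriv_const_mul_field, ← iteratedDeriv_succ', norm_mul, norm_inv,
      Real.norm_of_nonneg (hL i).le, ← div_eq_inv_mul, div_le_iff₀ (hL i)]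
    have hx := hSx i i.2
    have ht := hSt i i.2
    calc _ ≤ C * x i.1.1 := hC i i.2 y (Set.Ioo_subset_Icc_self hy)
      _ ≤ |C| * x i.1.1 := by gcongr; exact le_abs_self C
      _ ≤ |C| * (x i.1.1 + i.1.2) := by gcongr; linarith
  have hc1 : ∀ i : S, |x i.1.1 / (x i.1.1 + i.1.2)| ≤ 1 := fun i => by
    have hx := hSx i i.2
    have ht := hSt i i.2
    rw [abs_of_pos (div_pos hx (hL i)), div_le_one (hL i)]
    linarith
  have hc2 : ∀ i : S, |-(i.1.2 / (x i.1.1 + i.1.2))| ≤ 1 := fun i => by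
    have hx := hSx i i.2
    have ht := hSt i i.2
    rw [abs_neg, abs_of_pos (div_pos ht (hL i)), div_le_one (hL i)]
    linarith
  have hφB : BoundedDerivs (Set.Ioo α β) m (fun i => deriv (φ i)) := by
    have h1 := (BoundedDerivs.coeff hc1 m).smul hU
      (hconst ((contDiffOn_const (c := σ)).mul (hω.deriv_of_isOpen hΛ (by simp))))
    have h2 := (BoundedDerivs.coeff (fun _ : S => le_refl |σ|) m).smul hU hΦB
    have h3 := (BoundedDerivs.coeff hc2 m).smul hU (hconst (hχ.deriv_of_isOpen hΛ (by simp)))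
    refine ((h1.add hU h2).add hU h3).congr hU fun i y hy => ?_
    simp only [smul_eq_mul]
    rw [hφd i y hy]
    ring
  obtain ⟨C, hC⟩ := BoundedDerivs.norm_integral_mul_exp_le hU (Metric.isBounded_Ioo α β) m
    (a := fun _ : S => g) (φ := φ)
    (BoundedDerivs.const hΛ hg.contDiffOn isCompact_Icc hI Set.Ioo_subset_Icc_self m)
    (fun _ => hgc) (fun _ => hgs)
    (fun i => contDiffOn_const.mul ((contDiffOn_const.mul (((hω.mono hUΛ).mul
      contDiffOn_const).add ((hΦ _).mono hUΛ))).sub (contDiffOn_const.mul (hχ.mono hUΛ))))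
    hφB hc (fun i y hy => by
      rw [hφd i y hy, abs_mul, abs_inv, abs_of_pos (hL i), ← div_eq_inv_mul, le_div_iff₀ (hL i)]
      exact hlow i i.2 y hy)
  refine ⟨C, fun i hi => ?_⟩
  have h := hC ⟨i, hi⟩ _ (hL ⟨i, hi⟩)
  have e : ∀ y, (x i.1 + i.2) * φ ⟨i, hi⟩ y = σ * (ω y * x i.1 + Φ i.1 y) - i.2 * χ y := fun y => by
    simp only [hφ]
    rw [← mul_assoc, mul_inv_cancel₀ (hL ⟨i, hi⟩).ne', one_mul]
  simp only [e] at h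
  exact h

theorem PolynomialAsymptotics.exists_bound_iteratedDeriv {a b : ℕ → ℝ} {Λ : Set ℝ} {κ ω : ℝ → ℝ}
    {v x : ℕ → ℝ} {Φ : ℕ → ℝ → ℝ} (hP : PolynomialAsymptotics a b Λ κ ω v x Φ) {K : Set ℝ}
    (hKΛ : K ⊆ Λ) (hK : IsCompact K) (m : ℕ) :
    ∃ N, ∀ k, 1 ≤ k → k ≤ m → ∃ C, ∀ n, N ≤ n → ∀ y ∈ K, |iteratedDeriv k (Φ n) y| ≤ C * x n := by
  have h : ∀ k, ∃ C : ℝ, 1 ≤ k → ∀ᶠ n in atTop, ∀ y ∈ K, |iteratedDeriv k (Φ n) y| ≤ C * x n := by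
    intro k
    by_cases hk : 3 ≤ k
    · obtain ⟨C, hC⟩ := hP.Φ_big K hKΛ hK k hk
      exact ⟨C, fun _ => hC⟩
    · exact ⟨1, fun h1 => hP.Φ_little K hKΛ hK k (by omega) 1 one_pos⟩
  choose C hC using h
  have h2 : ∀ᶠ n in atTop, ∀ k ∈ Finset.Icc 1 m, ∀ y ∈ K, |iteratedDeriv k (Φ n) y| ≤ C k * x n :=
    (Filter.eventually_all_finset _).2 fun k hk => hC k (Finset.mem_Icc.1 hk).1
  obtain ⟨N, hN⟩ := eventually_atTop.1 h2
  exact ⟨N, fun k h1 h2 => ⟨C k, fun n hn => hN n hn k (Finset.mem_Icc.2 ⟨h1, h2⟩)⟩⟩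

namespace PolynomialAsymptotics

variable {a b : ℕ → ℝ} {Λ : Set ℝ} {κ ω : ℝ → ℝ} {v x : ℕ → ℝ} {Φ : ℕ → ℝ → ℝ}

theorem exists_abs_deriv_le (hP : PolynomialAsymptotics a b Λ κ ω v x Φ) {K : Set ℝ}
    (hKΛ : K ⊆ Λ) (hK : IsCompact K) {ε : ℝ} (hε : 0 < ε) :
    ∃ N, ∀ n, N ≤ n → 1 ≤ x n ∧ ∀ y ∈ K, |deriv (Φ n) y| ≤ ε * x n := by
  have h := hP.Φ_little K hKΛ hK 1 (Or.inl rfl) ε hε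
  simp only [iteratedDeriv_one] at h
  exact eventually_atTop.1 ((hP.x_tendsto.eventually_ge_atTop 1).and h)

/-- The terms `-ω' x_n` and `-tχ'` have the same sign and cannot cancel, while `Φ_n'` uses up at
most half of the first. -/
theorem exists_le_abs_deriv_neg (hP : PolynomialAsymptotics a b Λ κ ω v x Φ) (hΛ : IsOpen Λ)
    {χ : ℝ → ℝ} (hχ : ContDiffOn ℝ (⊤ : ℕ∞) χ Λ) (hχ' : ∀ y ∈ Λ, 0 < deriv χ y) {K : Set ℝ}
    (hKΛ : K ⊆ Λ) (hK : IsCompact K) :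
    ∃ c, 0 < c ∧ ∃ N, ∀ n, N ≤ n → ∀ t : ℝ, 0 < t → ∀ y ∈ K,
      c * (x n + t) ≤ |-1 * (deriv ω y * x n + deriv (Φ n) y) - t * deriv χ y| := by
  obtain ⟨c₁, hc₁, h₁⟩ := exists_pos_le_of_isCompact hK ((hP.ω_smooth.deriv_of_isOpen hΛ
    (m := (⊤ : ℕ∞)) (by simp)).continuousOn.mono hKΛ) fun y hy => hP.ω_deriv_pos y (hKΛ hy)
  obtain ⟨c₂, hc₂, h₂⟩ := exists_pos_le_of_isCompact hK ((hχ.deriv_of_isOpen hΛ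
    (m := (⊤ : ℕ∞)) (by simp)).continuousOn.mono hKΛ) fun y hy => hχ' y (hKΛ hy)
  obtain ⟨N, hN⟩ := hP.exists_abs_deriv_le hKΛ hK (half_pos hc₁)
  refine ⟨min (c₁ / 2) c₂, lt_min (half_pos hc₁) hc₂, N, fun n hn t ht y hy => ?_⟩
  obtain ⟨hx, hΦ⟩ := hN n hn
  have h3 := (abs_le.1 (hΦ y hy)).1
  have h4 : c₁ * x n ≤ deriv ω y * x n := by gcongr; exact h₁ y hy
  have h5 : c₂ * t ≤ t * deriv χ y := by rw [mul_comm]; gcongr; exact h₂ y hy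
  have h6 : min (c₁ / 2) c₂ * x n ≤ c₁ / 2 * x n := by gcongr; exact min_le_left _ _
  have h7 : min (c₁ / 2) c₂ * t ≤ c₂ * t := by gcongr; exact min_le_right _ _
  refine le_trans ?_ (neg_le_abs _)
  linarith

/-- The phase derivative is `ω' (x_n - q t) + Φ_n'`. If `x_n / t` avoids a window containing the
values of `q` on `K` in its interior, then `|x_n - q t|` is comparable to `x_n + t`. -/
theorem exists_le_abs_deriv_pos (hP : PolynomialAsymptotics a b Λ κ ω v x Φ) (hΛ : IsOpen Λ)
    {χ q : ℝ → ℝ} (hχq : ∀ y ∈ Λ, deriv χ y = q y * deriv ω y) (hq : ContinuousOn q Λ) {K : Set ℝ}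
    (hKΛ : K ⊆ Λ) (hK : IsCompact K) {p P : ℝ} (hp : 0 < p) (hpq : ∀ y ∈ K, p < q y)
    (hqP : ∀ y ∈ K, q y < P) :
    ∃ c, 0 < c ∧ ∃ N, ∀ n, N ≤ n → ∀ t : ℝ, 0 < t → x n / t ∉ Set.Icc p P → ∀ y ∈ K,
      c * (x n + t) ≤ |1 * (deriv ω y * x n + deriv (Φ n) y) - t * deriv χ y| := by
  obtain ⟨c₁, hc₁, h₁⟩ := exists_pos_le_of_isCompact hK ((hP.ω_smooth.deriv_of_isOpen hΛ
    (m := (⊤ : ℕ∞)) (by simp)).continuousOn.mono hKΛ) fun y hy => hP.ω_deriv_pos y (hKΛ hy)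
  have hqK := hq.mono hKΛ
  obtain ⟨c₂, hc₂, h₂⟩ := exists_pos_le_of_isCompact hK (hqK.sub (continuousOn_const (c := p)))
    fun y hy => sub_pos.2 (hpq y hy)
  obtain ⟨c₃, hc₃, h₃⟩ := exists_pos_le_of_isCompact hK ((continuousOn_const (c := P)).sub hqK)
    fun y hy => sub_pos.2 (hqP y hy)
  -- The first entry serves `x_n < p t`, where `x_n + t ≤ (p + 1) t`; the second serves `x_n > P t`,
  -- where `x_n + t ≤ (P + 1) x_n / P`. The absolute value is there because `P > 0` is known only
  -- once `K` has a point.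
  set d := min (c₂ / (p + 1)) (c₃ / (|P| + 1)) with hd
  have hd0 : 0 < d := lt_min (by positivity) (by positivity)
  obtain ⟨N, hN⟩ := hP.exists_abs_deriv_le hKΛ hK (half_pos (mul_pos hc₁ hd0))
  refine ⟨c₁ * d / 2, by positivity, N, fun n hn t ht hxt y hy => ?_⟩
  obtain ⟨hx, hΦ⟩ := hN n hn
  have hx0 : 0 < x n := by linarith
  have h3 := hΦ y hy
  have key : d * (x n + t) ≤ |x n - q y * t| := by
    by_cases h : x n / t < p
    · rw [div_lt_iff₀ ht] at h
      have h4 : d * (x n + t) ≤ c₂ / (p + 1) * (p * t + t) := by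
        refine mul_le_mul (min_le_left _ _) (by linarith) (by positivity) (by positivity)
      have h5 : c₂ / (p + 1) * (p * t + t) = c₂ * t := by field_simp
      have h6 : c₂ * t ≤ (q y - p) * t := by gcongr; exact h₂ y hy
      refine le_trans ?_ (neg_le_abs _)
      linarith
    · have h' : P < x n / t := by
        by_contra h''
        exact hxt ⟨not_lt.1 h, not_lt.1 h''⟩
      rw [lt_div_iff₀ ht] at h'
      have hP0 : 0 < P := hp.trans ((hpq y hy).trans (hqP y hy))
      rw [abs_of_pos hP0] at hd
      have h6 : c₃ ≤ P - q y := h₃ y hy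
      have htx : t ≤ x n / P := by rw [le_div_iff₀ hP0]; linarith
      have h4 : d * (x n + t) ≤ c₃ / (P + 1) * (x n + x n / P) := by
        refine mul_le_mul ?_ (by linarith) (by positivity) (by positivity)
        rw [hd]
        exact min_le_right _ _
      have h5 : c₃ / (P + 1) * (x n + x n / P) = c₃ * (x n / P) := by
        field_simp
      have h7 : c₃ * (x n / P) ≤ (P - q y) * (x n / P) := by gcongr
      have h8 : q y * t ≤ q y * (x n / P) :=
        mul_le_mul_of_nonneg_left htx (hp.trans (hpq y hy)).le
      have h9 : (P - q y) * (x n / P) = x n - q y * (x n / P) := by field_simp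
      refine le_trans ?_ (le_abs_self _)
      linarith
  have e : 1 * (deriv ω y * x n + deriv (Φ n) y) - t * deriv χ y =
      deriv ω y * (x n - q y * t) + deriv (Φ n) y := by rw [hχq y (hKΛ hy)]; ring
  rw [e]
  have h10 : c₁ * (d * (x n + t)) ≤ |deriv ω y * (x n - q y * t)| := by
    rw [abs_mul]
    exact mul_le_mul ((h₁ y hy).trans (le_abs_self _)) key (by positivity) (abs_nonneg _)
  have h11 := abs_sub_abs_le_abs_sub (deriv ω y * (x n - q y * t)) (-deriv (Φ n) y)
  rw [sub_neg_eq_add, abs_neg] at h11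
  have h12 : 0 < c₁ * d * t := by positivity
  nlinarith

/-- Domination of the terms without stationary points. -/
theorem exists_summable_bound (hP : PolynomialAsymptotics a b Λ κ ω v x Φ) (hΛ : IsOpen Λ)
    {χ : ℝ → ℝ} (hχ : ContDiffOn ℝ (⊤ : ℕ∞) χ Λ) {α β : ℝ} (hI : Set.Icc α β ⊆ Λ) {g : ℝ → ℂ}
    (hg : ContDiff ℝ (⊤ : ℕ∞) g) (hgc : HasCompactSupport g) (hgs : tsupport g ⊆ Set.Ioo α β)
    (σ : ℝ) (T : Set (ℕ × ℝ)) (hlow : ∃ c, 0 < c ∧ ∃ N, ∀ n, N ≤ n → ∀ t : ℝ, 0 < t → (n, t) ∈ T →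
      ∀ y ∈ Set.Icc α β,
        c * (x n + t) ≤ |σ * (deriv ω y * x n + deriv (Φ n) y) - t * deriv χ y|) :
    ∃ B : ℕ → ℝ, Summable B ∧ (∀ n, 0 ≤ B n) ∧ ∀ n, ∀ t : ℝ, 0 < t → (n, t) ∈ T →
      v n ^ 2 * ‖phaseIntegral ω χ x Φ g σ n t‖ ^ 2 ≤ B n := by
  obtain ⟨c, hc, N₁, h₁⟩ := hlow
  obtain ⟨k, hk, hsum⟩ := hP.summable
  -- With `m ≥ k` integrations by parts, `(x_n + t)^{-m} ≤ x_n^{-k}` once `x_n ≥ 1`.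
  obtain ⟨m, hm⟩ := exists_nat_ge k
  obtain ⟨N₂, h₂⟩ := hP.exists_bound_iteratedDeriv hI isCompact_Icc (m + 1)
  obtain ⟨N₃, h₃⟩ := eventually_atTop.1 (hP.x_tendsto.eventually_ge_atTop 1)
  set N := max N₁ (max N₂ N₃) with hN
  have hN₁ : N₁ ≤ N := le_max_left _ _
  have hN₂ : N₂ ≤ N := (le_max_left _ _).trans (le_max_right _ _)
  have hN₃ : N₃ ≤ N := (le_max_right _ _).trans (le_max_right _ _)
  obtain ⟨C, hC⟩ := norm_phaseIntegral_le hΛ hI hP.ω_smooth hP.Φ_smooth hχ hg hgc hgs σ m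
    {i | N ≤ i.1 ∧ 0 < i.2 ∧ i ∈ T} (fun i hi => by linarith [h₃ i.1 (hN₃.trans hi.1)])
    (fun i hi => hi.2.1) (fun k hk1 hk2 => (h₂ k hk1 hk2).imp fun C hC i hi y hy =>
      hC i.1 (hN₂.trans hi.1) y hy) hc
    (fun i hi y hy => h₁ i.1 (hN₁.trans hi.1) i.2 hi.2.1 hi.2.2 y (Set.Ioo_subset_Icc_self hy))
  -- Finitely many initial indices, where the uniform estimates may fail, are covered by the trivial
  -- bound.
  set A : ℕ → ℝ := fun n => if n < N then v n ^ 2 * (∫ y, ‖g y‖) ^ 2 else 0 with hA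
  have hA0 : ∀ n, 0 ≤ A n := fun n => by
    simp only [hA]
    split_ifs <;> positivity
  have hAs : Summable A := summable_of_ne_finset_zero (s := Finset.range N) fun n hn => by
    simp only [hA]
    rw [if_neg (by simpa using hn)]
  refine ⟨fun n => A n + C ^ 2 * (v n ^ 2 * |x n| ^ (-(2 * k))), hAs.add (hsum.mul_left _),
    fun n => add_nonneg (hA0 n) (by positivity), fun n t ht hT => ?_⟩
  by_cases hn : n < N
  · have h4 : v n ^ 2 * ‖phaseIntegral ω χ x Φ g σ n t‖ ^ 2 ≤ A n := by
      simp only [hA]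
      rw [if_pos hn]
      gcongr
      exact norm_phaseIntegral_le_integral _ _ _ _ _ _ _ _
    have h5 : 0 ≤ C ^ 2 * (v n ^ 2 * |x n| ^ (-(2 * k))) := by positivity
    linarith
  · have hn' : N ≤ n := not_lt.1 hn
    have hx := h₃ n (hN₃.trans hn')
    have hx0 : 0 < x n := by linarith
    have h4 := hC (n, t) ⟨hn', ht, hT⟩
    simp only at h4
    have h5 : (x n ^ k) ^ 2 ≤ ((x n + t) ^ m) ^ 2 := by
      have : x n ^ k ≤ (x n + t) ^ m := by
        calc x n ^ k ≤ x n ^ (m : ℝ) := Real.rpow_le_rpow_of_exponent_le hx hm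
          _ = x n ^ m := Real.rpow_natCast _ _
          _ ≤ _ := by gcongr; linarith
      gcongr
    have h6 : |x n| ^ (-(2 * k)) = ((x n ^ k) ^ 2)⁻¹ := by
      rw [abs_of_pos hx0, Real.rpow_neg hx0.le, mul_comm, Real.rpow_mul hx0.le, Real.rpow_two]
    have h7 : ‖phaseIntegral ω χ x Φ g σ n t‖ ^ 2 ≤ C ^ 2 * |x n| ^ (-(2 * k)) := by
      calc _ ≤ (C / (x n + t) ^ m) ^ 2 := by gcongr
        _ = C ^ 2 * (((x n + t) ^ m) ^ 2)⁻¹ := by rw [div_pow, div_eq_mul_inv]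
        _ ≤ C ^ 2 * ((x n ^ k) ^ 2)⁻¹ := by gcongr
        _ = _ := by rw [h6]
    calc v n ^ 2 * ‖phaseIntegral ω χ x Φ g σ n t‖ ^ 2
        ≤ v n ^ 2 * (C ^ 2 * |x n| ^ (-(2 * k))) := by gcongr
      _ = C ^ 2 * (v n ^ 2 * |x n| ^ (-(2 * k))) := by ring
      _ ≤ _ := le_add_of_nonneg_left (hA0 n)

end PolynomialAsymptotics

/-! ### The remainder terms. -/

namespace PolynomialAsymptotics

variable {a b : ℕ → ℝ} {Λ : Set ℝ} {κ ω : ℝ → ℝ} {v x : ℕ → ℝ} {Φ : ℕ → ℝ → ℝ}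

theorem contDiffOn_remainder (hP : PolynomialAsymptotics a b Λ κ ω v x Φ) (n : ℕ) :
    ContDiffOn ℝ (⊤ : ℕ∞) (remainder a b κ ω v x Φ n) Λ := by
  have hpoly : ContDiff ℝ (⊤ : ℕ∞) fun y => (orthoPoly a b n).eval y := by
    simpa only [Polynomial.coe_aeval_eq_eval] using (orthoPoly a b n).contDiff_aeval (𝕜 := ℝ) _
  refine hpoly.contDiffOn.sub ?_
  exact ((contDiffOn_const.mul hP.κ_smooth).mul contDiffOn_const).mul
    ((hP.ω_smooth.mul contDiffOn_const).add (hP.Φ_smooth n)).cos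

/-- The pointwise bound on the sums, uniform on the compact interval, is integrated over it. -/
theorem summable_integral_remainder_sq (hP : PolynomialAsymptotics a b Λ κ ω v x Φ) {α β : ℝ}
    (hI : Set.Icc α β ⊆ Λ) :
    Summable fun n => ∫ y in Set.Icc α β, remainder a b κ ω v x Φ n y ^ 2 := by
  obtain ⟨C, hC⟩ := hP.remainder_bound _ hI isCompact_Icc
  have hint : ∀ n, IntegrableOn (fun y => remainder a b κ ω v x Φ n y ^ 2) (Set.Icc α β) :=
    fun n => (((hP.contDiffOn_remainder n).continuousOn.mono hI).pow 2).integrableOn_compact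
      isCompact_Icc
  refine summable_of_sum_range_le (c := C * volume.real (Set.Icc α β))
    (fun n => integral_nonneg fun y => sq_nonneg _) fun N => ?_
  rw [← integral_finsetSum _ fun n _ => hint n]
  refine (Real.le_norm_self _).trans (norm_setIntegral_le_of_norm_le_const
    measure_Icc_lt_top fun y hy => ?_)
  rw [Real.norm_of_nonneg (Finset.sum_nonneg fun n _ => sq_nonneg _)]
  exact ((hC y hy).1.sum_le_tsum _ fun n _ => sq_nonneg _).trans (hC y hy).2

/-- Cauchy–Schwarz separates `ε_n` from `h`; the unimodular exponential disappears, so the bound is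
independent of `t`. -/
theorem exists_summable_bound_remainder (hP : PolynomialAsymptotics a b Λ κ ω v x Φ) {α β : ℝ}
    (hI : Set.Icc α β ⊆ Λ) {h : ℝ → ℂ} (hh : Continuous h)
    (hs : tsupport h ⊆ Set.Icc α β) (φ : ℝ → ℝ) :
    ∃ B : ℕ → ℝ, Summable B ∧ ∀ n (t : ℝ), ‖∫ y, ((remainder a b κ ω v x Φ n y : ℝ) : ℂ) * h y *
      Complex.exp (Complex.I * (-(t * φ y) : ℝ))‖ ^ 2 ≤ B n := by
  set D : ℝ := ∫ y in Set.Icc α β, ‖h y‖ ^ 2 with hD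
  refine ⟨fun n => (∫ y in Set.Icc α β, remainder a b κ ω v x Φ n y ^ 2) * D,
    (hP.summable_integral_remainder_sq hI).mul_right D, fun n t => ?_⟩
  set μ := volume.restrict (Set.Icc α β) with hμ
  have hεc : ContinuousOn (remainder a b κ ω v x Φ n) (Set.Icc α β) :=
    (hP.contDiffOn_remainder n).continuousOn.mono hI
  have hL1 : MemLp (remainder a b κ ω v x Φ n) 2 μ := by
    rw [memLp_two_iff_integrable_sq (hεc.aestronglyMeasurable measurableSet_Icc)]
    exact (hεc.pow 2).integrableOn_compact isCompact_Icc
  have hL2 : MemLp (fun y => ‖h y‖) 2 μ := by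
    rw [memLp_two_iff_integrable_sq hh.norm.aestronglyMeasurable]
    exact (hh.norm.pow 2).continuousOn.integrableOn_compact isCompact_Icc
  have h1 : ‖∫ y, ((remainder a b κ ω v x Φ n y : ℝ) : ℂ) * h y *
      Complex.exp (Complex.I * (-(t * φ y) : ℝ))‖ ≤
      ∫ y, ‖remainder a b κ ω v x Φ n y‖ * ‖‖h y‖‖ ∂μ := by
    rw [← setIntegral_eq_integral_of_forall_compl_eq_zero (s := Set.Icc α β) fun y hy => by
      rw [image_eq_zero_of_notMem_tsupport fun h' => hy (hs h'), mul_zero, zero_mul]]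
    refine (norm_integral_le_integral_norm _).trans (le_of_eq ?_)
    refine integral_congr_ae (ae_of_all _ fun y => ?_)
    simp only [norm_mul, Complex.norm_exp_I_mul_ofReal, mul_one, Complex.norm_real, norm_norm]
  have h2 := integral_mul_norm_le_Lp_mul_Lq (μ := μ) Real.HolderConjugate.two_two
    (f := remainder a b κ ω v x Φ n) (g := fun y => ‖h y‖) (by simpa using hL1) (by simpa using hL2)
  have h3 := pow_le_pow_left₀ (norm_nonneg _) (h1.trans h2) 2
  refine h3.trans (le_of_eq ?_)
  rw [mul_pow, ← Real.sqrt_eq_rpow, ← Real.sqrt_eq_rpow, Real.sq_sqrt, Real.sq_sqrt]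
  · simp [hD, hμ]
  · exact integral_nonneg fun y => by positivity
  · exact integral_nonneg fun y => by positivity

end PolynomialAsymptotics

/-! ### Asymptotics uniform in the velocity. -/

/-- The limit of `t |I_n(t)|² / (2π)` when `x_n / t = s`, where `q` maps stationary points
to velocities. -/
noncomputable def stationaryDensity (Λ : Set ℝ) (ω q : ℝ → ℝ) (g : ℝ → ℂ) (s : ℝ) : ℝ :=
  ‖g (Function.invFunOn q Λ s)‖ ^ 2 /
    (deriv ω (Function.invFunOn q Λ s) * |deriv q (Function.invFunOn q Λ s)|)

theorem continuousAt_stationaryDensity {Λ : Set ℝ} (hΛ : IsOpen Λ) (hΛ' : Λ.OrdConnected)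
    {ω q : ℝ → ℝ} (hω : ContDiffOn ℝ (⊤ : ℕ∞) ω Λ) (hω' : ∀ y ∈ Λ, 0 < deriv ω y)
    (hq : ContDiffOn ℝ (⊤ : ℕ∞) q Λ) (hq' : ∀ y ∈ Λ, deriv q y ≠ 0) {g : ℝ → ℂ}
    (hg : Continuous g) {s : ℝ} (hs : s ∈ q '' Λ) :
    ContinuousAt (stationaryDensity Λ ω q g) s := by
  have hinj := injOn_of_deriv_ne_zero hΛ' hq.continuousOn hq'
  obtain ⟨z, hz, rfl⟩ := hs
  have hη : ContinuousAt (Function.invFunOn q Λ) (q z) :=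
    (hasDerivAt_invFunOn hΛ hq hq' hinj hz).continuousAt
  have hηz : Function.invFunOn q Λ (q z) = z := hinj.leftInvOn_invFunOn hz
  have hn := hΛ.mem_nhds hz
  have h1 : ContinuousAt (deriv ω) (Function.invFunOn q Λ (q z)) := by
    rw [hηz]
    exact (hω.deriv_of_isOpen hΛ (m := (⊤ : ℕ∞)) (by simp)).continuousOn.continuousAt hn
  have h2 : ContinuousAt (deriv q) (Function.invFunOn q Λ (q z)) := by
    rw [hηz]
    exact (hq.deriv_of_isOpen hΛ (m := (⊤ : ℕ∞)) (by simp)).continuousOn.continuousAt hn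
  refine ContinuousAt.div ((ContinuousAt.comp hg.continuousAt hη).norm.pow 2)
    ((ContinuousAt.comp h1 hη).mul (ContinuousAt.comp h2 hη).abs) ?_
  rw [hηz]
  exact mul_ne_zero (hω' z hz).ne' (abs_ne_zero.2 (hq' z hz))

namespace PolynomialAsymptotics

variable {a b : ℕ → ℝ} {Λ : Set ℝ} {κ ω : ℝ → ℝ} {v x : ℕ → ℝ} {Φ : ℕ → ℝ → ℝ}

/-- With the phase divided by `t`, the coefficient of `ω` is `x_n / t` and the perturbation is `Φ_n
/ t`. Its first two derivatives are `o(x_n) / t = o(1)`, because the velocities converge. -/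
theorem tendsto_mul_norm_phaseIntegral_sq (hP : PolynomialAsymptotics a b Λ κ ω v x Φ)
    (hΛ : IsOpen Λ) (hΛ' : Λ.OrdConnected) {χ q : ℝ → ℝ} (hχ : ContDiffOn ℝ (⊤ : ℕ∞) χ Λ)
    (hq : ContDiffOn ℝ (⊤ : ℕ∞) q Λ) (hχq : ∀ y ∈ Λ, deriv χ y = q y * deriv ω y)
    (hq' : ∀ y ∈ Λ, deriv q y ≠ 0) {g : ℝ → ℂ}
    (hg : ContDiff ℝ (⊤ : ℕ∞) g) (hgc : HasCompactSupport g) (hgs : tsupport g ⊆ Λ) {t : ℕ → ℝ}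
    {n : ℕ → ℕ} (ht0 : ∀ j, 0 < t j) (ht : Tendsto t atTop atTop) {s : ℝ} (hs : s ∈ q '' Λ)
    (hs0 : 0 < s) (hlim : Tendsto (fun j => x (n j) / t j) atTop (𝓝 s)) :
    Tendsto (fun j => t j * ‖phaseIntegral ω χ x Φ g 1 (n j) (t j)‖ ^ 2) atTop
      (𝓝 (2 * Real.pi * stationaryDensity Λ ω q g s)) := by
  have hinj := injOn_of_deriv_ne_zero hΛ' hq.continuousOn hq'
  obtain ⟨z₀, hz₀, rfl⟩ := hs
  have hηz : Function.invFunOn q Λ (q z₀) = z₀ := hinj.leftInvOn_invFunOn hz₀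
  obtain ⟨α, β, hαβ, hK, hI⟩ := exists_Icc_subset_of_isCompact hΛ hΛ' ⟨z₀, hz₀⟩
    (hgc.isCompact.insert z₀) (Set.insert_subset hz₀ hgs)
  have hzI := hK (Set.mem_insert _ _)
  have hgI : tsupport g ⊆ Set.Ioo α β := (Set.subset_insert _ _).trans hK
  have hder : ∀ {f : ℝ → ℝ}, ContDiffOn ℝ (⊤ : ℕ∞) f Λ → ∀ y ∈ Set.Icc α β,
      HasDerivAt f (deriv f y) y := fun hf y hy =>
    ((hf.differentiableOn (by simp)).differentiableAt (hΛ.mem_nhds (hI hy))).hasDerivAt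
  have hdd : ∀ {f : ℝ → ℝ}, ContDiffOn ℝ (⊤ : ℕ∞) f Λ → ContDiffOn ℝ (⊤ : ℕ∞) (deriv f) Λ :=
    fun hf => hf.deriv_of_isOpen hΛ (by simp)
  have hxlim : Tendsto (fun j => x (n j)) atTop atTop := by
    refine (ht.atTop_mul_pos hs0 hlim).congr fun j => ?_
    rw [mul_div_cancel₀ _ (ht0 j).ne']
  -- A positive limiting velocity forces `x_{n_j} → ∞`, and `x` is increasing.
  have hn : Tendsto n atTop atTop := by
    refine tendsto_atTop.2 fun N => ?_
    filter_upwards [hxlim.eventually_gt_atTop (x N)] with j hj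
    exact (hP.x_strictMono.lt_iff_lt.1 hj).le
  have hsmall : ∀ k : ℕ, k = 1 ∨ k = 2 → ∀ ε > 0, ∀ᶠ j in atTop, ∀ y ∈ Set.Icc α β,
      |iteratedDeriv k (Φ (n j)) y / t j| ≤ ε := by
    intro k hk ε hε
    filter_upwards [hn.eventually (hP.Φ_little _ hI isCompact_Icc k hk (ε / (q z₀ + 1))
      (by positivity)), hlim.eventually_lt_const (lt_add_one (q z₀))] with j h1 h2 y hy
    rw [abs_div, abs_of_pos (ht0 j), div_le_iff₀ (ht0 j)]
    rw [div_lt_iff₀ (ht0 j)] at h2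
    calc _ ≤ ε / (q z₀ + 1) * x (n j) := h1 y hy
      _ ≤ ε / (q z₀ + 1) * ((q z₀ + 1) * t j) := by gcongr
      _ = ε * t j := by field_simp
  have h := tendsto_sqrt_mul_norm_integral_perturbed (χ := χ) (q := q) (hder hP.ω_smooth)
    (hder (hdd hP.ω_smooth)) ((hdd (hdd hP.ω_smooth)).continuousOn.mono hI)
    (fun y hy => hχq y (hI hy) ▸ hder hχ y hy) (hder hq) ((hdd hq).continuousOn.mono hI)
    (fun y hy => hP.ω_deriv_pos y (hI hy)) (fun y hy => hq' y (hI hy))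
    (φ := fun j y => Φ (n j) y / t j) (φ₁ := fun j y => deriv (Φ (n j)) y / t j)
    (φ₂ := fun j y => deriv (deriv (Φ (n j))) y / t j)
    (fun j y hy => (hder (hP.Φ_smooth _) y hy).div_const _)
    (fun j y hy => (hder (hdd (hP.Φ_smooth _)) y hy).div_const _)
    (fun j => ((hdd (hdd (hP.Φ_smooth _))).continuousOn.mono hI).div_const _)
    (by simpa only [iteratedDeriv_one] using hsmall 1 (Or.inl rfl))
    (by simpa only [iteratedDeriv_succ, iteratedDeriv_zero] using hsmall 2 (Or.inr rfl))
    ht hzI hlim (hg.of_le (by simp)) hgc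
  have h2 := h.pow 2
  have e1 : (‖g z₀‖ * √(2 * Real.pi / (deriv ω z₀ * |deriv q z₀|))) ^ 2 =
      2 * Real.pi * stationaryDensity Λ ω q g (q z₀) := by
    have := hP.ω_deriv_pos z₀ hz₀
    rw [mul_pow, Real.sq_sqrt (by positivity), stationaryDensity, hηz]
    ring
  rw [e1] at h2
  refine h2.congr fun j => ?_
  rw [mul_pow, Real.sq_sqrt (ht0 j).le, phaseIntegral,
    intervalIntegral.integral_eq_integral_of_support_subset]
  · congr 3
    refine integral_congr_ae (ae_of_all _ fun y => ?_)
    simp only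
    congr 3
    have := (ht0 j).ne'
    field_simp
  · intro y hy
    have : y ∈ tsupport g := subset_tsupport g fun h0 => hy (by simp [h0])
    exact Set.Ioo_subset_Ioc_self (hgI this)

/-- A violating sequence would have a subsequence of convergent velocities in `[p, P]`,
contradicting the sequential limit and the continuity of the density. -/
theorem uniform_mul_norm_phaseIntegral_sq (hP : PolynomialAsymptotics a b Λ κ ω v x Φ)
    (hΛ : IsOpen Λ) (hΛ' : Λ.OrdConnected) {χ q : ℝ → ℝ} (hχ : ContDiffOn ℝ (⊤ : ℕ∞) χ Λ)
    (hq : ContDiffOn ℝ (⊤ : ℕ∞) q Λ) (hχq : ∀ y ∈ Λ, deriv χ y = q y * deriv ω y)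
    (hq' : ∀ y ∈ Λ, deriv q y ≠ 0) {g : ℝ → ℂ}
    (hg : ContDiff ℝ (⊤ : ℕ∞) g) (hgc : HasCompactSupport g) (hgs : tsupport g ⊆ Λ) {p P : ℝ}
    (hp : 0 < p) (hJ : Set.Icc p P ⊆ q '' Λ) {ε : ℝ} (hε : 0 < ε) :
    ∃ T, ∀ t, T ≤ t → ∀ n, x n / t ∈ Set.Icc p P →
      |t * ‖phaseIntegral ω χ x Φ g 1 n t‖ ^ 2 -
        2 * Real.pi * stationaryDensity Λ ω q g (x n / t)| ≤ ε := by
  by_contra! hcon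
  choose t ht n hn hbad using fun j : ℕ => hcon (j + 1)
  obtain ⟨s, hs, ϕ, hϕ, hlim⟩ := isCompact_Icc.tendsto_subseq hn
  have ht0 : ∀ j, 0 < t j := fun j => lt_of_lt_of_le (by positivity) (ht j)
  have htlim : Tendsto t atTop atTop :=
    tendsto_atTop_mono (fun j => (by linarith [ht j] : (j : ℝ) ≤ t j)) tendsto_natCast_atTop_atTop
  have h1 := hP.tendsto_mul_norm_phaseIntegral_sq hΛ hΛ' hχ hq hχq hq' hg hgc hgs
    (t := t ∘ ϕ) (n := n ∘ ϕ) (fun j => ht0 _) (htlim.comp hϕ.tendsto_atTop) (hJ hs)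
    (hp.trans_le hs.1) hlim
  have h2 := ((continuousAt_stationaryDensity hΛ hΛ' hP.ω_smooth hP.ω_deriv_pos hq hq'
    hg.continuous (hJ hs)).tendsto.comp hlim).const_mul (2 * Real.pi)
  have h3 := (h1.sub h2).abs
  rw [sub_self, abs_zero] at h3
  obtain ⟨j, hj⟩ := (h3.eventually_lt_const hε).exists
  exact absurd hj (not_lt.2 (hbad (ϕ j)).le)

end PolynomialAsymptotics

/-! ### Reduction to the exponential with stationary points. -/

theorem summable_norm_sub_sq {u w : ℕ → ℂ} (hu : Summable fun n => ‖u n‖ ^ 2)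
    (hw : Summable fun n => ‖w n‖ ^ 2) :
    (Summable fun n => ‖u n - w n‖ ^ 2) ∧
      |√(∑' n, ‖u n - w n‖ ^ 2) - √(∑' n, ‖u n‖ ^ 2)| ≤ √(∑' n, ‖w n‖ ^ 2) := by
  have hmem : ∀ {r : ℕ → ℂ}, Summable (fun n => ‖r n‖ ^ 2) → Memℓp r 2 := fun h =>
    memℓp_gen (by simpa using h)
  have hnorm : ∀ r : EllTwo, HasSum (fun n => ‖r n‖ ^ 2) (‖r‖ ^ 2) := fun r => by
    simpa using lp.hasSum_norm (p := 2) (by norm_num) r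
  set U : EllTwo := ⟨u, hmem hu⟩
  set W : EllTwo := ⟨w, hmem hw⟩
  have h1 := hnorm U
  have h2 := hnorm W
  have h3 := hnorm (U - W)
  refine ⟨h3.summable, ?_⟩
  have e1 : ∑' n, ‖u n‖ ^ 2 = ‖U‖ ^ 2 := h1.tsum_eq
  have e2 : ∑' n, ‖w n‖ ^ 2 = ‖W‖ ^ 2 := h2.tsum_eq
  have e3 : ∑' n, ‖u n - w n‖ ^ 2 = ‖U - W‖ ^ 2 := h3.tsum_eq
  rw [e1, e2, e3, Real.sqrt_sq (norm_nonneg _), Real.sqrt_sq (norm_nonneg _),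
    Real.sqrt_sq (norm_nonneg _)]
  refine (abs_norm_sub_norm_le _ _).trans (le_of_eq ?_)
  rw [sub_sub_cancel_left, norm_neg]

theorem ContDiffOn.contDiff_of_tsupport_subset {F : Type*} [NormedAddCommGroup F]
    [NormedSpace ℝ F] {Λ : Set ℝ} (hΛ : IsOpen Λ) {g : ℝ → F} (hg : ContDiffOn ℝ (⊤ : ℕ∞) g Λ)
    (hgs : tsupport g ⊆ Λ) : ContDiff ℝ (⊤ : ℕ∞) g := by
  rw [contDiff_iff_contDiffAt]
  intro y
  by_cases hy : y ∈ tsupport g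
  · exact hg.contDiffAt (hΛ.mem_nhds (hgs hy))
  · exact (contDiffAt_const (c := (0 : F))).congr_of_eventuallyEq
      (notMem_tsupport_iff_eventuallyEq.1 hy)

theorem ContinuousOn.integrable_of_tsupport_subset {Λ : Set ℝ} (hΛ : IsOpen Λ) {g : ℝ → ℂ}
    (hg : ContinuousOn g Λ) {f : ℝ → ℂ} (hf : HasCompactSupport f) (hfs : tsupport f ⊆ Λ)
    (h : ∀ y, f y = 0 → g y = 0) : Integrable g := by
  have hs : tsupport g ⊆ tsupport f := tsupport_subset_of_imp h
  exact (continuous_of_tsupport fun y hy =>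
    hg.continuousAt (hΛ.mem_nhds (hfs (hs hy)))).integrable_of_hasCompactSupport
    (hf.mono' fun y hy => hs (subset_tsupport _ hy))

/-- The smooth amplitude `κ √τ f`. -/
noncomputable def amplitude (τ κ : ℝ → ℝ) (f : ℝ → ℂ) (y : ℝ) : ℂ :=
  ((κ y * √(τ y) : ℝ) : ℂ) * f y

theorem tsupport_amplitude_subset (τ κ : ℝ → ℝ) (f : ℝ → ℂ) :
    tsupport (amplitude τ κ f) ⊆ tsupport f :=
  tsupport_subset_of_imp fun y h => by simp [amplitude, h]

theorem contDiffOn_sqrt_of_pos {Λ : Set ℝ} {τ : ℝ → ℝ} (hτ : ContDiffOn ℝ (⊤ : ℕ∞) τ Λ)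
    (hτpos : ∀ y ∈ Λ, 0 < τ y) : ContDiffOn ℝ (⊤ : ℕ∞) (fun y => √(τ y)) Λ :=
  hτ.sqrt fun y hy => (hτpos y hy).ne'

theorem contDiff_amplitude {Λ : Set ℝ} (hΛ : IsOpen Λ) {τ κ : ℝ → ℝ}
    (hτ : ContDiffOn ℝ (⊤ : ℕ∞) τ Λ) (hτpos : ∀ y ∈ Λ, 0 < τ y)
    (hκ : ContDiffOn ℝ (⊤ : ℕ∞) κ Λ) {f : ℝ → ℂ} (hf : ContDiff ℝ (⊤ : ℕ∞) f)
    (hfs : tsupport f ⊆ Λ) : ContDiff ℝ (⊤ : ℕ∞) (amplitude τ κ f) := by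
  refine ContDiffOn.contDiff_of_tsupport_subset hΛ ?_
    ((tsupport_amplitude_subset τ κ f).trans hfs)
  exact (Complex.ofRealCLM.contDiff.comp_contDiffOn
    (hκ.mul (contDiffOn_sqrt_of_pos hτ hτpos))).mul hf.contDiffOn

namespace PolynomialAsymptotics

variable {a b : ℕ → ℝ} {Λ : Set ℝ} {κ ω : ℝ → ℝ} {v x : ℕ → ℝ} {Φ : ℕ → ℝ → ℝ}

theorem integral_orthoPoly_eq (hP : PolynomialAsymptotics a b Λ κ ω v x Φ) (hΛ : IsOpen Λ)
    {τ : ℝ → ℝ} (hτ : ContDiffOn ℝ (⊤ : ℕ∞) τ Λ) (hτpos : ∀ y ∈ Λ, 0 < τ y) {χ : ℝ → ℝ}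
    (hχ : ContDiffOn ℝ (⊤ : ℕ∞) χ Λ) {f : ℝ → ℂ} (hf : ContDiff ℝ (⊤ : ℕ∞) f)
    (hfc : HasCompactSupport f) (hfs : tsupport f ⊆ Λ) (n : ℕ) (t : ℝ) :
    ∫ y, (((orthoPoly a b n).eval y * √(τ y) : ℝ) : ℂ) * f y *
        Complex.exp (Complex.I * (-(t * χ y) : ℝ)) =
      v n * phaseIntegral ω χ x Φ (amplitude τ κ f) 1 n t +
        (v n * phaseIntegral ω χ x Φ (amplitude τ κ f) (-1) n t +
        ∫ y, ((remainder a b κ ω v x Φ n y : ℝ) : ℂ) * (((√(τ y) : ℝ) : ℂ) * f y) *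
          Complex.exp (Complex.I * (-(t * χ y) : ℝ))) := by
  have hgΛ : ContinuousOn (amplitude τ κ f) Λ :=
    (contDiff_amplitude hΛ hτ hτpos hP.κ_smooth hf hfs).continuous.continuousOn
  have hωΦ : ContinuousOn (fun y => ω y * x n + Φ n y) Λ :=
    (hP.ω_smooth.continuousOn.mul continuousOn_const).add (hP.Φ_smooth n).continuousOn
  have hexp : ∀ {φ : ℝ → ℝ}, ContinuousOn φ Λ →
      ContinuousOn (fun y => Complex.exp (Complex.I * (φ y : ℝ))) Λ := fun hφ =>
    (continuousOn_const.mul (Complex.continuous_ofReal.comp_continuousOn hφ)).cexp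
  have hσ : ∀ σ : ℝ, Integrable fun y => amplitude τ κ f y *
      Complex.exp (Complex.I * (σ * (ω y * x n + Φ n y) - t * χ y : ℝ)) := fun σ =>
    ContinuousOn.integrable_of_tsupport_subset hΛ (hgΛ.mul (hexp ((continuousOn_const.mul hωΦ).sub
      (continuousOn_const.mul hχ.continuousOn)))) hfc hfs fun y hy => by simp [amplitude, hy]
  have hr : Integrable fun y => ((remainder a b κ ω v x Φ n y : ℝ) : ℂ) *
      (((√(τ y) : ℝ) : ℂ) * f y) * Complex.exp (Complex.I * (-(t * χ y) : ℝ)) := by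
    refine ContinuousOn.integrable_of_tsupport_subset hΛ ?_ hfc hfs fun y hy => by simp [hy]
    refine ((Complex.continuous_ofReal.comp_continuousOn
      (hP.contDiffOn_remainder n).continuousOn).mul ((Complex.continuous_ofReal.comp_continuousOn
        (contDiffOn_sqrt_of_pos hτ hτpos).continuousOn).mul hf.continuous.continuousOn)).mul ?_
    exact hexp (continuousOn_const.mul hχ.continuousOn).neg
  have hr' : Integrable fun y => (v n : ℂ) * (amplitude τ κ f y *
      Complex.exp (Complex.I * (-1 * (ω y * x n + Φ n y) - t * χ y : ℝ))) +
        ((remainder a b κ ω v x Φ n y : ℝ) : ℂ) * (((√(τ y) : ℝ) : ℂ) * f y) *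
          Complex.exp (Complex.I * (-(t * χ y) : ℝ)) := ((hσ (-1)).const_mul _).add hr
  rw [phaseIntegral, phaseIntegral, ← integral_const_mul, ← integral_const_mul,
    ← integral_add ((hσ (-1)).const_mul _) hr,
    ← integral_add ((hσ 1).const_mul _) hr']
  refine integral_congr_ae (ae_of_all _ fun y => ?_)
  have e1 : Complex.exp (Complex.I * ((1 * (ω y * x n + Φ n y) - t * χ y : ℝ) : ℂ)) =
      Complex.exp (((ω y * x n + Φ n y : ℝ) : ℂ) * Complex.I) *
        Complex.exp (Complex.I * (-(t * χ y) : ℝ)) := by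
    rw [← Complex.exp_add]
    congr 1
    push_cast
    ring
  have e2 : Complex.exp (Complex.I * ((-1 * (ω y * x n + Φ n y) - t * χ y : ℝ) : ℂ)) =
      Complex.exp (-((ω y * x n + Φ n y : ℝ) : ℂ) * Complex.I) *
        Complex.exp (Complex.I * (-(t * χ y) : ℝ)) := by
    rw [← Complex.exp_add]
    congr 1
    push_cast
    ring
  have e3 : (((orthoPoly a b n).eval y : ℝ) : ℂ) = (remainder a b κ ω v x Φ n y : ℝ) +
      κ y * v n * (Complex.exp (((ω y * x n + Φ n y : ℝ) : ℂ) * Complex.I) +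
        Complex.exp (-((ω y * x n + Φ n y : ℝ) : ℂ) * Complex.I)) := by
    rw [← Complex.two_cos, ← Complex.ofReal_cos, remainder]
    push_cast
    ring
  simp only
  rw [e1, e2, amplitude, Complex.ofReal_mul, Complex.ofReal_mul, e3]
  ring

/-- The exponentials with stationary points carry the whole norm asymptotically. -/
theorem tendsto_tsum_phaseIntegral (hP : PolynomialAsymptotics a b Λ κ ω v x Φ) (hΛ : IsOpen Λ)
    (hΛ' : Λ.OrdConnected) (hne : Λ.Nonempty) {τ : ℝ → ℝ} (hτ : ContDiffOn ℝ (⊤ : ℕ∞) τ Λ)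
    (hτpos : ∀ y ∈ Λ, 0 < τ y) {χ : ℝ → ℝ} (hχ : ContDiffOn ℝ (⊤ : ℕ∞) χ Λ)
    (hχ' : ∀ y ∈ Λ, 0 < deriv χ y) {f : ℝ → ℂ} (hf : ContDiff ℝ (⊤ : ℕ∞) f)
    (hfc : HasCompactSupport f) (hfs : tsupport f ⊆ Λ)
    (hsum : ∀ t : ℝ, HasSum (fun n => ‖∫ y, (((orthoPoly a b n).eval y * √(τ y) : ℝ) : ℂ) * f y *
      Complex.exp (Complex.I * (-(t * χ y) : ℝ))‖ ^ 2) (∫ y in Λ, ‖f y‖ ^ 2)) :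
    (∀ t : ℝ, 0 < t → Summable fun n =>
      v n ^ 2 * ‖phaseIntegral ω χ x Φ (amplitude τ κ f) 1 n t‖ ^ 2) ∧
    Tendsto (fun t : ℝ => ∑' n, v n ^ 2 * ‖phaseIntegral ω χ x Φ (amplitude τ κ f) 1 n t‖ ^ 2)
      atTop (𝓝 (∫ y in Λ, ‖f y‖ ^ 2)) := by
  obtain ⟨α, β, hαβ, hK, hI⟩ := exists_Icc_subset_of_isCompact hΛ hΛ' hne hfc.isCompact hfs
  set g := amplitude τ κ f with hg
  set h : ℝ → ℂ := fun y => ((√(τ y) : ℝ) : ℂ) * f y with hh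
  have hgs' : tsupport g ⊆ tsupport f := tsupport_amplitude_subset τ κ f
  have hhs' : tsupport h ⊆ tsupport f := tsupport_subset_of_imp fun y hy => by simp [hh, hy]
  have hgC : ContDiff ℝ (⊤ : ℕ∞) g := contDiff_amplitude hΛ hτ hτpos hP.κ_smooth hf hfs
  have hgc : HasCompactSupport g := hfc.mono' fun y hy => hgs' (subset_tsupport _ hy)
  have hhC : ContDiff ℝ (⊤ : ℕ∞) h := ContDiffOn.contDiff_of_tsupport_subset hΛ
    ((Complex.ofRealCLM.contDiff.comp_contDiffOn (contDiffOn_sqrt_of_pos hτ hτpos)).mul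
      hf.contDiffOn) (hhs'.trans hfs)
  obtain ⟨B₁, hB₁s, hB₁0, hB₁⟩ := hP.exists_summable_bound hΛ hχ hI hgC hgc (hgs'.trans hK) (-1)
    Set.univ (by
      obtain ⟨c, hc, N, hN⟩ := hP.exists_le_abs_deriv_neg hΛ hχ hχ' hI isCompact_Icc
      exact ⟨c, hc, N, fun n hn t ht _ => hN n hn t ht⟩)
  obtain ⟨B₂, hB₂s, hB₂⟩ := hP.exists_summable_bound_remainder hI hhC.continuous
    (hhs'.trans (hK.trans Set.Ioo_subset_Icc_self)) χ
  -- Everything other than the exponential that may have stationary points: the conjugate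
  -- exponential and the remainder. It tends to zero in `ℓ²` by dominated convergence.
  set w : ℝ → ℕ → ℂ := fun t n => v n * phaseIntegral ω χ x Φ g (-1) n t +
    ∫ y, ((remainder a b κ ω v x Φ n y : ℝ) : ℂ) * h y *
      Complex.exp (Complex.I * (-(t * χ y) : ℝ)) with hw
  have hwB : ∀ t : ℝ, 0 < t → ∀ n, ‖w t n‖ ^ 2 ≤ 2 * B₁ n + 2 * B₂ n := by
    intro t ht n
    have h1 := hB₁ n t ht (Set.mem_univ _)
    have h2 := hB₂ n t
    have h3 : ‖w t n‖ ≤ v n * ‖phaseIntegral ω χ x Φ g (-1) n t‖ +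
        ‖∫ y, ((remainder a b κ ω v x Φ n y : ℝ) : ℂ) * h y *
          Complex.exp (Complex.I * (-(t * χ y) : ℝ))‖ := by
      refine (norm_add_le _ _).trans (le_of_eq ?_)
      rw [norm_mul, Complex.norm_real, Real.norm_of_nonneg (hP.v_pos n).le]
    have h4 := pow_le_pow_left₀ (norm_nonneg _) h3 2
    rw [← mul_pow] at h1
    refine h4.trans ((add_sq_le (R := ℝ)).trans ?_)
    rw [← mul_add]
    exact (mul_le_mul_of_nonneg_left (add_le_add h1 h2) zero_le_two).trans (by linarith)
  have hBs : Summable fun n => 2 * B₁ n + 2 * B₂ n := (hB₁s.mul_left 2).add (hB₂s.mul_left 2)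
  have hws : ∀ t : ℝ, 0 < t → Summable fun n => ‖w t n‖ ^ 2 := fun t ht =>
    hBs.of_nonneg_of_le (fun n => by positivity) (hwB t ht)
  have hwlim : Tendsto (fun t : ℝ => ∑' n, ‖w t n‖ ^ 2) atTop (𝓝 0) := by
    have hpt : ∀ n, Tendsto (fun t => ‖w t n‖ ^ 2) atTop (𝓝 0) := by
      intro n
      have h1 := (tendsto_phaseIntegral_zero (x := x) hΛ hΛ' hne hP.ω_smooth hP.Φ_smooth hχ hχ' hgC hgc
        (hgs'.trans hfs) (-1) n).const_mul (v n : ℂ)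
      have has : tsupport (fun y => ((remainder a b κ ω v x Φ n y : ℝ) : ℂ) * h y) ⊆ tsupport f :=
        (tsupport_subset_of_imp fun y hy => by simp [hy]).trans hhs'
      have h2 := tendsto_integral_mul_exp_neg_zero hΛ hΛ' hne
        (a := fun y => ((remainder a b κ ω v x Φ n y : ℝ) : ℂ) * h y)
        ((Complex.ofRealCLM.contDiff.comp_contDiffOn (hP.contDiffOn_remainder n)).mul
          hhC.contDiffOn) (hfc.mono' fun y hy => has (subset_tsupport _ hy)) (has.trans hfs) hχ hχ'
      have h3 := ((h1.add h2).norm).pow 2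
      rw [mul_zero, add_zero, norm_zero, zero_pow two_ne_zero] at h3
      exact h3
    have := tendsto_tsum_of_dominated_convergence hBs hpt (by
      filter_upwards [eventually_gt_atTop 0] with t ht n
      rw [Real.norm_of_nonneg (by positivity)]
      exact hwB t ht n)
    simpa using this
  have heq : ∀ t n, (∫ y, (((orthoPoly a b n).eval y * √(τ y) : ℝ) : ℂ) * f y *
      Complex.exp (Complex.I * (-(t * χ y) : ℝ))) - w t n = v n * phaseIntegral ω χ x Φ g 1 n t := by
    intro t n
    rw [hP.integral_orthoPoly_eq hΛ hτ hτpos hχ hf hfc hfs n t]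
    simp only [hw, hh, hg]
    ring
  have hsq : ∀ t n, ‖(v n : ℂ) * phaseIntegral ω χ x Φ g 1 n t‖ ^ 2 =
      v n ^ 2 * ‖phaseIntegral ω χ x Φ g 1 n t‖ ^ 2 := fun t n => by
    rw [norm_mul, Complex.norm_real, mul_pow, Real.norm_eq_abs, sq_abs]
  have hmain := fun t (ht : 0 < t) => summable_norm_sub_sq (hsum t).summable (hws t ht)
  simp only [heq, hsq] at hmain
  refine ⟨fun t ht => (hmain t ht).1, ?_⟩
  set c := ∫ y in Λ, ‖f y‖ ^ 2 with hc
  have hc0 : 0 ≤ c := integral_nonneg fun y => by positivity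
  -- Square roots of the sums are `ℓ²` norms, to which the reverse triangle inequality applies.
  have hsqrt : Tendsto (fun t : ℝ => √(∑' n, v n ^ 2 * ‖phaseIntegral ω χ x Φ g 1 n t‖ ^ 2)) atTop
      (𝓝 (√c)) := by
    rw [tendsto_iff_norm_sub_tendsto_zero]
    have h0 : Tendsto (fun t : ℝ => √(∑' n, ‖w t n‖ ^ 2)) atTop (𝓝 0) := by
      simpa using hwlim.sqrt
    refine squeeze_zero' (Eventually.of_forall fun _ => norm_nonneg _) ?_ h0
    filter_upwards [eventually_gt_atTop 0] with t ht
    have := (hmain t ht).2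
    rwa [(hsum t).tsum_eq] at this
  have h2 := hsqrt.pow 2
  rw [Real.sq_sqrt hc0] at h2
  refine h2.congr fun t => ?_
  rw [Real.sq_sqrt (tsum_nonneg fun n => by positivity)]

end PolynomialAsymptotics

/-! ### Velocity windows and the bound for the weights. -/

/-- The indices whose velocity `x_n / t` lies in `[p, P]`. -/
def velocityWindow (x : ℕ → ℝ) (p P t : ℝ) : Set ℕ := {n | x n / t ∈ Set.Icc p P}

theorem finite_velocityWindow {x : ℕ → ℝ} (hx : Tendsto x atTop atTop) (p P : ℝ) {t : ℝ}
    (ht : 0 < t) : (velocityWindow x p P t).Finite := by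
  obtain ⟨N, hN⟩ := eventually_atTop.1 (hx.eventually_gt_atTop (P * t))
  refine (Set.finite_lt_nat N).subset fun n hn => ?_
  by_contra h
  exact absurd ((div_le_iff₀ ht).1 hn.2) (not_le.2 (hN n (not_lt.1 h)))

theorem summable_indicator_velocityWindow {x : ℕ → ℝ} (hx : Tendsto x atTop atTop) (p P : ℝ)
    {t : ℝ} (ht : 0 < t) (u : ℕ → ℝ) : Summable ((velocityWindow x p P t).indicator u) :=
  summable_of_hasFiniteSupport
    ((finite_velocityWindow hx p P ht).subset Set.support_indicator_subset)

theorem stationaryDensity_pos {Λ : Set ℝ} (hΛ' : Λ.OrdConnected) {ω q : ℝ → ℝ}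
    (hω' : ∀ y ∈ Λ, 0 < deriv ω y) (hq : ContinuousOn q Λ) (hq' : ∀ y ∈ Λ, deriv q y ≠ 0)
    {g : ℝ → ℂ} {z : ℝ} (hz : z ∈ Λ) (hgz : g z ≠ 0) : 0 < stationaryDensity Λ ω q g (q z) := by
  rw [stationaryDensity, (injOn_of_deriv_ne_zero hΛ' hq hq').leftInvOn_invFunOn hz]
  have := hω' z hz
  have := abs_pos.2 (hq' z hz)
  positivity

namespace PolynomialAsymptotics

variable {a b : ℕ → ℝ} {Λ : Set ℝ} {κ ω : ℝ → ℝ} {v x : ℕ → ℝ} {Φ : ℕ → ℝ → ℝ}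

/-- The Weyl-type bound for the weights `v_n²` in a window of velocities. -/
theorem exists_sum_velocityWindow_le (hP : PolynomialAsymptotics a b Λ κ ω v x Φ) (hΛ : IsOpen Λ)
    (hΛ' : Λ.OrdConnected) (hne : Λ.Nonempty) {τ : ℝ → ℝ} (hτ : ContDiffOn ℝ (⊤ : ℕ∞) τ Λ)
    (hτpos : ∀ y ∈ Λ, 0 < τ y) {χ q : ℝ → ℝ} (hχ : ContDiffOn ℝ (⊤ : ℕ∞) χ Λ)
    (hq : ContDiffOn ℝ (⊤ : ℕ∞) q Λ) (hχq : ∀ y ∈ Λ, deriv χ y = q y * deriv ω y)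
    (hq0 : ∀ y ∈ Λ, 0 < q y) (hq' : ∀ y ∈ Λ, deriv q y ≠ 0)
    (hsum : ∀ f : ℝ → ℂ, ContDiff ℝ (⊤ : ℕ∞) f → HasCompactSupport f → tsupport f ⊆ Λ → ∀ t : ℝ,
      HasSum (fun n => ‖∫ y, (((orthoPoly a b n).eval y * √(τ y) : ℝ) : ℂ) * f y *
        Complex.exp (Complex.I * (-(t * χ y) : ℝ))‖ ^ 2) (∫ y in Λ, ‖f y‖ ^ 2))
    {p P : ℝ} (hp : 0 < p) (hJ : Set.Icc p P ⊆ q '' Λ) :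
    ∃ M, ∀ᶠ t in atTop,
      t⁻¹ * ∑' n, (velocityWindow x p P t).indicator (fun n => v n ^ 2) n ≤ M := by
  have hinj := injOn_of_deriv_ne_zero hΛ' hq.continuousOn hq'
  have hη : ContinuousOn (Function.invFunOn q Λ) (Set.Icc p P) := fun s hs => by
    obtain ⟨z, hz, rfl⟩ := hJ hs
    exact (hasDerivAt_invFunOn hΛ hq hq' hinj hz).continuousAt.continuousWithinAt
  have hηΛ : Function.invFunOn q Λ '' Set.Icc p P ⊆ Λ := by
    rintro _ ⟨s, hs, rfl⟩
    exact Function.invFunOn_mem (hJ hs)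
  obtain ⟨α, β, -, hK, hI⟩ := exists_Icc_subset_of_isCompact hΛ hΛ' hne
    (isCompact_Icc.image_of_continuousOn hη) hηΛ
  -- An auxiliary function vanishing nowhere on the stationary points of the window. Its density
  -- then has a positive minimum `c` there.
  obtain ⟨ψ, hψs, hψ, -⟩ := (isOpen_Ioo (a := α) (b := β)).exists_contDiff_support_eq (n := ⊤)
  set f : ℝ → ℂ := fun y => (ψ y : ℂ) with hfdef
  have hf : ContDiff ℝ (⊤ : ℕ∞) f := Complex.ofRealCLM.contDiff.comp hψ
  have hfI : tsupport f ⊆ Set.Icc α β := closure_minimal (fun y hy => by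
    have : y ∈ Function.support ψ := fun h => hy (by simp [hfdef, h])
    rw [hψs] at this
    exact Set.Ioo_subset_Icc_self this) isClosed_Icc
  have hfc : HasCompactSupport f := isCompact_Icc.of_isClosed_subset (isClosed_tsupport _) hfI
  have hfs := hfI.trans hI
  set g := amplitude τ κ f with hg
  have hgs : tsupport g ⊆ tsupport f := tsupport_amplitude_subset τ κ f
  have hgC : ContDiff ℝ (⊤ : ℕ∞) g := contDiff_amplitude hΛ hτ hτpos hP.κ_smooth hf hfs
  have hgc : HasCompactSupport g := hfc.mono' fun y hy => hgs (subset_tsupport _ hy)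
  have hχ' : ∀ y ∈ Λ, 0 < deriv χ y := fun y hy => by
    rw [hχq y hy]
    exact mul_pos (hq0 y hy) (hP.ω_deriv_pos y hy)
  obtain ⟨hsm, hlim⟩ := hP.tendsto_tsum_phaseIntegral hΛ hΛ' hne hτ hτpos hχ hχ' hf hfc hfs
    (hsum f hf hfc hfs)
  obtain ⟨c, hc, hcle⟩ := exists_pos_le_of_isCompact isCompact_Icc
    (f := stationaryDensity Λ ω q g) (K := Set.Icc p P)
    (fun s hs => (continuousAt_stationaryDensity hΛ hΛ' hP.ω_smooth hP.ω_deriv_pos hq hq'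
      hgC.continuous (hJ hs)).continuousWithinAt) (by
      intro s hs
      obtain ⟨z, hz, rfl⟩ := hJ hs
      refine stationaryDensity_pos hΛ' hP.ω_deriv_pos hq.continuousOn hq' hz ?_
      have hzI : z ∈ Function.support ψ := by
        rw [hψs, ← hinj.leftInvOn_invFunOn hz]
        exact hK (Set.mem_image_of_mem _ hs)
      have h1 := hP.κ_pos z hz
      have h2 := Real.sqrt_pos.2 (hτpos z hz)
      exact mul_ne_zero (Complex.ofReal_ne_zero.2 (mul_pos h1 h2).ne')
        (Complex.ofReal_ne_zero.2 hzI))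
  -- An error of `πc` leaves `t |I_n(t)|² ≥ 2πc - πc = πc` throughout the window, so the conserved
  -- norm controls `t⁻¹ ∑ v_n²`.
  obtain ⟨T, hT⟩ := hP.uniform_mul_norm_phaseIntegral_sq hΛ hΛ' hχ hq hχq hq' hgC hgc
    (hgs.trans hfs) hp hJ (ε := Real.pi * c) (by positivity)
  refine ⟨(Real.pi * c)⁻¹ * ((∫ y in Λ, ‖f y‖ ^ 2) + 1), ?_⟩
  filter_upwards [eventually_ge_atTop T, eventually_gt_atTop 0,
    hlim.eventually_le_const (lt_add_one _)] with t htT ht0 htl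
  have hpc : 0 < Real.pi * c := by positivity
  have key : Real.pi * c * ∑' n, (velocityWindow x p P t).indicator (fun n => v n ^ 2) n ≤
      t * ∑' n, v n ^ 2 * ‖phaseIntegral ω χ x Φ g 1 n t‖ ^ 2 := by
    rw [← tsum_mul_left, ← tsum_mul_left]
    refine Summable.tsum_le_tsum (fun n => ?_)
      ((summable_indicator_velocityWindow hP.x_tendsto p P ht0 _).mul_left _)
      ((hsm t ht0).mul_left _)
    by_cases hn : n ∈ velocityWindow x p P t
    · rw [Set.indicator_of_mem hn]
      have h1 := (abs_le.1 (hT t htT n hn)).1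
      have h2 := mul_le_mul_of_nonneg_left (hcle _ hn) (by positivity : 0 ≤ 2 * Real.pi)
      have h3 : Real.pi * c ≤ t * ‖phaseIntegral ω χ x Φ g 1 n t‖ ^ 2 := by linarith
      calc _ ≤ (t * ‖phaseIntegral ω χ x Φ g 1 n t‖ ^ 2) * v n ^ 2 := by gcongr
        _ = _ := by ring
    · rw [Set.indicator_of_notMem hn, mul_zero]
      positivity
  rw [inv_mul_le_iff₀ ht0, mul_left_comm, ← inv_mul_le_iff₀ (inv_pos.2 hpc), inv_inv]
  exact key.trans (mul_le_mul_of_nonneg_left htl ht0.le)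

/-- Only the indices with velocity in a neighbourhood of the velocities of `supp f` matter. -/
theorem tendsto_tsum_indicator_phaseIntegral (hP : PolynomialAsymptotics a b Λ κ ω v x Φ)
    (hΛ : IsOpen Λ) (hΛ' : Λ.OrdConnected) (hne : Λ.Nonempty) {χ q : ℝ → ℝ}
    (hχ : ContDiffOn ℝ (⊤ : ℕ∞) χ Λ) (hq : ContDiffOn ℝ (⊤ : ℕ∞) q Λ)
    (hχq : ∀ y ∈ Λ, deriv χ y = q y * deriv ω y) (hq0 : ∀ y ∈ Λ, 0 < q y) {g : ℝ → ℂ}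
    (hg : ContDiff ℝ (⊤ : ℕ∞) g) (hgc : HasCompactSupport g) {α β : ℝ} (hI : Set.Icc α β ⊆ Λ)
    (hgs : tsupport g ⊆ Set.Ioo α β) {p P : ℝ} (hp : 0 < p)
    (hqI : q '' Set.Icc α β ⊆ Set.Ioo p P) {c : ℝ}
    (hsm : ∀ t : ℝ, 0 < t → Summable fun n => v n ^ 2 * ‖phaseIntegral ω χ x Φ g 1 n t‖ ^ 2)
    (hlim : Tendsto (fun t : ℝ => ∑' n, v n ^ 2 * ‖phaseIntegral ω χ x Φ g 1 n t‖ ^ 2)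
      atTop (𝓝 c)) :
    Tendsto (fun t : ℝ => ∑' n, (velocityWindow x p P t).indicator
      (fun n => v n ^ 2 * ‖phaseIntegral ω χ x Φ g 1 n t‖ ^ 2) n) atTop (𝓝 c) := by
  have hχ' : ∀ y ∈ Λ, 0 < deriv χ y := fun y hy => by
    rw [hχq y hy]
    exact mul_pos (hq0 y hy) (hP.ω_deriv_pos y hy)
  have hgΛ : tsupport g ⊆ Λ := hgs.trans (Set.Ioo_subset_Icc_self.trans hI)
  obtain ⟨B, hBs, hB0, hB⟩ := hP.exists_summable_bound hΛ hχ hI hg hgc hgs 1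
    {r | x r.1 / r.2 ∉ Set.Icc p P} (hP.exists_le_abs_deriv_pos hΛ hχq hq.continuousOn hI
      isCompact_Icc hp (fun y hy => (hqI (Set.mem_image_of_mem _ hy)).1)
      fun y hy => (hqI (Set.mem_image_of_mem _ hy)).2)
  set u : ℝ → ℕ → ℝ := fun t n => v n ^ 2 * ‖phaseIntegral ω χ x Φ g 1 n t‖ ^ 2 with hu
  have hu0 : ∀ t n, 0 ≤ u t n := fun t n => by positivity
  have hpt : ∀ n, Tendsto (fun t => u t n) atTop (𝓝 0) := fun n => by
    simpa using ((tendsto_phaseIntegral_zero (x := x) hΛ hΛ' hne hP.ω_smooth hP.Φ_smooth hχ hχ'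
      hg hgc hgΛ 1 n).norm.pow 2).const_mul (v n ^ 2)
  have hout : Tendsto (fun t : ℝ => ∑' n, (velocityWindow x p P t)ᶜ.indicator (u t) n) atTop
      (𝓝 0) := by
    have := tendsto_tsum_of_dominated_convergence (f := fun t n =>
        (velocityWindow x p P t)ᶜ.indicator (u t) n) (g := fun _ => (0 : ℝ)) (𝓕 := atTop) hBs
      (fun n => squeeze_zero (fun t => Set.indicator_nonneg (fun n _ => hu0 t n) n)
        (fun t => Set.indicator_le_self' (fun n _ => hu0 t n) n) (hpt n)) (by
      filter_upwards [eventually_gt_atTop 0] with t ht n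
      rw [Real.norm_of_nonneg (Set.indicator_nonneg (fun n _ => hu0 t n) n)]
      by_cases hn : n ∈ velocityWindow x p P t
      · rw [Set.indicator_of_notMem (Set.notMem_compl_iff.2 hn)]
        exact hB0 n
      · rw [Set.indicator_of_mem hn]
        exact hB n t ht hn)
    simpa using this
  have := hlim.sub hout
  rw [sub_zero] at this
  refine this.congr' ?_
  filter_upwards [eventually_gt_atTop 0] with t ht
  have h1 := (hsm t ht).indicator (velocityWindow x p P t)
  have h2 := (hsm t ht).indicator (velocityWindow x p P t)ᶜ
  rw [sub_eq_iff_eq_add, ← h1.tsum_add h2]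
  exact tsum_congr fun n =>
    (congrFun (Set.indicator_self_add_compl (velocityWindow x p P t) (u t)) n).symm

/-- The weighted sum of the stationary densities reproduces the norm of `f`. -/
theorem tendsto_tsum_stationaryDensity (hP : PolynomialAsymptotics a b Λ κ ω v x Φ) (hΛ : IsOpen Λ)
    (hΛ' : Λ.OrdConnected) (hne : Λ.Nonempty) {τ : ℝ → ℝ} (hτ : ContDiffOn ℝ (⊤ : ℕ∞) τ Λ)
    (hτpos : ∀ y ∈ Λ, 0 < τ y) {χ q : ℝ → ℝ} (hχ : ContDiffOn ℝ (⊤ : ℕ∞) χ Λ)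
    (hq : ContDiffOn ℝ (⊤ : ℕ∞) q Λ) (hχq : ∀ y ∈ Λ, deriv χ y = q y * deriv ω y)
    (hq0 : ∀ y ∈ Λ, 0 < q y) (hq' : ∀ y ∈ Λ, deriv q y ≠ 0)
    (hsum : ∀ f : ℝ → ℂ, ContDiff ℝ (⊤ : ℕ∞) f → HasCompactSupport f → tsupport f ⊆ Λ → ∀ t : ℝ,
      HasSum (fun n => ‖∫ y, (((orthoPoly a b n).eval y * √(τ y) : ℝ) : ℂ) * f y *
        Complex.exp (Complex.I * (-(t * χ y) : ℝ))‖ ^ 2) (∫ y in Λ, ‖f y‖ ^ 2))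
    {f : ℝ → ℂ} (hf : ContDiff ℝ (⊤ : ℕ∞) f) (hfc : HasCompactSupport f) {α β : ℝ}
    (hI : Set.Icc α β ⊆ Λ) (hfs : tsupport f ⊆ Set.Ioo α β) {p P : ℝ} (hp : 0 < p)
    (hqI : q '' Set.Icc α β ⊆ Set.Ioo p P) (hJ : Set.Icc p P ⊆ q '' Λ) :
    Tendsto (fun t : ℝ => 2 * Real.pi * (t⁻¹ * ∑' n, (velocityWindow x p P t).indicator
      (fun n => v n ^ 2 * stationaryDensity Λ ω q (amplitude τ κ f) (x n / t)) n)) atTop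
      (𝓝 (∫ y in Λ, ‖f y‖ ^ 2)) := by
  have hfΛ : tsupport f ⊆ Λ := hfs.trans (Set.Ioo_subset_Icc_self.trans hI)
  set g := amplitude τ κ f with hg
  have hgs : tsupport g ⊆ tsupport f := tsupport_amplitude_subset τ κ f
  have hgC : ContDiff ℝ (⊤ : ℕ∞) g := contDiff_amplitude hΛ hτ hτpos hP.κ_smooth hf hfΛ
  have hgc : HasCompactSupport g := hfc.mono' fun y hy => hgs (subset_tsupport _ hy)
  have hχ' : ∀ y ∈ Λ, 0 < deriv χ y := fun y hy => by
    rw [hχq y hy]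
    exact mul_pos (hq0 y hy) (hP.ω_deriv_pos y hy)
  obtain ⟨hsm, hlim⟩ := hP.tendsto_tsum_phaseIntegral hΛ hΛ' hne hτ hτpos hχ hχ' hf hfc hfΛ
    (hsum f hf hfc hfΛ)
  have hwin := hP.tendsto_tsum_indicator_phaseIntegral hΛ hΛ' hne hχ hq hχq hq0 hgC hgc hI
    (hgs.trans hfs) hp hqI hsm hlim
  obtain ⟨M, hM⟩ := hP.exists_sum_velocityWindow_le hΛ hΛ' hne hτ hτpos hχ hq hχq hq0 hq' hsum hp hJ
  set W := velocityWindow x p P with hW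
  set u : ℝ → ℕ → ℝ := fun t n => v n ^ 2 * ‖phaseIntegral ω χ x Φ g 1 n t‖ ^ 2 with hu
  set d : ℝ → ℕ → ℝ := fun t n => v n ^ 2 * stationaryDensity Λ ω q g (x n / t) with hd
  have hs : ∀ {t : ℝ}, 0 < t → ∀ r : ℕ → ℝ, Summable ((W t).indicator r) := fun ht r =>
    summable_indicator_velocityWindow hP.x_tendsto p P ht r
  have hdiff : Tendsto (fun t : ℝ => 2 * Real.pi * (t⁻¹ * ∑' n, (W t).indicator (d t) n) -
      ∑' n, (W t).indicator (u t) n) atTop (𝓝 0) := by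
    rw [Metric.tendsto_nhds]
    intro ε hε
    have hM1 : 0 < |M| + 1 := by positivity
    -- The uniform error is multiplied by `t⁻¹ ∑ v_n² ≤ |M|` when summed over the window; `|M| + 1`
    -- also avoids division by zero.
    obtain ⟨T, hT⟩ := hP.uniform_mul_norm_phaseIntegral_sq hΛ hΛ' hχ hq hχq hq' hgC hgc
      (hgs.trans hfΛ) hp hJ (ε := ε / (|M| + 1)) (by positivity)
    filter_upwards [eventually_ge_atTop T, eventually_gt_atTop 0, hM] with t htT ht0 htM
    rw [dist_zero_right, Real.norm_eq_abs]
    have e1 : 2 * Real.pi * (t⁻¹ * ∑' n, (W t).indicator (d t) n) -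
        ∑' n, (W t).indicator (u t) n =
        ∑' n, (2 * Real.pi * (t⁻¹ * (W t).indicator (d t) n) - (W t).indicator (u t) n) := by
      rw [← tsum_mul_left, ← tsum_mul_left]
      exact ((((hs ht0 (d t)).mul_left _).mul_left _).tsum_sub (hs ht0 (u t))).symm
    have hle : ∀ n, ‖2 * Real.pi * (t⁻¹ * (W t).indicator (d t) n) - (W t).indicator (u t) n‖ ≤
        ε / (|M| + 1) * (t⁻¹ * (W t).indicator (fun n => v n ^ 2) n) := by
      intro n
      by_cases hn : n ∈ W t
      · simp only [Set.indicator_of_mem hn]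
        have e2 : 2 * Real.pi * (t⁻¹ * d t n) - u t n = -(t⁻¹ * v n ^ 2 *
            (t * ‖phaseIntegral ω χ x Φ g 1 n t‖ ^ 2 -
              2 * Real.pi * stationaryDensity Λ ω q g (x n / t))) := by
          simp only [hu, hd]
          field_simp
          ring
        rw [e2, norm_neg, norm_mul, Real.norm_of_nonneg (by positivity), Real.norm_eq_abs,
          mul_comm (ε / (|M| + 1))]
        exact mul_le_mul_of_nonneg_left (hT t htT n hn) (by positivity)
      · simp [Set.indicator_of_notMem hn]
    have hb := tsum_of_norm_bounded
      (((hs ht0 (fun n => v n ^ 2)).mul_left t⁻¹).mul_left (ε / (|M| + 1))).hasSum hle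
    rw [e1, ← Real.norm_eq_abs]
    refine hb.trans_lt ?_
    rw [tsum_mul_left, tsum_mul_left]
    calc ε / (|M| + 1) * (t⁻¹ * ∑' n, (W t).indicator (fun n => v n ^ 2) n)
        ≤ ε / (|M| + 1) * |M| := by
          gcongr
          exact htM.trans (le_abs_self M)
      _ < ε := by
          rw [div_mul_eq_mul_div, div_lt_iff₀ hM1]
          nlinarith
  have h := hdiff.add hwin
  rw [zero_add] at h
  exact h.congr fun t => sub_add_cancel _ _

end PolynomialAsymptotics

/-! ### Identification of the profile and conclusion. -/

/-- With `q = θ' ∘ ω` one has `h' = 1 / θ''` and `q' = θ'' ω'`, so both sides equal `κ² τ |f|² /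
(ω'² |θ''|)` at `z`. -/
theorem norm_evolutionProfile_sq {Λ : Set ℝ} (hΛ : IsOpen Λ) (hΛ' : Λ.OrdConnected)
    {ω θ : ℝ → ℝ} (hω : ContDiffOn ℝ (⊤ : ℕ∞) ω Λ) (hω' : ∀ y ∈ Λ, 0 < deriv ω y)
    (hθ : ContDiffOn ℝ (⊤ : ℕ∞) θ (ω '' Λ)) (hθ2 : ∀ μ ∈ ω '' Λ, deriv (deriv θ) μ ≠ 0)
    (τ κ : ℝ → ℝ) (f : ℝ → ℂ) {z : ℝ} (hz : z ∈ Λ) :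
    ‖evolutionProfile Λ τ κ ω θ f (deriv θ (ω z))‖ ^ 2 =
      stationaryDensity Λ ω (fun y => deriv θ (ω y)) (amplitude τ κ f) (deriv θ (ω z)) := by
  have hω0 : ∀ y ∈ Λ, deriv ω y ≠ 0 := fun y hy => (hω' y hy).ne'
  have hΔ : IsOpen (ω '' Λ) := isOpen_image_of_deriv_ne_zero hΛ hω hω0
  have hΔ' : (ω '' Λ).OrdConnected :=
    (hΛ'.isPreconnected.image ω hω.continuousOn).ordConnected
  have hωinj := injOn_of_deriv_ne_zero hΛ' hω.continuousOn hω0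
  have hdθ : ContDiffOn ℝ (⊤ : ℕ∞) (deriv θ) (ω '' Λ) := hθ.deriv_of_isOpen hΔ (by simp)
  have hθinj := injOn_of_deriv_ne_zero hΔ' hdθ.continuousOn hθ2
  have hinj : Set.InjOn (fun y => deriv θ (ω y)) Λ :=
    hθinj.comp hωinj (Set.mapsTo_image ω Λ)
  have hμ : ω z ∈ ω '' Λ := Set.mem_image_of_mem _ hz
  have h1 : derivInverse Λ ω θ (deriv θ (ω z)) = ω z := hθinj.leftInvOn_invFunOn hμ
  have h2 : deriv (derivInverse Λ ω θ) (deriv θ (ω z)) = (deriv (deriv θ) (ω z))⁻¹ :=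
    (hasDerivAt_invFunOn hΔ hdθ hθ2 hθinj hμ).deriv
  have h3 : Function.invFunOn ω Λ (ω z) = z := hωinj.leftInvOn_invFunOn hz
  have h4 : Function.invFunOn (fun y => deriv θ (ω y)) Λ (deriv θ (ω z)) = z :=
    hinj.leftInvOn_invFunOn hz
  have h5 : deriv (fun y => deriv θ (ω y)) z = deriv (deriv θ) (ω z) * deriv ω z :=
    ((hdθ.hasStrictDerivAt_deriv hΔ hμ).hasDerivAt.comp z
      (hω.hasStrictDerivAt_deriv hΛ hz).hasDerivAt).deriv
  have hp := hω' z hz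
  have hq := abs_pos.2 (hθ2 _ hμ)
  rw [evolutionProfile, h1, h2, transportedAmplitude, stationaryDensity, h4, h5, amplitude]
  simp only [h3, norm_mul, Complex.norm_real, mul_pow, Real.norm_eq_abs, abs_mul, abs_inv,
    abs_of_pos hp, abs_of_nonneg (Real.sqrt_nonneg _)]
  rw [Real.sq_sqrt (inv_nonneg.2 hq.le)]
  field_simp

theorem stationaryDensity_eq_zero {Λ : Set ℝ} {ω q : ℝ → ℝ} {g : ℝ → ℂ} {p P : ℝ}
    (hqg : ∀ y ∈ Λ, g y ≠ 0 → q y ∈ Set.Icc p P) {s : ℝ} (hs : s ∈ q '' Λ)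
    (hsJ : s ∉ Set.Icc p P) : stationaryDensity Λ ω q g s = 0 := by
  have h : g (Function.invFunOn q Λ s) = 0 := by
    by_contra h
    have := hqg _ (Function.invFunOn_mem hs) h
    rw [Function.invFunOn_eq hs] at this
    exact hsJ this
  rw [stationaryDensity, h]
  simp

theorem corollary4p5
    -- the Jacobi operator: a self-adjoint extension of the minimal operator
    (a b : ℕ → ℝ) (ha : ∀ n, 0 < a n)
    (J : EllTwo →ₗ.[ℂ] EllTwo) (hJ : IsSelfAdjoint J) (hJext : minimalJacobi a b ≤ J)
    (E : ProjValuedMeasure) (hE : E.IsSpectralMeasureOf J)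
    -- the open interval where the spectral measure has a smooth positive density
    (Λ : Set ℝ) (hΛ : IsOpen Λ) (hΛ' : Λ.OrdConnected)
    (τ : ℝ → ℝ) (hτ : ContDiffOn ℝ (⊤ : ℕ∞) τ Λ) (hτpos : ∀ y ∈ Λ, 0 < τ y)
    (hρ : E.scalar.restrict Λ =
      (volume.restrict Λ).withDensity (fun y => ENNReal.ofReal (τ y)))
    -- the asymptotics of the orthonormal polynomials
    (κ ω : ℝ → ℝ) (v x : ℕ → ℝ) (Φ : ℕ → ℝ → ℝ)
    (hP : PolynomialAsymptotics a b Λ κ ω v x Φ)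
    -- the function `θ` on `ω(Λ)`
    (θ : ℝ → ℝ) (hθ : ContDiffOn ℝ (⊤ : ℕ∞) θ (ω '' Λ))
    (hθ1 : ∀ μ ∈ ω '' Λ, 0 < deriv θ μ) (hθ2 : ∀ μ ∈ ω '' Λ, deriv (deriv θ) μ ≠ 0)
    -- a test function on `Λ`
    (f : ℝ → ℂ) (hf : ContDiff ℝ (⊤ : ℕ∞) f) (hfc : HasCompactSupport f) (hfs : tsupport f ⊆ Λ) :
    (∀ t : ℝ, 0 < t →
      Summable fun n : {n : ℕ // x n / t ∈ deriv θ '' (ω '' Λ)} =>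
        v n ^ 2 * ‖evolutionProfile Λ τ κ ω θ f (x n / t)‖ ^ 2) ∧
    Tendsto (fun t : ℝ => 2 * Real.pi * (t⁻¹ *
        ∑' n : {n : ℕ // x n / t ∈ deriv θ '' (ω '' Λ)},
          v n ^ 2 * ‖evolutionProfile Λ τ κ ω θ f (x n / t)‖ ^ 2))
      atTop (𝓝 (∫ y in Λ, ‖f y‖ ^ 2)) := by
  rcases Λ.eq_empty_or_nonempty with rfl | hne
  · have : ∀ t : ℝ, IsEmpty {n : ℕ // x n / t ∈ deriv θ '' (ω '' (∅ : Set ℝ))} := fun t =>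
      ⟨fun n => by simpa using n.2⟩
    refine ⟨fun t _ => summable_empty, ?_⟩
    simp
  have hω0 : ∀ y ∈ Λ, deriv ω y ≠ 0 := fun y hy => (hP.ω_deriv_pos y hy).ne'
  have hΔ : IsOpen (ω '' Λ) := isOpen_image_of_deriv_ne_zero hΛ hP.ω_smooth hω0
  have hdθ : ContDiffOn ℝ (⊤ : ℕ∞) (deriv θ) (ω '' Λ) := hθ.deriv_of_isOpen hΔ (by simp)
  have hmaps : Set.MapsTo ω Λ (ω '' Λ) := Set.mapsTo_image ω Λ
  set χ : ℝ → ℝ := fun y => θ (ω y) with hχdef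
  set q : ℝ → ℝ := fun y => deriv θ (ω y) with hqdef
  have hχ : ContDiffOn ℝ (⊤ : ℕ∞) χ Λ := hθ.comp hP.ω_smooth hmaps
  have hq : ContDiffOn ℝ (⊤ : ℕ∞) q Λ := hdθ.comp hP.ω_smooth hmaps
  have hχq : ∀ y ∈ Λ, deriv χ y = q y * deriv ω y := fun y hy =>
    ((hθ.hasStrictDerivAt_deriv hΔ (hmaps hy)).hasDerivAt.comp y
      (hP.ω_smooth.hasStrictDerivAt_deriv hΛ hy).hasDerivAt).deriv
  have hq0 : ∀ y ∈ Λ, 0 < q y := fun y hy => hθ1 _ (hmaps hy)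
  have hq' : ∀ y ∈ Λ, deriv q y ≠ 0 := fun y hy => by
    have : deriv q y = deriv (deriv θ) (ω y) * deriv ω y :=
      ((hdθ.hasStrictDerivAt_deriv hΔ (hmaps hy)).hasDerivAt.comp y
        (hP.ω_smooth.hasStrictDerivAt_deriv hΛ hy).hasDerivAt).deriv
    rw [this]
    exact mul_ne_zero (hθ2 _ (hmaps hy)) (hω0 y hy)
  have himage : deriv θ '' (ω '' Λ) = q '' Λ := Set.image_image _ _ _
  obtain ⟨α, β, -, hK, hI⟩ := exists_Icc_subset_of_isCompact hΛ hΛ' hne hfc.isCompact hfs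
  -- The window must lie inside `q(Λ)`, for stationary phase, and contain the velocities of `[α, β]`
  -- in its interior, for the decay outside.
  obtain ⟨p, P, hpP, hqI, hJΛ⟩ := exists_Icc_subset_of_isCompact
    (isOpen_image_of_deriv_ne_zero hΛ hq hq')
    (hΛ'.isPreconnected.image q hq.continuousOn).ordConnected (hne.image q)
    (isCompact_Icc.image_of_continuousOn (hq.continuousOn.mono hI)) (Set.image_mono hI)
  have hp : 0 < p := by
    obtain ⟨y, hy, hyp⟩ := hJΛ (Set.left_mem_Icc.2 hpP.le)
    exact hyp ▸ hq0 y hy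
  -- The window lies in `𝓘`, and the profile vanishes on the rest of `𝓘`. So the series is a finite
  -- sum for each `t > 0`, whence its convergence.
  have key : ∀ t : ℝ, {n : ℕ | x n / t ∈ deriv θ '' (ω '' Λ)}.indicator
      (fun n => v n ^ 2 * ‖evolutionProfile Λ τ κ ω θ f (x n / t)‖ ^ 2) =
      (velocityWindow x p P t).indicator
        (fun n => v n ^ 2 * stationaryDensity Λ ω q (amplitude τ κ f) (x n / t)) := by
    intro t
    have hS : {n : ℕ | x n / t ∈ deriv θ '' (ω '' Λ)} = {n : ℕ | x n / t ∈ q '' Λ} := by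
      rw [himage]
    funext n
    rw [hS]
    by_cases hn : x n / t ∈ q '' Λ
    · rw [Set.indicator_of_mem (s := {n : ℕ | x n / t ∈ q '' Λ}) hn]
      obtain ⟨z, hz, hzn⟩ := id hn
      have hnorm := norm_evolutionProfile_sq hΛ hΛ' hP.ω_smooth hP.ω_deriv_pos hθ hθ2 τ κ f hz
      rw [show deriv θ (ω z) = x n / t from hzn] at hnorm
      rw [hnorm]
      by_cases hw : n ∈ velocityWindow x p P t
      · rw [Set.indicator_of_mem hw]
      · rw [Set.indicator_of_notMem hw]
        refine mul_eq_zero_of_right _ (stationaryDensity_eq_zero (fun y _ hy => ?_) hn hw)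
        exact Set.Ioo_subset_Icc_self (hqI (Set.mem_image_of_mem _ (Set.Ioo_subset_Icc_self
          (hK (tsupport_amplitude_subset τ κ f (subset_tsupport _ hy))))))
    · rw [Set.indicator_of_notMem (s := {n : ℕ | x n / t ∈ q '' Λ}) hn,
        Set.indicator_of_notMem (s := velocityWindow x p P t) fun hw => hn (hJΛ hw)]
  refine ⟨fun t ht => ?_, ?_⟩
  · have h := summable_indicator_velocityWindow hP.x_tendsto p P ht
      fun n => v n ^ 2 * stationaryDensity Λ ω q (amplitude τ κ f) (x n / t)
    rw [← key] at h
    exact summable_subtype_iff_indicator.2 h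
  · refine (hP.tendsto_tsum_stationaryDensity hΛ hΛ' hne hτ hτpos hχ hq hχq hq0 hq'
      (fun f hf hfc hfs t => hE.hasSum_norm_sq_of_density hJ ha hJext hΛ hτ.continuousOn hτpos hρ
        hf.continuous hfc hfs (φ := fun y => -(t * χ y))
        (continuousOn_const.mul hχ.continuousOn).neg)
      hf hfc hI hK hp hqI hJΛ).congr fun t => ?_
    rw [← key]
    exact congrArg (fun r => 2 * Real.pi * (t⁻¹ * r))
      (tsum_subtype {n : ℕ | x n / t ∈ deriv θ '' (ω '' Λ)}
        (fun n => v n ^ 2 * ‖evolutionProfile Λ τ κ ω θ f (x n / t)‖ ^ 2)).symm
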